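/- **Setting.** Work on $\mathbb R^3$; indices $i,\alpha\in\{1,2,3\}$, repeated indices are summed, $\mu>0$, $T_{\rm fin}>0$, and $T:\mathbb R^{3\times3}\to\mathbb R^{3\times 3}$ is $C^\infty$. For $\epsilon>0$ the relaxation system is $$\partial_t\bar F_{i\alpha}-\partial_\alpha\bar v_i=0,\qquad \partial_t\bar v_i-\partial_\alpha\bar S_{i\alpha}=0,\qquad \partial_t\bar S_{i\alpha}-\tfrac{\mu}{\epsilon}\partial_\alpha\bar v_i=-\tfrac1\epsilon\bar S_{i\alpha}+\tfrac1\epsilon T_{i\alpha}(\bar F),\tag{R}$$ and the (incompletely parabolic) equilibrium system is $$\partial_t\hat F_{i\alpha}-\partial_\alpha\hat v_i=0,\qquad \partial_t\hat v_i-\partial_\alpha T_{i\alpha}(\hat F)=\mu\,\Delta\hat v_i.\tag{E}$$ For $W=(F,v,S)\in H^3(\mathbb R^3;\mathbb R^{3\times3}\times\mathbb R^3\times\mathbb R^{3\times3})$ put $$E^\epsilon(W)=\int_{\mathbb R^3}\Big(\tfrac\mu\epsilon|F|^2-2F_{i\alpha}S_{i\alpha}+\big(\tfrac\mu\epsilon-1\big)|v|^2+|S|^2\Big)dx,\qquad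 \mathcal E^\epsilon(W)=\sum_{|\gamma|\le3}\epsilon\,E^\epsilon(\partial_\gamma W).$$ **Theorem.** Let $(\hat F,\hat v)\in C^1([0,T_{\rm fin}];H^4(\mathbb R^3))$ be a solution of (E) and put $\hat S=T(\hat F)+\mu\nabla\hat v$, i.e. $\hat S_{i\alpha}=T_{i\alpha}(\hat F)+\mu\,\partial_\alpha\hat v_i$. For every $\epsilon>0$ let initial data $(\bar F^\epsilon_0,\bar v^\epsilon_0,\bar S^\epsilon_0)\in H^3(\mathbb R^3)$ be given whose deviation $$W^\epsilon_0=(\bar F^\epsilon_0-\hat F(\cdot,0),\ \bar v^\epsilon_0-\hat v(\cdot,0),\ \bar S^\epsilon_0-\hat S(\cdot,0))$$ lies in $H^3(\mathbb R^3)$ (so that $\mathcal E^\epsilon(W_0^\epsilon)$ makes sense), and assume that they are well prepared: $\mathcal E^\epsilon(W^\epsilon_0)\to0$ as $\epsilon\downarrow0$. Then there are $\epsilon_0>0$ and $C>0$ such that for every $0<\epsilon\le\epsilon_0$ the system (R) has, on the whole $\epsilon$-independent interval $[0,T_{\rm fin}]$, a unique strong solution $(\bar F,\bar v,\bar S)\in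 C([0,T_{\rm fin}];H^3)\cap C^1([0,T_{\rm fin}];H^2)$ with these initial data; its deviation $W^\epsilon(t)=(\bar F-\hat F,\bar v-\hat v,\bar S-\hat S)(\cdot,t)$ lies in $H^3(\mathbb R^3)$ and satisfies $$\mathcal E^\epsilon(W^\epsilon(t))\le C\big(\epsilon^2+\mathcal E^\epsilon(W^\epsilon_0)\big)\qquad\text{for all }t\in[0,T_{\rm fin}].$$ In particular, as $\epsilon\downarrow0$, $\bar F-\hat F\to0$, $\bar v-\hat v\to0$ and $\sqrt\epsilon\,(\bar S-\hat S)\to0$ in $H^3(\mathbb R^3)$, uniformly on $[0,T_{\rm fin}]$. -/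

import Mathlib

open MeasureTheory Filter Topology Set
open scoped ContDiff

noncomputable section

namespace Visco

/-! ### Function spaces on `ℝ³` -/

/-- The physical space `ℝ³` with its Euclidean norm and Lebesgue measure. -/
abbrev X : Type := EuclideanSpace ℝ (Fin 3)

/-- Velocities, with values in `ℝ³`. -/
abbrev Vec : Type := EuclideanSpace ℝ (Fin 3)

/-- Real `3 × 3` matrices with the Frobenius inner product; the entry of `A` in row `i` and
column `α` is `A (i, α)`. -/
abbrev Mat : Type := EuclideanSpace ℝ (Fin 3 × Fin 3)

/-- `L²(ℝ³; V)`. -/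
abbrev L2 (V : Type) [NormedAddCommGroup V] : Type := Lp V 2 (volume : Measure X)

/-- The classical partial derivative `∂_i φ`. -/
def partialD (i : Fin 3) (φ : X → ℝ) : X → ℝ :=
  fun x => fderiv ℝ φ x (EuclideanSpace.single i 1)

/-- The classical derivative `∂^γ φ` for a multi-index `γ`. -/
def multiD (γ : Fin 3 → ℕ) (φ : X → ℝ) : X → ℝ :=
  (partialD 0)^[γ 0] ((partialD 1)^[γ 1] ((partialD 2)^[γ 2] φ))

/-- Test functions: `φ ∈ C_c^∞(ℝ³)`. -/
def IsTest (φ : X → ℝ) : Prop := ContDiff ℝ ∞ φ ∧ HasCompactSupport φ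

/-- The finite set of multi-indices `γ` with `|γ| ≤ k`. -/
def multiIdx (k : ℕ) : Finset (Fin 3 → ℕ) :=
  (Fintype.piFinset fun _ => Finset.range (k + 1)).filter fun γ => ∑ i, γ i ≤ k

theorem mem_multiIdx {k : ℕ} {γ : Fin 3 → ℕ} : γ ∈ multiIdx k ↔ ∑ i, γ i ≤ k := by
  simp only [multiIdx, Finset.mem_filter, Fintype.mem_piFinset, Finset.mem_range,
    and_iff_right_iff_imp]
  intro h i
  have := Finset.single_le_sum (f := γ) (fun j _ => Nat.zero_le _) (Finset.mem_univ i)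
  omega

theorem multiIdx_mono {k l : ℕ} (h : k ≤ l) {γ : Fin 3 → ℕ} (hγ : γ ∈ multiIdx k) :
    γ ∈ multiIdx l :=
  mem_multiIdx.2 ((mem_multiIdx.1 hγ).trans h)

theorem zero_mem_multiIdx (k : ℕ) : (0 : Fin 3 → ℕ) ∈ multiIdx k := by
  simp [mem_multiIdx]

theorem IsTest.partialD {φ : X → ℝ} (h : IsTest φ) (i : Fin 3) : IsTest (partialD i φ) := by
  refine ⟨?_, ?_⟩
  · exact (h.1.fderiv_right (m := ∞) (by simp)).clm_apply contDiff_const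
  · exact h.2.fderiv_apply (𝕜 := ℝ) _

theorem IsTest.iterate {φ : X → ℝ} (h : IsTest φ) (i : Fin 3) (n : ℕ) :
    IsTest ((Visco.partialD i)^[n] φ) := by
  induction n with
  | zero => exact h
  | succ n ih => rw [Function.iterate_succ_apply']; exact ih.partialD i

theorem IsTest.multiD {φ : X → ℝ} (h : IsTest φ) (γ : Fin 3 → ℕ) : IsTest (multiD γ φ) :=
  ((h.iterate 2 _).iterate 1 _).iterate 0 _

section

variable {V : Type} [NormedAddCommGroup V] [InnerProductSpace ℝ V]

/-- `g` is the weak derivative `∂^γ f`: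
`∫ f ∂^γ φ = (-1)^{|γ|} ∫ g φ` for all test functions `φ`. -/
def IsWeakDeriv (γ : Fin 3 → ℕ) (f g : X → V) : Prop :=
  ∀ φ : X → ℝ, IsTest φ →
    ∫ x, multiD γ φ x • f x = (-1 : ℝ) ^ (∑ i, γ i) • ∫ x, φ x • g x

theorem IsTest.integrable_smul {φ : X → ℝ} (h : IsTest φ) (f : L2 V) :
    Integrable (fun x => φ x • f x) :=
  ((Lp.memLp f).locallyIntegrable (by norm_num)).integrable_smul_left_of_hasCompactSupport
    h.1.continuous h.2

theorem IsWeakDeriv.zero (γ : Fin 3 → ℕ) :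
    IsWeakDeriv γ ((0 : L2 V) : X → V) ((0 : L2 V) : X → V) := by
  intro φ _
  have h (ψ : X → ℝ) : ∫ x, ψ x • ((0 : L2 V) : X → V) x = 0 := by
    rw [← integral_zero X V]
    refine integral_congr_ae ?_
    filter_upwards [Lp.coeFn_zero V 2 (volume : Measure X)] with x hx
    simp only [hx, Pi.zero_apply, smul_zero]
  rw [h, h, smul_zero]

theorem IsWeakDeriv.add {γ : Fin 3 → ℕ} {f g f' g' : L2 V} (h : IsWeakDeriv γ f g)
    (h' : IsWeakDeriv γ f' g') : IsWeakDeriv γ (f + f' : L2 V) (g + g' : L2 V) := by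
  intro φ hφ
  have key (ψ : X → ℝ) (hψ : IsTest ψ) (a b : L2 V) :
      ∫ x, ψ x • (a + b : L2 V) x = (∫ x, ψ x • a x) + ∫ x, ψ x • b x := by
    rw [← integral_add (hψ.integrable_smul a) (hψ.integrable_smul b)]
    refine integral_congr_ae ?_
    filter_upwards [Lp.coeFn_add a b] with x hx
    simp only [hx, Pi.add_apply, smul_add]
  rw [key _ (hφ.multiD γ), key _ hφ, h φ hφ, h' φ hφ, smul_add]

theorem IsWeakDeriv.smul {γ : Fin 3 → ℕ} {f g : L2 V} (c : ℝ) (h : IsWeakDeriv γ f g) :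
    IsWeakDeriv γ (c • f : L2 V) (c • g : L2 V) := by
  intro φ hφ
  have key (ψ : X → ℝ) (a : L2 V) : ∫ x, ψ x • (c • a : L2 V) x = c • ∫ x, ψ x • a x := by
    rw [← integral_smul]
    refine integral_congr_ae ?_
    filter_upwards [Lp.coeFn_smul c a] with x hx
    simp only [hx, Pi.smul_apply, smul_comm c]
  rw [key, key, h φ hφ, smul_comm]

variable (V) in
/-- The Sobolev space `H^k(ℝ³; V)`: a function `u ∈ L²` together with its (unique) weak
derivatives `∂^γ u ∈ L²`, `|γ| ≤ k`, stored as the family `(∂^γ u)_{|γ| ≤ k}`. The norm inherited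
from the ambient `ℓ²`-product is `‖u‖² = ∑_{|γ| ≤ k} ‖∂^γ u‖²_{L²}`. -/
def sobolev (k : ℕ) : Submodule ℝ (PiLp 2 fun _ : multiIdx k => L2 V) where
  carrier := {u | ∀ γ : multiIdx k, IsWeakDeriv γ.1 (u ⟨0, zero_mem_multiIdx k⟩) (u γ)}
  zero_mem' := fun γ => IsWeakDeriv.zero γ.1
  add_mem' := fun ha hb γ => (ha γ).add (hb γ)
  smul_mem' := fun c _ ha γ => (ha γ).smul c

/-- `H^k(ℝ³; V)` as a normed space. -/
abbrev Sob (k : ℕ) (V : Type) [NormedAddCommGroup V] [InnerProductSpace ℝ V] : Type :=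
  sobolev V k

/-- The weak derivative `∂^γ u ∈ L²` of `u ∈ H^k`, for `|γ| ≤ k`
(by convention `0` for the other multi-indices, for which it is never used). -/
def Sob.D {k : ℕ} (u : Sob k V) (γ : Fin 3 → ℕ) : L2 V :=
  if h : γ ∈ multiIdx k then u.1 ⟨γ, h⟩ else 0

/-- The underlying function `u`. -/
def Sob.val {k : ℕ} (u : Sob k V) : L2 V := u.D 0

/-- The first order derivative `∂_α u`. -/
def Sob.pd {k : ℕ} (α : Fin 3) (u : Sob k V) : L2 V := u.D (Pi.single α 1)

/-- The inclusion `H^l ⊆ H^k`, `k ≤ l`. -/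
def Sob.incl {k l : ℕ} (h : k ≤ l) (u : Sob l V) : Sob k V :=
  ⟨WithLp.toLp 2 fun γ => u.1 ⟨γ.1, multiIdx_mono h γ.2⟩,
    fun γ => u.2 ⟨γ.1, multiIdx_mono h γ.2⟩⟩

end

/-- Triples `(F, v, S)` in `H^k(ℝ³)`. -/
abbrev State (k : ℕ) : Type := Sob k Mat × Sob k Vec × Sob k Mat

/-- The inclusion `H^l ⊆ H^k`, `k ≤ l`, for triples. -/
def State.incl {k l : ℕ} (h : k ≤ l) (U : State l) : State k :=
  (Sob.incl h U.1, Sob.incl h U.2.1, Sob.incl h U.2.2)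

/-! ### The two systems -/

/-- `(F̂, v̂) ∈ C¹([0,τ]; H⁴)` solves the incompletely parabolic system
`∂ₜ F_{iα} = ∂_α v_i`, `∂ₜ v_i - ∂_α T_{iα}(F) = μ Δ v_i` on `[0,τ]`, where
`∂_α T_{iα}(F)` (summed over `α`) is a distributional divergence. -/
structure IsEquilibriumSolution (T : Mat → Mat) (μ τ : ℝ)
    (F : ℝ → Sob 4 Mat) (v : ℝ → Sob 4 Vec) : Prop where
  contDiffOn_F : ContDiffOn ℝ 1 F (Icc 0 τ)
  contDiffOn_v : ContDiffOn ℝ 1 v (Icc 0 τ)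
  eq_F : ∀ t ∈ Icc 0 τ, ∀ i α : Fin 3, ∀ᵐ x : X,
    (derivWithin F (Icc 0 τ) t).val x (i, α) = (v t).pd α x i
  eq_v : ∀ t ∈ Icc 0 τ, ∀ i : Fin 3, ∀ φ : X → ℝ, IsTest φ →
    ∫ x, φ x * ((derivWithin v (Icc 0 τ) t).val x i
        - μ * ∑ α : Fin 3, (v t).D (Pi.single α 2) x i)
      = - ∫ x, ∑ α : Fin 3, partialD α φ x * T ((F t).val x) (i, α)

/-- `U = (F, v, S)` is a strong solution on `[0,τ]`, with initial datum `U₀`, of the relaxation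
system `∂ₜ F_{iα} = ∂_α v_i`, `∂ₜ v_i = ∂_α S_{iα}`,
`∂ₜ S_{iα} - (μ/ε) ∂_α v_i = -(1/ε) S_{iα} + (1/ε) T_{iα}(F)`:
it belongs to `C([0,τ]; H³) ∩ C¹([0,τ]; H²)` and the equations hold for every `t ∈ [0,τ]` and
almost every `x`. -/
structure IsRelaxationSolution (T : Mat → Mat) (μ ε τ : ℝ) (U₀ : State 3) (U : ℝ → State 3) :
    Prop where
  initial : U 0 = U₀
  continuousOn : ContinuousOn U (Icc 0 τ)
  contDiffOn : ContDiffOn ℝ 1 (fun t => (State.incl (by norm_num) (U t) : State 2)) (Icc 0 τ)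
  eq_F : ∀ t ∈ Icc 0 τ, ∀ i α : Fin 3, ∀ᵐ x : X,
    (derivWithin (fun s => (State.incl (by norm_num) (U s) : State 2)) (Icc 0 τ) t).1.val x (i, α)
      = (U t).2.1.pd α x i
  eq_v : ∀ t ∈ Icc 0 τ, ∀ i : Fin 3, ∀ᵐ x : X,
    (derivWithin (fun s => (State.incl (by norm_num) (U s) : State 2)) (Icc 0 τ) t).2.1.val x i
      = ∑ α : Fin 3, (U t).2.2.pd α x (i, α)
  eq_S : ∀ t ∈ Icc 0 τ, ∀ i α : Fin 3, ∀ᵐ x : X,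
    (derivWithin (fun s => (State.incl (by norm_num) (U s) : State 2)) (Icc 0 τ) t).2.2.val x (i, α)
        - μ / ε * (U t).2.1.pd α x i
      = - (1 / ε) * (U t).2.2.val x (i, α) + 1 / ε * T ((U t).1.val x) (i, α)

/-! ### Deviation from equilibrium and energies -/

/-- The equilibrium stress `Ŝ_{iα} = T_{iα}(F̂) + μ ∂_α v̂_i` as a function on `ℝ³`. -/
def equilibriumStress (T : Mat → Mat) (μ : ℝ) (F : Sob 4 Mat) (v : Sob 4 Vec) : X → Mat :=
  fun x => T (F.val x) + μ • WithLp.toLp 2 fun p : Fin 3 × Fin 3 => v.pd p.2 x p.1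

/-- `W ∈ H³` is the deviation `(F̄ - F̂, v̄ - v̂, S̄ - Ŝ)` of `U = (F̄, v̄, S̄)` from the equilibrium
`(F̂, v̂, Ŝ)`, `Ŝ = T(F̂) + μ ∇v̂`. -/
structure IsDeviation (T : Mat → Mat) (μ : ℝ) (F : Sob 4 Mat) (v : Sob 4 Vec)
    (U W : State 3) : Prop where
  fst : W.1 = U.1 - Sob.incl (by norm_num) F
  snd : W.2.1 = U.2.1 - Sob.incl (by norm_num) v
  trd : ∀ᵐ x : X, W.2.2.val x = U.2.2.val x - equilibriumStress T μ F v x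

/-- The symmetrizer
`B^ε = [[μ/ε I, 0, -I], [0, (μ/ε - 1) I, 0], [-I, 0, I]]` acting on `L²` triples `(F, v, S)`. -/
def symmetrizer (μ ε : ℝ) (w : L2 Mat × L2 Vec × L2 Mat) : L2 Mat × L2 Vec × L2 Mat :=
  ((μ / ε) • w.1 - w.2.2, (μ / ε - 1) • w.2.1, -w.1 + w.2.2)

/-- The energy `E^ε(w) = ⟨B^ε w, w⟩_{L²}`. -/
def energy (μ ε : ℝ) (w : L2 Mat × L2 Vec × L2 Mat) : ℝ :=
  inner ℝ (symmetrizer μ ε w).1 w.1 + inner ℝ (symmetrizer μ ε w).2.1 w.2.1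
    + inner ℝ (symmetrizer μ ε w).2.2 w.2.2

/-- The high-order energy `𝓔^ε(W) = ∑_{|γ| ≤ 3} ε E^ε(∂^γ W)`. -/
def highEnergy (μ ε : ℝ) (W : State 3) : ℝ :=
  ∑ γ ∈ multiIdx 3, ε * energy μ ε (W.1.D γ, W.2.1.D γ, W.2.2.D γ)

end Visco

end

open Visco

noncomputable section

namespace Visco

/-! ### Calculus of test functions -/

/-! The equilibrium (F̂, v̂, Ŝ) with Ŝ = T(F̂) + μ∇v̂ almost solves the relaxation system: the stiff
terms (μ/ε)∇v̂ − Ŝ/ε + T(F̂)/ε cancel exactly, so the only defect is R = ∂ₜŜ in the stress equation,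
and R is continuous in time with values in H³ and does not depend on ε (`exists_equilibrium_curve`).
The deviation W = (F, v, S) therefore solves the linear equation ∂ₜW = (∇v, div S, (μ/ε)∇v) with the
additional force ε⁻¹(T(F̂ + F) − T(F̂) − S) − R in the stress slot.

The symmetrizer makes the linear part skew, so it contributes nothing to the time derivative of 𝓔.
The force contributes 2⟨T(F̂ + F) − T(F̂) − S − εR, S − F⟩ in H³: the weight ε in 𝓔 has removed the
factor 1/ε, and the damping −2‖S‖² absorbs every other term containing S (`deviation_estimate`).
What remains is bounded by a constant times ‖F‖² + ε², and 𝓔 controls ‖F‖² uniformly in ε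
(`energyForm_lower`). Grönwall gives 𝓔(t) + ε² ≤ e^{Kt}(𝓔(0) + ε²) with K independent of ε, as long
as F stays in a fixed ball in which F ↦ T(F̂ + F) is Lipschitz on H³. Well prepared data and small ε
make the right side so small that the solution never leaves this ball before the final time.

Existence rests on the group U(t) of the linear part (`exists_relaxGroup`), a limit of exponentials
of bounded operators in which derivatives are replaced by central difference quotients; these are
skew-adjoint like the derivatives, so the approximate groups conserve the same energy. For Z =
U(−t)W the equation is an ODE in H³ with a locally Lipschitz field, which `exists_semilinear` solves
on the whole interval by truncating the energy. This uses that F ↦ T(F) is C¹ on H³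
(`exists_superpos_mat`), which depends on H² ⊆ L^∞ (`exists_sobolev_const`). Uniqueness is the same
energy estimate performed in L² (`relaxation_solution_unique`). -/

/-- The `i`-th vector of the standard basis of `ℝ³`. -/
abbrev e (i : Fin 3) : X := EuclideanSpace.single i 1

theorem partialD_comm {φ : X → ℝ} (h : ContDiff ℝ 2 φ) (i j : Fin 3) :
    partialD i (partialD j φ) = partialD j (partialD i φ) := by
  have key (a b : Fin 3) (x : X) :
      partialD a (partialD b φ) x = fderiv ℝ (fderiv ℝ φ) x (e a) (e b) := by
    have hd : DifferentiableAt ℝ (fderiv ℝ φ) x :=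
      ((h.fderiv_right (m := 1) (by norm_num)).differentiable (by norm_num)) x
    change fderiv ℝ (fun y => fderiv ℝ φ y (e b)) x (e a) = _
    rw [fderiv_clm_apply hd (differentiableAt_const _)]
    simp
  ext x
  rw [key, key]
  exact (h.contDiffAt.isSymmSndFDerivAt (by simp)) (e i) (e j)

theorem iterate_partialD_comm {φ : X → ℝ} (h : IsTest φ) (i j : Fin 3) (n : ℕ) :
    (partialD i)^[n] (partialD j φ) = partialD j ((partialD i)^[n] φ) := by
  induction n with
  | zero => rfl
  | succ n ih =>
    rw [Function.iterate_succ_apply', ih, Function.iterate_succ_apply',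
      partialD_comm ((h.iterate i n).1.of_le (by norm_cast))]

theorem multiD_partialD {φ : X → ℝ} (h : IsTest φ) (γ : Fin 3 → ℕ) (j : Fin 3) :
    multiD γ (partialD j φ) = partialD j (multiD γ φ) := by
  unfold multiD
  rw [iterate_partialD_comm h, iterate_partialD_comm (h.iterate 2 _),
    iterate_partialD_comm ((h.iterate 2 _).iterate 1 _)]

/-- `multiD` applies the directions in a fixed order, so the extra derivative must be commuted into
the innermost place. -/
theorem multiD_add_single {φ : X → ℝ} (h : IsTest φ) (γ : Fin 3 → ℕ) (j : Fin 3) :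
    multiD (γ + Pi.single j 1) φ = multiD γ (partialD j φ) := by
  unfold multiD
  fin_cases j
  · simp [Function.iterate_succ_apply, iterate_partialD_comm h,
      iterate_partialD_comm (h.iterate 2 _)]
  · simp [Function.iterate_succ_apply, iterate_partialD_comm h]
  · simp [Function.iterate_succ_apply]

theorem multiD_single (j : Fin 3) (φ : X → ℝ) : multiD (Pi.single j 1) φ = partialD j φ := by
  unfold multiD
  fin_cases j <;> simp

theorem multiD_zero (φ : X → ℝ) : multiD 0 φ = φ := rfl

theorem sum_single_one (j : Fin 3) : ∑ i, (Pi.single j 1 : Fin 3 → ℕ) i = 1 := by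
  simp

theorem partialD_translate (j : Fin 3) (φ : X → ℝ) (a : X) :
    partialD j (fun x => φ (x - a)) = fun x => partialD j φ (x - a) := by
  ext x
  simp only [partialD, fderiv_comp_sub]

theorem multiD_translate (γ : Fin 3 → ℕ) (φ : X → ℝ) (a : X) :
    multiD γ (fun x => φ (x - a)) = fun x => multiD γ φ (x - a) := by
  have key (j : Fin 3) (n : ℕ) (ψ : X → ℝ) :
      (partialD j)^[n] (fun x => ψ (x - a)) = fun x => (partialD j)^[n] ψ (x - a) := by
    induction n with
    | zero => rfl
    | succ n ih => simp only [Function.iterate_succ_apply', ih, partialD_translate]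
  simp only [multiD, key]

theorem IsTest.translate {φ : X → ℝ} (h : IsTest φ) (a : X) : IsTest fun x => φ (x - a) :=
  ⟨h.1.comp (contDiff_id.sub contDiff_const),
    h.2.comp_homeomorph (Homeomorph.subRight a)⟩

theorem IsTest.memLp {φ : X → ℝ} (h : IsTest φ) (p : ENNReal) : MemLp φ p :=
  h.1.continuous.memLp_of_hasCompactSupport h.2

section

variable {V : Type} [NormedAddCommGroup V] [InnerProductSpace ℝ V]

/-! ### Testing and translating `L²` functions -/

/-- The functional `u ↦ ∫ φ u` on `L²`. -/
def testL [CompleteSpace V] {φ : X → ℝ} (h : IsTest φ) : L2 V →L[ℝ] V :=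
  (ContinuousLinearMap.lsmul ℝ ℝ).lpPairing volume 2 2 (h.memLp 2).toLp

theorem testL_apply [CompleteSpace V] {φ : X → ℝ} (h : IsTest φ) (u : L2 V) :
    testL h u = ∫ x, φ x • u x := by
  rw [testL, ContinuousLinearMap.lpPairing_eq_integral]
  refine integral_congr_ae ?_
  filter_upwards [(h.memLp 2).coeFn_toLp] with x hx
  simp [hx]

/-- Fundamental lemma of the calculus of variations. It reduces identities in L² to identities
between continuous functionals, which commute with limits and integrals. -/
theorem eq_of_testL [CompleteSpace V] {u w : L2 V}
    (h : ∀ (φ : X → ℝ) (hφ : IsTest φ), testL hφ u = testL hφ w) : u = w := by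
  refine Lp.ext (ae_eq_of_integral_contDiff_smul_eq
    ((Lp.memLp u).locallyIntegrable (by norm_num)) ((Lp.memLp w).locallyIntegrable (by norm_num))
    fun φ h1 h2 => ?_)
  have hφ : IsTest φ := ⟨h1, h2⟩
  exact (testL_apply hφ u).symm.trans ((h φ hφ).trans (testL_apply hφ w))

theorem isWeakDeriv_iff [CompleteSpace V] {γ : Fin 3 → ℕ} {u w : L2 V} :
    IsWeakDeriv γ u w ↔ ∀ (φ : X → ℝ) (hφ : IsTest φ),
      testL (hφ.multiD γ) u = (-1 : ℝ) ^ (∑ i, γ i) • testL hφ w := by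
  simp only [testL_apply]; rfl

theorem IsWeakDeriv.congr {γ : Fin 3 → ℕ} {u w u' w' : X → V} (h : IsWeakDeriv γ u w)
    (hu : u =ᵐ[volume] u') (hw : w =ᵐ[volume] w') : IsWeakDeriv γ u' w' := by
  intro φ hφ
  have key (ψ : X → ℝ) {a b : X → V} (hab : a =ᵐ[volume] b) :
      ∫ x, ψ x • b x = ∫ x, ψ x • a x :=
    integral_congr_ae (by filter_upwards [hab] with x hx; rw [hx])
  rw [key _ hu, key _ hw, h φ hφ]

theorem IsWeakDeriv.unique [CompleteSpace V] {γ : Fin 3 → ℕ} {u w w' : L2 V}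
    (h : IsWeakDeriv γ u w) (h' : IsWeakDeriv γ u w') : w = w' := by
  refine eq_of_testL fun φ hφ => ?_
  have := (isWeakDeriv_iff.1 h φ hφ).symm.trans (isWeakDeriv_iff.1 h' φ hφ)
  exact smul_right_injective V (pow_ne_zero _ (by norm_num : (-1 : ℝ) ≠ 0)) this

theorem isWeakDeriv_zero_self (u : X → V) : IsWeakDeriv 0 u u := fun φ _ => by
  simp [multiD_zero]

theorem IsWeakDeriv.trans_single {γ : Fin 3 → ℕ} {j : Fin 3} {u w z : X → V}
    (h : IsWeakDeriv (Pi.single j 1) u w) (h' : IsWeakDeriv γ w z) :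
    IsWeakDeriv (γ + Pi.single j 1) u z := by
  intro φ hφ
  have h1 := h (multiD γ φ) (hφ.multiD γ)
  rw [multiD_single, ← multiD_partialD hφ, ← multiD_add_single hφ] at h1
  rw [h1, h' φ hφ, smul_smul]
  simp only [sum_single_one, Pi.add_apply, Finset.sum_add_distrib]
  ring_nf

/-- Elements of H^k only store weak derivatives of u itself. This lemma and the next recover
derivatives of derivatives, by testing with a derivative of φ and cancelling the sign. -/
theorem IsWeakDeriv.of_add_single {γ : Fin 3 → ℕ} {j : Fin 3} {u w z : X → V}
    (h : IsWeakDeriv (Pi.single j 1) u w) (h' : IsWeakDeriv (γ + Pi.single j 1) u z) :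
    IsWeakDeriv γ w z := by
  intro φ hφ
  have h1 := h (multiD γ φ) (hφ.multiD γ)
  rw [multiD_single, ← multiD_partialD hφ, ← multiD_add_single hφ, h' φ hφ] at h1
  simp only [sum_single_one, Pi.add_apply, Finset.sum_add_distrib, pow_succ, pow_zero,
    mul_neg, mul_one, neg_smul, one_smul, neg_inj] at h1
  exact h1.symm

theorem IsWeakDeriv.single_of_add_single {γ : Fin 3 → ℕ} {j : Fin 3} {u w z : X → V}
    (h : IsWeakDeriv γ u w) (h' : IsWeakDeriv (γ + Pi.single j 1) u z) :
    IsWeakDeriv (Pi.single j 1) w z := by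
  intro φ hφ
  have h1 := h (partialD j φ) (hφ.partialD j)
  rw [← multiD_add_single hφ, h' φ hφ] at h1
  simp only [sum_single_one, Pi.add_apply, Finset.sum_add_distrib, pow_add, pow_one,
    mul_smul] at h1 ⊢
  rw [multiD_single]
  exact (smul_right_injective V (pow_ne_zero _ (by norm_num : (-1 : ℝ) ≠ 0)) h1).symm

theorem measurePreserving_add_right' (a : X) :
    MeasurePreserving (fun x : X => x + a) volume volume :=
  measurePreserving_add_right volume a

/-- Translation `(τ_a u)(x) = u(x + a)` as an isometry of `L²`. -/
def trans (a : X) : L2 V →ₗᵢ[ℝ] L2 V :=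
  Lp.compMeasurePreservingₗᵢ ℝ (fun x => x + a) (measurePreserving_add_right' a)

theorem trans_ae (a : X) (u : L2 V) : trans a u =ᵐ[volume] fun x => u (x + a) :=
  Lp.coeFn_compMeasurePreserving u (measurePreserving_add_right' a)

theorem ae_translate {p : X → Prop} (h : ∀ᵐ x, p x) (a : X) : ∀ᵐ x : X, p (x + a) :=
  (measurePreserving_add_right' a).quasiMeasurePreserving.ae h

theorem trans_trans (a b : X) (u : L2 V) : trans a (trans b u) = trans (a + b) u := by
  refine Lp.ext ?_
  filter_upwards [trans_ae a (trans b u), ae_translate (trans_ae b u) a, trans_ae (a + b) u]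
    with x h1 h2 h3
  rw [h1, h2, h3, add_assoc]

theorem trans_zero (u : L2 V) : trans 0 u = u := by
  refine Lp.ext ?_
  filter_upwards [trans_ae 0 u] with x h1
  rw [h1, add_zero]

theorem continuous_trans (u : L2 V) : Continuous fun a : X => trans a u := by
  let g : X → C(X, X) := fun a => ⟨fun x => x + a, by fun_prop⟩
  have hg : Continuous g := by
    refine ContinuousMap.continuous_of_continuous_uncurry _ ?_
    change Continuous fun p : X × X => p.2 + p.1
    fun_prop
  exact Continuous.compMeasurePreservingLp (f := fun _ : X => u) (g := g) continuous_const hg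
    (fun a => measurePreserving_add_right' a) (by norm_num)

theorem integral_smul_trans (φ : X → ℝ) (a : X) (u : L2 V) :
    ∫ x, φ x • trans a u x = ∫ x, φ (x - a) • u x := by
  rw [← integral_add_right_eq_self (fun x => φ (x - a) • u x) a]
  refine integral_congr_ae ?_
  filter_upwards [trans_ae a u] with x hx
  simp [hx]

theorem inner_trans (a : X) (u w : L2 V) : inner ℝ (trans a u) w = inner ℝ u (trans (-a) w) := by
  rw [← (trans a).inner_map_map u (trans (-a) w), trans_trans, add_neg_cancel, trans_zero]

theorem IsWeakDeriv.translate {γ : Fin 3 → ℕ} {u w : L2 V} (h : IsWeakDeriv γ u w) (a : X) :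
    IsWeakDeriv γ (trans a u) (trans a w) := by
  intro φ hφ
  rw [integral_smul_trans, integral_smul_trans, ← h _ (hφ.translate a), multiD_translate]

/-- The tested translate is a convolution of u with the reflection of φ, evaluated at s e_j; the
derivative falls on φ, so no regularity of u is needed. -/
theorem hasDerivAt_testL_trans [CompleteSpace V] {φ : X → ℝ} (hφ : IsTest φ) (u : L2 V)
    (j : Fin 3) (s : ℝ) :
    HasDerivAt (fun r : ℝ => testL hφ (trans (r • e j) u))
      (-testL (hφ.partialD j) (trans (s • e j) u)) s := by
  let ψ : X → ℝ := fun z => φ (-z)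
  have hψ : ContDiff ℝ 1 ψ := (hφ.1.of_le (by simp)).comp contDiff_neg
  have hψc : HasCompactSupport ψ := hφ.2.comp_homeomorph (Homeomorph.neg X)
  have hu : LocallyIntegrable (u : X → V) := (Lp.memLp u).locallyIntegrable (by norm_num)
  let L : V →L[ℝ] ℝ →L[ℝ] V := (ContinuousLinearMap.lsmul ℝ ℝ).flip
  have h1 := hψc.hasFDerivAt_convolution_right L hu hψ (s • e j)
  have h2 : HasDerivAt (fun r : ℝ => r • e j) (e j) s := by
    simpa using (hasDerivAt_id s).smul_const (e j)
  have h3 := h1.comp_hasDerivAt s h2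
  have hconv (r : ℝ) : testL hφ (trans (r • e j) u) = convolution u ψ L volume (r • e j) := by
    rw [testL_apply, integral_smul_trans]
    simp [convolution, L, ψ]
  have hD : convolution (u : X → V) (fderiv ℝ ψ) (L.precompR X) volume (s • e j) (e j)
      = -testL (hφ.partialD j) (trans (s • e j) u) := by
    rw [testL_apply, integral_smul_trans, convolution]
    have hc : ConvolutionExistsAt (u : X → V) (fderiv ℝ ψ) (s • e j) (L.precompR X) volume :=
      (hψc.fderiv ℝ).convolutionExists_right _ hu
        (hψ.continuous_fderiv (by norm_num)) _
    rw [ContinuousLinearMap.integral_apply hc.integrable, ← integral_neg]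
    congr 1
    ext x
    have hψ' : fderiv ℝ ψ (s • e j - x) = -fderiv ℝ φ (x - s • e j) := by
      have hd : HasFDerivAt φ (fderiv ℝ φ (-(s • e j - x))) (-(s • e j - x)) :=
        (hφ.1.differentiable (by simp) _).hasFDerivAt
      rw [neg_sub] at hd
      have hn : HasFDerivAt (fun z : X => -z) (-ContinuousLinearMap.id ℝ X) (s • e j - x) :=
        (hasFDerivAt_id _).neg
      refine (HasFDerivAt.comp (s • e j - x) (by rwa [neg_sub]) hn).fderiv.trans ?_
      ext z
      simp
    simp [L, partialD, hψ']
  rw [hD] at h3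
  exact h3.congr_of_eventuallyEq (Eventually.of_forall hconv)

/-- The weak derivative is the generator of translations. -/
theorem IsWeakDeriv.trans_sub_eq [CompleteSpace V] {j : Fin 3} {u w : L2 V}
    (h : IsWeakDeriv (Pi.single j 1) u w) (s : ℝ) :
    trans (s • e j) u - u = ∫ r in (0 : ℝ)..s, trans (r • e j) w := by
  have hc : Continuous fun r : ℝ => trans (r • e j) w :=
    (continuous_trans w).comp (by fun_prop)
  -- Against a fixed φ the claim is the scalar fundamental theorem of calculus, since the translated
  -- weak derivative is the derivative of the tested translates.
  refine eq_of_testL fun φ hφ => ?_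
  rw [← ContinuousLinearMap.intervalIntegral_comp_comm _ (hc.intervalIntegrable _ _)]
  have hd (r : ℝ) : HasDerivAt (fun r : ℝ => testL hφ (trans (r • e j) u))
      (testL hφ (trans (r • e j) w)) r := by
    have h1 := hasDerivAt_testL_trans hφ u j r
    have h2 := isWeakDeriv_iff.1 (h.translate (r • e j)) φ hφ
    simp only [multiD_single, sum_single_one, pow_one, neg_smul, one_smul] at h2
    rwa [h2, neg_neg] at h1
  rw [intervalIntegral.integral_eq_sub_of_hasDerivAt (fun r _ => hd r)
    (((testL hφ).continuous.comp hc).intervalIntegrable _ _)]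
  simp [trans_zero]

/-- Strong continuity of translations in L² upgrades the integral formula to convergence of
difference quotients in norm. -/
theorem IsWeakDeriv.hasDerivAt [CompleteSpace V] {j : Fin 3} {u w : L2 V}
    (h : IsWeakDeriv (Pi.single j 1) u w) :
    HasDerivAt (fun s : ℝ => trans (s • e j) u) w 0 := by
  have hc : Continuous fun r : ℝ => trans (r • e j) w :=
    (continuous_trans w).comp (by fun_prop)
  have h1 := intervalIntegral.integral_hasDerivAt_right (hc.intervalIntegrable 0 0)
    hc.stronglyMeasurable.stronglyMeasurableAtFilter hc.continuousAt
  simp only [zero_smul, trans_zero] at h1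
  have h2 := h1.add_const u
  refine h2.congr_of_eventuallyEq (Eventually.of_forall fun s => ?_)
  simp only [← h.trans_sub_eq s, sub_add_cancel]

theorem IsWeakDeriv.norm_trans_sub_le [CompleteSpace V] {j : Fin 3} {u w : L2 V}
    (h : IsWeakDeriv (Pi.single j 1) u w) (s : ℝ) :
    ‖trans (s • e j) u - u‖ ≤ ‖w‖ * |s| := by
  rw [h.trans_sub_eq s]
  simpa using intervalIntegral.norm_integral_le_of_norm_le_const (a := 0) (b := s)
    (f := fun r => trans (r • e j) w) (C := ‖w‖) (fun r _ => by rw [LinearIsometry.norm_map])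

/-- Difference quotients that converge in the sense of distributions give a weak derivative. -/
theorem isWeakDeriv_of_tendsto [CompleteSpace V] {j : Fin 3} {u w : L2 V}
    (h : ∀ (φ : X → ℝ) (hφ : IsTest φ),
      Tendsto (fun s : ℝ => s⁻¹ • testL hφ (trans (s • e j) u - u)) (𝓝[≠] 0) (𝓝 (testL hφ w))) :
    IsWeakDeriv (Pi.single j 1) u w := by
  refine isWeakDeriv_iff.2 fun φ hφ => ?_
  have h1 := (hasDerivAt_testL_trans hφ u j 0).tendsto_slope
  simp only [zero_smul, trans_zero] at h1
  -- The tested quotients also converge to minus the pairing of u with ∂_j φ; equality of the two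
  -- limits is the definition of the weak derivative.
  have h2 := tendsto_nhds_unique h1 ((h φ hφ).congr fun s => by simp [slope, trans_zero])
  simp only [multiD_single, sum_single_one, pow_one, neg_smul, one_smul, ← h2, neg_neg]

end

/-! ### Sobolev spaces -/

section

variable {V V' : Type} [NormedAddCommGroup V] [InnerProductSpace ℝ V]
  [NormedAddCommGroup V'] [InnerProductSpace ℝ V']

theorem single_mem_multiIdx {k : ℕ} (j : Fin 3) : Pi.single j 1 ∈ multiIdx (k + 1) := by
  simp [mem_multiIdx]

theorem add_single_mem_multiIdx {k : ℕ} {γ : Fin 3 → ℕ} (h : γ ∈ multiIdx k) (j : Fin 3) :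
    γ + Pi.single j 1 ∈ multiIdx (k + 1) := by
  rw [mem_multiIdx] at *
  simpa [Finset.sum_add_distrib] using h

theorem exists_eq_add_single {k : ℕ} {γ : Fin 3 → ℕ} (h : γ ∈ multiIdx (k + 1)) (h0 : γ ≠ 0) :
    ∃ j, ∃ δ ∈ multiIdx k, γ = δ + Pi.single j 1 := by
  obtain ⟨j, hj⟩ := Function.ne_iff.1 h0
  have hj : γ j ≠ 0 := hj
  have key : γ = (γ - Pi.single j 1) + Pi.single j 1 := by
    ext i
    by_cases hij : i = j
    · subst hij
      simp only [Pi.add_apply, Pi.sub_apply, Pi.single_eq_same]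
      omega
    · simp [hij]
  refine ⟨j, γ - Pi.single j 1, ?_, key⟩
  rw [key] at h
  rw [mem_multiIdx] at *
  simpa [Finset.sum_add_distrib] using h

instance (k : ℕ) : NormedAddCommGroup (Sob k V) := Submodule.normedAddCommGroup _

instance (k : ℕ) : InnerProductSpace ℝ (Sob k V) := Submodule.innerProductSpace _

instance (k : ℕ) : NormedSpace ℝ (Sob k V) := InnerProductSpace.toNormedSpace

instance (k : ℕ) : Module ℝ (Sob k V) := NormedSpace.toModule

instance (k : ℕ) : ContinuousConstSMul ℝ (Sob k V) := inferInstance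

instance (k : ℕ) : IsTopologicalAddGroup (Sob k V) := inferInstance

theorem Sob.D_of_mem {k : ℕ} (u : Sob k V) {γ : Fin 3 → ℕ} (h : γ ∈ multiIdx k) :
    u.D γ = u.1 ⟨γ, h⟩ := dif_pos h

theorem Sob.isWeakDeriv {k : ℕ} (u : Sob k V) {γ : Fin 3 → ℕ} (h : γ ∈ multiIdx k) :
    IsWeakDeriv γ u.val (u.D γ) := by
  rw [u.D_of_mem h, Sob.val, u.D_of_mem (zero_mem_multiIdx k)]
  exact u.2 ⟨γ, h⟩

theorem Sob.ext_D {k : ℕ} {u w : Sob k V} (h : ∀ γ ∈ multiIdx k, u.D γ = w.D γ) : u = w := by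
  refine Subtype.ext (PiLp.ext fun γ => ?_)
  simpa [Sob.D_of_mem _ γ.2] using h γ.1 γ.2

/-- Weak derivatives are unique, so the stored family carries no more information than the function.
-/
theorem Sob.ext_val [CompleteSpace V] {k : ℕ} {u w : Sob k V} (h : u.val = w.val) : u = w :=
  Sob.ext_D fun _ hγ => (u.isWeakDeriv hγ).unique (h ▸ w.isWeakDeriv hγ)

theorem Sob.inner_eq {k : ℕ} (u w : Sob k V) :
    inner ℝ u w = ∑ γ ∈ multiIdx k, inner ℝ (u.D γ) (w.D γ) := by
  rw [Submodule.coe_inner, PiLp.inner_apply,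
    ← Finset.sum_coe_sort (multiIdx k) fun γ => inner ℝ (u.D γ) (w.D γ)]
  refine Finset.sum_congr rfl fun γ _ => ?_
  rw [u.D_of_mem γ.2, w.D_of_mem γ.2]

theorem Sob.norm_sq_eq {k : ℕ} (u : Sob k V) :
    ‖u‖ ^ 2 = ∑ γ ∈ multiIdx k, ‖u.D γ‖ ^ 2 := by
  rw [← real_inner_self_eq_norm_sq, Sob.inner_eq]
  simp only [real_inner_self_eq_norm_sq]

/-- Membership is an intersection of closed linear conditions, one for each multi-index and test
function. Completeness of H^k follows. -/
theorem isClosed_sobolev [CompleteSpace V] (k : ℕ) :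
    IsClosed (sobolev V k : Set (PiLp 2 fun _ : multiIdx k => L2 V)) := by
  have : (sobolev V k : Set (PiLp 2 fun _ : multiIdx k => L2 V)) =
      ⋂ (γ : multiIdx k) (φ : X → ℝ) (hφ : IsTest φ),
        {u | testL (hφ.multiD γ.1) (u ⟨0, zero_mem_multiIdx k⟩)
          = (-1 : ℝ) ^ (∑ i, γ.1 i) • testL hφ (u γ)} := by
    ext u
    simp only [mem_iInter, mem_ofPred_eq]
    exact forall_congr' fun γ => isWeakDeriv_iff
  rw [this]
  refine isClosed_iInter fun γ => isClosed_iInter fun φ => isClosed_iInter fun hφ => ?_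
  exact isClosed_eq
    ((testL _).continuous.comp (PiLp.continuous_apply 2 _ _))
    (((testL hφ).continuous.comp (PiLp.continuous_apply 2 _ γ)).const_smul
      ((-1 : ℝ) ^ (∑ i, γ.1 i)))

instance [CompleteSpace V] (k : ℕ) : CompleteSpace (Sob k V) :=
  (isClosed_sobolev k).completeSpace_coe

/-- The weak derivative `∂^γ` as a continuous linear map. -/
def Sob.DL {k : ℕ} (γ : Fin 3 → ℕ) : Sob k V →L[ℝ] L2 V :=
  if h : γ ∈ multiIdx k then
    (PiLp.proj 2 (fun _ : multiIdx k => L2 V) ⟨γ, h⟩ : _ →L[ℝ] _).comp (sobolev V k).subtypeL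
  else 0

@[simp]
theorem Sob.DL_apply {k : ℕ} (γ : Fin 3 → ℕ) (u : Sob k V) : Sob.DL γ u = u.D γ := by
  unfold Sob.DL Sob.D
  split_ifs <;> rfl

section lift

variable {E : Type*} [NormedAddCommGroup E] [NormedSpace ℝ E]

/-- A continuous linear map into `H^k` from the family of its derivatives. -/
def Sob.lift {k : ℕ} (P : (Fin 3 → ℕ) → E →L[ℝ] L2 V)
    (h : ∀ γ ∈ multiIdx k, ∀ x, IsWeakDeriv γ (P 0 x) (P γ x)) : E →L[ℝ] Sob k V :=
  ((PiLp.continuousLinearEquiv 2 ℝ (fun _ : multiIdx k => L2 V)).symm.toContinuousLinearMap.comp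
    (ContinuousLinearMap.pi fun γ : multiIdx k => P γ.1)).codRestrict (sobolev V k)
    fun x γ => h γ.1 γ.2 x

theorem Sob.D_lift {k : ℕ} {P : (Fin 3 → ℕ) → E →L[ℝ] L2 V}
    {h : ∀ γ ∈ multiIdx k, ∀ x, IsWeakDeriv γ (P 0 x) (P γ x)} (x : E) {γ : Fin 3 → ℕ}
    (hγ : γ ∈ multiIdx k) : (Sob.lift P h x).D γ = P γ x := by
  rw [Sob.D_of_mem _ hγ]; rfl

end lift

theorem Sob.val_eq {k : ℕ} (u : Sob k V) : u.val = u.D 0 := rfl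

theorem Sob.pd_eq {k : ℕ} (u : Sob k V) (j : Fin 3) : u.pd j = u.D (Pi.single j 1) := rfl

/-- The inclusion `H^l ⊆ H^k` as a continuous linear map. -/
def Sob.inclL {k l : ℕ} (h : k ≤ l) : Sob l V →L[ℝ] Sob k V :=
  Sob.lift Sob.DL fun _ hγ u => by simpa [Sob.val_eq] using u.isWeakDeriv (multiIdx_mono h hγ)

theorem Sob.D_incl {k l : ℕ} (h : k ≤ l) (u : Sob l V) {γ : Fin 3 → ℕ} (hγ : γ ∈ multiIdx k) :
    (Sob.incl h u).D γ = u.D γ := by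
  rw [Sob.D_of_mem _ hγ, Sob.D_of_mem _ (multiIdx_mono h hγ)]; rfl

theorem Sob.inclL_apply {k l : ℕ} (h : k ≤ l) (u : Sob l V) : Sob.inclL h u = Sob.incl h u :=
  Sob.ext_D fun γ hγ => by rw [Sob.inclL, Sob.D_lift _ hγ, Sob.D_incl h u hγ, Sob.DL_apply]

theorem Sob.val_incl {k l : ℕ} (h : k ≤ l) (u : Sob l V) : (Sob.incl h u).val = u.val :=
  Sob.D_incl h u (zero_mem_multiIdx k)

theorem Sob.isWeakDeriv_D {k : ℕ} (u : Sob (k + 1) V) {γ : Fin 3 → ℕ} (hγ : γ ∈ multiIdx k)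
    (j : Fin 3) : IsWeakDeriv (Pi.single j 1) (u.D γ) (u.D (γ + Pi.single j 1)) :=
  (u.isWeakDeriv (multiIdx_mono (Nat.le_succ k) hγ)).single_of_add_single
    (u.isWeakDeriv (add_single_mem_multiIdx hγ j))

/-- The partial derivative `∂_j : H^{k+1} → H^k`. -/
def Sob.pdS {k : ℕ} (j : Fin 3) : Sob (k + 1) V →L[ℝ] Sob k V :=
  Sob.lift (fun γ => Sob.DL (γ + Pi.single j 1)) fun _ hγ u => by
    simpa using (u.isWeakDeriv (single_mem_multiIdx j)).of_add_single
      (u.isWeakDeriv (add_single_mem_multiIdx hγ j))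

theorem Sob.D_pdS {k : ℕ} (j : Fin 3) (u : Sob (k + 1) V) {γ : Fin 3 → ℕ} (hγ : γ ∈ multiIdx k) :
    (Sob.pdS j u).D γ = u.D (γ + Pi.single j 1) := by
  rw [Sob.pdS, Sob.D_lift _ hγ, Sob.DL_apply]

theorem Sob.val_pdS {k : ℕ} (j : Fin 3) (u : Sob (k + 1) V) : (Sob.pdS j u).val = u.pd j := by
  rw [Sob.val_eq, Sob.D_pdS j u (zero_mem_multiIdx k), zero_add, Sob.pd_eq]

/-! ### Post-composition with linear maps and translation on Sobolev spaces -/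

theorem compLpL_ae (L : V →L[ℝ] V') (u : L2 V) :
    L.compLpL 2 volume u =ᵐ[volume] fun x => L (u x) :=
  L.coeFn_compLp u

theorem testL_compLpL [CompleteSpace V] [CompleteSpace V'] (L : V →L[ℝ] V') {φ : X → ℝ}
    (hφ : IsTest φ) (u : L2 V) : testL hφ (L.compLpL 2 volume u) = L (testL hφ u) := by
  rw [testL_apply, testL_apply, ← L.integral_comp_comm (hφ.integrable_smul u)]
  refine integral_congr_ae ?_
  filter_upwards [compLpL_ae L u] with x hx
  rw [hx, L.map_smul]

theorem IsWeakDeriv.compLpL [CompleteSpace V] [CompleteSpace V'] (L : V →L[ℝ] V')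
    {γ : Fin 3 → ℕ} {u w : L2 V} (h : IsWeakDeriv γ u w) :
    IsWeakDeriv γ (L.compLpL 2 volume u) (L.compLpL 2 volume w) := by
  refine isWeakDeriv_iff.2 fun φ hφ => ?_
  rw [testL_compLpL, testL_compLpL, isWeakDeriv_iff.1 h, L.map_smul]

/-- Post-composition `H^k(V) → H^k(V')` with a linear map `V → V'`. -/
def Sob.mapL [CompleteSpace V] [CompleteSpace V'] {k : ℕ} (L : V →L[ℝ] V') :
    Sob k V →L[ℝ] Sob k V' :=
  Sob.lift (fun γ => (L.compLpL 2 volume).comp (Sob.DL γ)) fun _ hγ u => by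
    simpa [Sob.val_eq] using (u.isWeakDeriv hγ).compLpL L

theorem Sob.D_mapL [CompleteSpace V] [CompleteSpace V'] {k : ℕ} (L : V →L[ℝ] V') (u : Sob k V)
    {γ : Fin 3 → ℕ} (hγ : γ ∈ multiIdx k) : (Sob.mapL L u).D γ = L.compLpL 2 volume (u.D γ) := by
  rw [Sob.mapL, Sob.D_lift _ hγ]; simp

/-- Translation on `H^k`. -/
def Sob.transS {k : ℕ} (a : X) : Sob k V →L[ℝ] Sob k V :=
  Sob.lift (fun γ => (trans a).toContinuousLinearMap.comp (Sob.DL γ)) fun _ hγ u => by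
    simpa [Sob.val_eq] using (u.isWeakDeriv hγ).translate a

theorem Sob.D_transS {k : ℕ} (a : X) (u : Sob k V) {γ : Fin 3 → ℕ} (hγ : γ ∈ multiIdx k) :
    (Sob.transS a u).D γ = trans a (u.D γ) := by
  rw [Sob.transS, Sob.D_lift _ hγ]; simp

theorem Sob.D_sub {k : ℕ} (u w : Sob k V) (γ : Fin 3 → ℕ) : (u - w).D γ = u.D γ - w.D γ := by
  simp only [← Sob.DL_apply, map_sub]

theorem Sob.D_add {k : ℕ} (u w : Sob k V) (γ : Fin 3 → ℕ) : (u + w).D γ = u.D γ + w.D γ := by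
  simp only [← Sob.DL_apply, map_add]

theorem Sob.D_smul {k : ℕ} (c : ℝ) (u : Sob k V) (γ : Fin 3 → ℕ) : (c • u).D γ = c • u.D γ := by
  simp only [← Sob.DL_apply, map_smul]

theorem Sob.norm_le_of_forall_D {V' : Type} [NormedAddCommGroup V'] [InnerProductSpace ℝ V']
    {k : ℕ} {u : Sob k V} {w : Sob k V'} (h : ∀ γ ∈ multiIdx k, ‖u.D γ‖ ≤ ‖w.D γ‖) :
    ‖u‖ ≤ ‖w‖ := by
  refine le_of_sq_le_sq ?_ (norm_nonneg _)
  rw [Sob.norm_sq_eq, Sob.norm_sq_eq]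
  exact Finset.sum_le_sum fun γ hγ => pow_le_pow_left₀ (norm_nonneg _) (h γ hγ) 2

theorem Sob.norm_eq_of_forall_D {k : ℕ} {u w : Sob k V}
    (h : ∀ γ ∈ multiIdx k, ‖u.D γ‖ = ‖w.D γ‖) : ‖u‖ = ‖w‖ :=
  le_antisymm (Sob.norm_le_of_forall_D fun γ hγ => (h γ hγ).le)
    (Sob.norm_le_of_forall_D fun γ hγ => (h γ hγ).ge)

theorem Sob.norm_transS {k : ℕ} (a : X) (u : Sob k V) : ‖Sob.transS a u‖ = ‖u‖ :=
  Sob.norm_eq_of_forall_D fun γ hγ => by rw [Sob.D_transS a u hγ, LinearIsometry.norm_map]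

theorem Sob.transS_transS {k : ℕ} (a b : X) (u : Sob k V) :
    Sob.transS a (Sob.transS b u) = Sob.transS (a + b) u :=
  Sob.ext_D fun γ hγ => by
    rw [Sob.D_transS _ _ hγ, Sob.D_transS _ _ hγ, Sob.D_transS _ _ hγ, trans_trans]

theorem Sob.transS_zero {k : ℕ} (u : Sob k V) : Sob.transS 0 u = u :=
  Sob.ext_D fun γ hγ => by rw [Sob.D_transS _ _ hγ, trans_zero]

theorem Sob.inner_transS {k : ℕ} (a : X) (u w : Sob k V) :
    inner ℝ (Sob.transS a u) w = inner ℝ u (Sob.transS (-a) w) := by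
  rw [Sob.inner_eq, Sob.inner_eq]
  exact Finset.sum_congr rfl fun γ hγ => by
    rw [Sob.D_transS _ _ hγ, Sob.D_transS _ _ hγ, inner_trans]

theorem trans_compLpL (L : V →L[ℝ] V') (a : X) (u : L2 V) :
    trans a (L.compLpL 2 volume u) = L.compLpL 2 volume (trans a u) := by
  refine Lp.ext ?_
  filter_upwards [trans_ae a (L.compLpL 2 volume u), compLpL_ae L (trans a u), trans_ae a u,
    ae_translate (compLpL_ae L u) a] with x h1 h2 h3 h4
  rw [h1, h2, h3, h4]

theorem Sob.transS_mapL [CompleteSpace V] [CompleteSpace V'] {k : ℕ} (L : V →L[ℝ] V') (a : X)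
    (u : Sob k V) : Sob.transS a (Sob.mapL L u) = Sob.mapL L (Sob.transS a u) :=
  Sob.ext_D fun γ hγ => by
    rw [Sob.D_transS _ _ hγ, Sob.D_mapL _ _ hγ, Sob.D_mapL _ _ hγ, Sob.D_transS _ _ hγ,
      trans_compLpL]

theorem Sob.transS_incl {k l : ℕ} (h : k ≤ l) (a : X) (u : Sob l V) :
    Sob.transS a (Sob.incl h u) = Sob.incl h (Sob.transS a u) :=
  Sob.ext_D fun γ hγ => by
    rw [Sob.D_transS _ _ hγ, Sob.D_incl _ _ hγ, Sob.D_incl _ _ hγ,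
      Sob.D_transS _ _ (multiIdx_mono h hγ)]

theorem Sob.tendsto_iff {ι : Type*} {l : Filter ι} {k : ℕ} {f : ι → Sob k V} {u : Sob k V} :
    Tendsto f l (𝓝 u) ↔ ∀ γ ∈ multiIdx k, Tendsto (fun i => (f i).D γ) l (𝓝 (u.D γ)) := by
  refine ⟨fun h γ _ => ?_, fun h => ?_⟩
  · simpa [Function.comp_def] using ((Sob.DL γ).continuous.tendsto u).comp h
  · rw [tendsto_iff_norm_sub_tendsto_zero]
    have h1 : Tendsto (fun i => ‖f i - u‖ ^ 2) l (𝓝 0) := by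
      have : Tendsto (fun i => ∑ γ ∈ multiIdx k, ‖(f i).D γ - u.D γ‖ ^ 2) l
          (𝓝 (∑ γ ∈ multiIdx k, (0 : ℝ) ^ 2)) :=
        tendsto_finsetSum _ fun γ hγ =>
          ((tendsto_iff_norm_sub_tendsto_zero.1 (h γ hγ)).pow 2)
      simp only [Sob.norm_sq_eq, Sob.D_sub]
      simpa using this
    simpa [Real.sqrt_sq] using h1.sqrt

theorem Sob.continuous_transS {k : ℕ} (u : Sob k V) : Continuous fun a : X => Sob.transS a u := by
  refine continuous_iff_continuousAt.2 fun a => Sob.tendsto_iff.2 fun γ hγ => ?_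
  simp only [Sob.D_transS _ _ hγ]
  exact (continuous_trans _).continuousAt

theorem Sob.hasDerivAt_iff {k : ℕ} {f : ℝ → Sob k V} {f' : Sob k V} {t : ℝ} :
    HasDerivAt f f' t ↔ ∀ γ ∈ multiIdx k, HasDerivAt (fun s => (f s).D γ) (f'.D γ) t := by
  simp only [hasDerivAt_iff_tendsto_slope]
  rw [Sob.tendsto_iff]
  simp only [slope_fun_def, vsub_eq_sub, Sob.D_sub, Sob.D_smul]

theorem Sob.hasDerivAt_transS [CompleteSpace V] {k : ℕ} (j : Fin 3) (u : Sob (k + 1) V) :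
    HasDerivAt (fun s : ℝ => Sob.transS (s • e j) (Sob.incl (Nat.le_succ k) u)) (Sob.pdS j u) 0 := by
  refine Sob.hasDerivAt_iff.2 fun γ hγ => ?_
  simp only [Sob.D_transS _ _ hγ, Sob.D_incl _ _ hγ, Sob.D_pdS _ _ hγ]
  exact (u.isWeakDeriv_D hγ j).hasDerivAt

/-! ### Central difference quotients -/

/-- The central difference quotient with step `h` in direction `j`. -/
def Sob.diffQ {k : ℕ} (h : ℝ) (j : Fin 3) : Sob k V →L[ℝ] Sob k V :=
  (2 * h)⁻¹ • (Sob.transS (h • e j) - Sob.transS (-(h • e j)))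

theorem Sob.diffQ_apply {k : ℕ} (h : ℝ) (j : Fin 3) (u : Sob k V) :
    Sob.diffQ h j u = (2 * h)⁻¹ • (Sob.transS (h • e j) u - Sob.transS (-(h • e j)) u) := rfl

/-- The adjoint of a translation is the inverse translation, so the central quotient, unlike a
one-sided one, is exactly skew-adjoint. The discretised system inherits energy conservation from
this. -/
theorem Sob.inner_diffQ {k : ℕ} (h : ℝ) (j : Fin 3) (u w : Sob k V) :
    inner ℝ (Sob.diffQ h j u) w = -inner ℝ u (Sob.diffQ h j w) := by
  simp only [Sob.diffQ_apply, inner_smul_left, inner_smul_right, inner_sub_left, inner_sub_right,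
    Sob.inner_transS, neg_neg, RCLike.conj_to_real]
  ring

theorem Sob.diffQ_comm {k : ℕ} (h h' : ℝ) (j j' : Fin 3) (u : Sob k V) :
    Sob.diffQ h j (Sob.diffQ h' j' u) = Sob.diffQ h' j' (Sob.diffQ h j u) := by
  simp only [Sob.diffQ_apply, map_smul, map_sub, Sob.transS_transS, smul_smul, smul_sub]
  rw [mul_comm (2 * h)⁻¹, add_comm (h • e j) (h' • e j'), add_comm (h • e j) (-(h' • e j')),
    add_comm (-(h • e j)) (h' • e j'), add_comm (-(h • e j)) (-(h' • e j'))]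
  abel

theorem Sob.diffQ_mapL [CompleteSpace V] [CompleteSpace V'] {k : ℕ} (L : V →L[ℝ] V') (h : ℝ)
    (j : Fin 3) (u : Sob k V) : Sob.diffQ h j (Sob.mapL L u) = Sob.mapL L (Sob.diffQ h j u) := by
  simp only [Sob.diffQ_apply, map_smul, map_sub, Sob.transS_mapL]

theorem Sob.diffQ_incl {k l : ℕ} (hkl : k ≤ l) (h : ℝ) (j : Fin 3) (u : Sob l V) :
    Sob.diffQ h j (Sob.incl hkl u) = Sob.incl hkl (Sob.diffQ h j u) := by
  simp only [Sob.diffQ_apply, Sob.transS_incl]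
  simp only [← Sob.inclL_apply, map_sub, map_smul]

theorem Sob.tendsto_diffQ {k : ℕ} {j : Fin 3} {u u' : Sob k V}
    (h : HasDerivAt (fun s : ℝ => Sob.transS (s • e j) u) u' 0) :
    Tendsto (fun s => Sob.diffQ s j u) (𝓝[≠] 0) (𝓝 u') := by
  have h1 : HasDerivAt (fun s : ℝ => Sob.transS (-(s • e j)) u) (-u') 0 := by
    have h0 : HasDerivAt (fun s : ℝ => Sob.transS (s • e j) u) u' (-0 : ℝ) := by simpa using h
    have := h0.scomp (0 : ℝ) (hasDerivAt_neg (0 : ℝ))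
    simpa [Function.comp_def] using this
  have h2 := ((h.sub h1).const_smul (2⁻¹ : ℝ)).tendsto_slope
  have h3 : (2⁻¹ : ℝ) • (u' - -u') = u' := by
    rw [sub_neg_eq_add, ← two_smul ℝ u', smul_smul]; norm_num
  rw [h3] at h2
  refine h2.congr fun s => ?_
  simp [slope, Sob.diffQ_apply, smul_smul]

/-- Integration by parts. -/
theorem Sob.inner_pdS [CompleteSpace V] {k : ℕ} (j : Fin 3) (u w : Sob (k + 1) V) :
    inner ℝ (Sob.pdS j u) (Sob.incl (Nat.le_succ k) w)
      = -inner ℝ (Sob.incl (Nat.le_succ k) u) (Sob.pdS j w) := by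
  -- Both sides are limits of the skew-adjointness identity for central quotients.
  have h1 := (Sob.tendsto_diffQ (Sob.hasDerivAt_transS j u)).inner
    (tendsto_const_nhds (x := Sob.incl (Nat.le_succ k) w)) (𝕜 := ℝ)
  have h2 := ((tendsto_const_nhds (x := Sob.incl (Nat.le_succ k) u)).inner
    (Sob.tendsto_diffQ (Sob.hasDerivAt_transS j w)) (𝕜 := ℝ)).neg
  exact tendsto_nhds_unique h1 (h2.congr fun s => (Sob.inner_diffQ s j _ _).symm)

/-! ### Steklov averages -/

/-- The average of `u` over the segment `[x, x + h e_j]`. -/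
def Sob.avg [CompleteSpace V] {k : ℕ} (h : ℝ) (j : Fin 3) (u : Sob k V) : Sob k V :=
  h⁻¹ • ∫ s in (0 : ℝ)..h, Sob.transS (s • e j) u

theorem Sob.continuous_transS_smul {k : ℕ} (j : Fin 3) (u : Sob k V) :
    Continuous fun s : ℝ => Sob.transS (s • e j) u :=
  (Sob.continuous_transS u).comp (by fun_prop)

theorem Sob.transS_avg [CompleteSpace V] {k : ℕ} (h : ℝ) (j : Fin 3) (a : X) (u : Sob k V) :
    Sob.transS a (Sob.avg h j u) = Sob.avg h j (Sob.transS a u) := by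
  rw [Sob.avg, Sob.avg, map_smul, ← ContinuousLinearMap.intervalIntegral_comp_comm _
    ((Sob.continuous_transS_smul j u).intervalIntegrable _ _)]
  simp only [Sob.transS_transS, add_comm]

theorem Sob.norm_avg_sub_le [CompleteSpace V] {k : ℕ} {h : ℝ} (hh : 0 < h) (j : Fin 3)
    {u : Sob k V} {C : ℝ} (hC : ∀ s ∈ Icc 0 h, ‖Sob.transS (s • e j) u - u‖ ≤ C) :
    ‖Sob.avg h j u - u‖ ≤ C := by
  have h1 : Sob.avg h j u - u = h⁻¹ • ∫ s in (0 : ℝ)..h, (Sob.transS (s • e j) u - u) := by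
    rw [intervalIntegral.integral_sub ((Sob.continuous_transS_smul j u).intervalIntegrable _ _)
      intervalIntegrable_const, smul_sub, Sob.avg, intervalIntegral.integral_const, sub_zero,
      smul_smul, inv_mul_cancel₀ hh.ne', one_smul]
  have h2 := intervalIntegral.norm_integral_le_of_norm_le_const (a := 0) (b := h)
    (f := fun s => Sob.transS (s • e j) u - u) (C := C) (fun r hr => hC r (by
      rw [uIoc_of_le hh.le] at hr; exact ⟨hr.1.le, hr.2⟩))
  rw [h1, norm_smul, norm_inv, Real.norm_eq_abs, abs_of_pos hh, inv_mul_le_iff₀ hh]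
  simpa [abs_of_pos hh, mul_comm] using h2

theorem Sob.norm_avg_le [CompleteSpace V] {k : ℕ} {h : ℝ} (hh : 0 < h) (j : Fin 3)
    (u : Sob k V) : ‖Sob.avg h j u‖ ≤ ‖u‖ := by
  have h2 := intervalIntegral.norm_integral_le_of_norm_le_const (a := 0) (b := h)
    (f := fun s => Sob.transS (s • e j) u) (C := ‖u‖) (fun r _ => (Sob.norm_transS _ _).le)
  rw [Sob.avg, norm_smul, norm_inv, Real.norm_eq_abs, abs_of_pos hh, inv_mul_le_iff₀ hh]
  simpa [abs_of_pos hh, mul_comm] using h2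

theorem Sob.avg_sub [CompleteSpace V] {k : ℕ} (h : ℝ) (j : Fin 3) (u w : Sob k V) :
    Sob.avg h j (u - w) = Sob.avg h j u - Sob.avg h j w := by
  simp only [Sob.avg, map_sub, ← smul_sub]
  rw [intervalIntegral.integral_sub ((Sob.continuous_transS_smul j u).intervalIntegrable _ _)
    ((Sob.continuous_transS_smul j w).intervalIntegrable _ _)]

/-- `Sob.avg` as a continuous linear map. -/
def Sob.avgL [CompleteSpace V] {k : ℕ} {h : ℝ} (hh : 0 < h) (j : Fin 3) :
    Sob k V →L[ℝ] Sob k V :=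
  LinearMap.mkContinuous
    { toFun := Sob.avg h j
      map_add' := fun u w => by
        have := Sob.avg_sub h j (u + w) w
        rw [add_sub_cancel_right] at this
        rw [this, sub_add_cancel]
      map_smul' := fun c u => by
        simp only [Sob.avg, map_smul, intervalIntegral.integral_smul, RingHom.id_apply]
        rw [smul_comm] } 1 fun u => by
    rw [one_mul]; exact Sob.norm_avg_le hh j u

theorem Sob.avg_comm [CompleteSpace V] {k : ℕ} {h : ℝ} (hh : 0 < h) (i j : Fin 3) (u : Sob k V) :
    Sob.avg h i (Sob.avg h j u) = Sob.avg h j (Sob.avg h i u) := by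
  have h1 (w : Sob k V) : Sob.avg h j w = Sob.avgL hh j w := rfl
  rw [h1 (Sob.avg h i u), Sob.avg, Sob.avg.eq_def h i u, map_smul,
    ← ContinuousLinearMap.intervalIntegral_comp_comm _
      ((Sob.continuous_transS_smul i u).intervalIntegrable _ _)]
  simp only [← h1, Sob.transS_avg]

/-- Steklov averages are differentiable along translations. -/
theorem Sob.exists_hasDerivAt_transS_avg [CompleteSpace V] {k : ℕ} (h : ℝ) (j : Fin 3)
    (u : Sob k V) :
    ∃ u', HasDerivAt (fun s : ℝ => Sob.transS (s • e j) (Sob.avg h j u)) u' 0 := by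
  have hc := Sob.continuous_transS_smul j u
  -- Translating the average shifts both endpoints of the integral, leaving a difference of two
  -- primitives of a continuous function.
  have key (s : ℝ) : Sob.transS (s • e j) (Sob.avg h j u)
      = h⁻¹ • ((∫ r in (0 : ℝ)..(s + h), Sob.transS (r • e j) u)
        - ∫ r in (0 : ℝ)..s, Sob.transS (r • e j) u) := by
    rw [Sob.transS_avg, Sob.avg]
    congr 1
    simp only [Sob.transS_transS, ← add_smul]
    rw [intervalIntegral.integral_comp_add_right (fun r => Sob.transS (r • e j) u), zero_add,
      intervalIntegral.integral_interval_sub_left (hc.intervalIntegrable _ _)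
      (hc.intervalIntegrable _ _), add_comm]
  have hd (b : ℝ) : HasDerivAt (fun s : ℝ => ∫ r in (0 : ℝ)..s, Sob.transS (r • e j) u)
      (Sob.transS (b • e j) u) b :=
    (hc.integral_hasStrictDerivAt 0 b).hasDerivAt
  have h1 := (hd (0 + h)).comp_add_const (0 : ℝ) h
  exact ⟨_, ((h1.sub (hd 0)).const_smul h⁻¹).congr_of_eventuallyEq (Eventually.of_forall key)⟩

/-- Averaging over short segments in all three directions approximates u and creates
differentiability in each direction without leaving H^k. -/
theorem Sob.dense_differentiable [CompleteSpace V] (k : ℕ) :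
    Dense {u : Sob k V | ∀ j, ∃ u', HasDerivAt (fun s : ℝ => Sob.transS (s • e j) u) u' 0} := by
  refine Metric.dense_iff.2 fun u r hr => ?_
  have hsmall : ∀ j : Fin 3, ∀ᶠ h in 𝓝[>] (0 : ℝ), ∀ s ∈ Icc 0 h,
      ‖Sob.transS (s • e j) u - u‖ ≤ r / 4 := by
    intro j
    have h0 := (Sob.continuous_transS_smul j u).tendsto 0
    simp only [zero_smul, Sob.transS_zero] at h0
    obtain ⟨δ, hδ, hδ'⟩ := Metric.eventually_nhds_iff.1
      (h0.eventually (Metric.ball_mem_nhds u (show 0 < r / 4 by positivity)))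
    filter_upwards [Ioo_mem_nhdsGT hδ] with h hh s hs
    have := hδ' (y := s) (by
      rw [Real.dist_eq, sub_zero, abs_of_nonneg hs.1]; exact hs.2.trans_lt hh.2)
    rw [dist_eq_norm] at this
    exact this.le
  obtain ⟨h, hh, hpos⟩ := ((eventually_all.2 hsmall).and self_mem_nhdsWithin).exists
  have hpos : 0 < h := hpos
  -- Averaging is a contraction, so each of the three directions costs at most r/4.
  refine ⟨Sob.avg h 0 (Sob.avg h 1 (Sob.avg h 2 u)), ?_, ?_⟩
  · rw [Metric.mem_ball, dist_eq_norm]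
    have h2 := Sob.norm_avg_sub_le hpos 2 (hh 2)
    have h1 : ‖Sob.avg h 1 (Sob.avg h 2 u) - u‖ ≤ r / 4 + r / 4 := by
      calc _ = ‖Sob.avg h 1 (Sob.avg h 2 u - u) + (Sob.avg h 1 u - u)‖ := by
            rw [Sob.avg_sub]; congr 1; abel
        _ ≤ _ := norm_add_le _ _
        _ ≤ _ := add_le_add ((Sob.norm_avg_le hpos _ _).trans h2)
            (Sob.norm_avg_sub_le hpos 1 (hh 1))
    have h0 : ‖Sob.avg h 0 (Sob.avg h 1 (Sob.avg h 2 u)) - u‖ ≤ (r / 4 + r / 4) + r / 4 := by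
      calc _ = ‖Sob.avg h 0 (Sob.avg h 1 (Sob.avg h 2 u) - u) + (Sob.avg h 0 u - u)‖ := by
            rw [Sob.avg_sub]; congr 1; abel
        _ ≤ _ := norm_add_le _ _
        _ ≤ _ := add_le_add ((Sob.norm_avg_le hpos _ _).trans h1)
            (Sob.norm_avg_sub_le hpos 0 (hh 0))
    linarith
  -- The averages commute, so the one in direction j can be made the outermost.
  · intro j
    fin_cases j
    · exact Sob.exists_hasDerivAt_transS_avg h 0 _
    · rw [Sob.avg_comm hpos 0 1]
      exact Sob.exists_hasDerivAt_transS_avg h 1 _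
    · rw [Sob.avg_comm hpos 1 2, Sob.avg_comm hpos 0 2]
      exact Sob.exists_hasDerivAt_transS_avg h 2 _

end

/-! ### The embedding `H² ⊆ L^∞` -/

section

open scoped SchwartzMap FourierTransform LineDeriv Laplacian

open SchwartzMap

theorem norm_top_le_of_ae {V : Type} [NormedAddCommGroup V] {u : Lp V ⊤ (volume : Measure X)} {C : ℝ} (hC : 0 ≤ C)
    (h : ∀ᵐ x, ‖u x‖ ≤ C) : ‖u‖ ≤ C := by
  rw [Lp.norm_def, eLpNorm_exponent_top]
  exact ENNReal.toReal_le_of_le_ofReal hC (eLpNormEssSup_le_of_ae_bound h)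

/-- With the normalisation of the Fourier transform used here the Laplacian has symbol −(2π)²|ξ|²,
whence the constant in front of Δ; multiplying by (1 + |ξ|²) then undoes the multiplier. -/
theorem fourierMultiplier_one_add_norm_sq_mul (f : 𝓢(X, ℂ)) :
    f = fourierMultiplierCLM ℂ (fun ξ : X => (1 + ‖ξ‖ ^ 2) ^ (-1 : ℝ)) f
      - ((2 * Real.pi) ^ 2)⁻¹ •
        Δ (fourierMultiplierCLM ℂ (fun ξ : X => (1 + ‖ξ‖ ^ 2) ^ (-1 : ℝ)) f) := by
  have hm : (fun ξ : X => (1 + ‖ξ‖ ^ 2) ^ (-1 : ℝ)).HasTemperateGrowth := by fun_prop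
  have hq : (fun ξ : X => ‖ξ‖ ^ 2).HasTemperateGrowth := by fun_prop
  rw [laplacian_eq_fourierMultiplierCLM, neg_smul, smul_neg, sub_neg_eq_add, smul_smul,
    inv_mul_cancel₀ (by positivity), one_smul]
  set g := fourierMultiplierCLM ℂ (fun ξ : X => (1 + ‖ξ‖ ^ 2) ^ (-1 : ℝ)) f with hg
  have h1 : g = fourierMultiplierCLM ℂ (fun _ : X => (1 : ℝ)) g := by simp
  have h2 : fourierMultiplierCLM ℂ (‖·‖ ^ 2 : X → ℝ) g =
      fourierMultiplierCLM ℂ ((fun ξ : X => ‖ξ‖ ^ 2) * fun ξ : X => (1 + ‖ξ‖ ^ 2) ^ (-1 : ℝ)) f :=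
    fourierMultiplierCLM_fourierMultiplierCLM_apply hq hm f
  have hone : f = fourierMultiplierCLM ℂ (fun _ : X => (1 : ℝ)) f := by simp
  have hsum : fourierMultiplierCLM ℂ (fun _ : X => (1 : ℝ)) f
      = fourierMultiplierCLM ℂ (fun ξ : X => (1 + ‖ξ‖ ^ 2) ^ (-1 : ℝ)) f
        + fourierMultiplierCLM ℂ
          ((fun ξ : X => ‖ξ‖ ^ 2) * fun ξ : X => (1 + ‖ξ‖ ^ 2) ^ (-1 : ℝ)) f := by
    simp only [fourierMultiplierCLM_apply]
    rw [← FourierTransform.fourierInv_add]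
    congr 1
    ext ξ
    rw [add_apply, smulLeftCLM_apply_apply (by fun_prop), smulLeftCLM_apply_apply hm,
      smulLeftCLM_apply_apply (hq.mul hm), ← add_smul]
    congr 1
    have : (0 : ℝ) < 1 + ‖ξ‖ ^ 2 := by positivity
    simp only [Pi.mul_apply, Real.rpow_neg_one]
    field_simp
  rw [h2, hg, ← hsum]
  exact hone

theorem memLp_one_add_norm_sq : MemLp (fun ξ : X => (1 + ‖ξ‖ ^ 2) ^ (-1 : ℝ)) 2 := by
  have hc : Continuous fun ξ : X => (1 + ‖ξ‖ ^ 2) ^ (-1 : ℝ) :=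
    ((Function.hasTemperateGrowth_one_add_norm_sq_rpow X (-1)).1).continuous
  refine (memLp_two_iff_integrable_sq hc.aestronglyMeasurable).2 ?_
  -- Squaring gives (1 + |ξ|²)^(−2), integrable because 4 exceeds the dimension 3. This is where the
  -- dimension enters the embedding of H² into L^∞.
  have := integrable_rpow_neg_one_add_norm_sq (E := X) (μ := volume) (r := 4) (by simp; norm_num)
  refine this.congr (Eventually.of_forall fun ξ => ?_)
  have : (0 : ℝ) ≤ 1 + ‖ξ‖ ^ 2 := by positivity
  simp only
  rw [← Real.rpow_mul_natCast this]
  norm_num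

/-- The `L²`-norm of `(1 + |ξ|²)⁻¹`. -/
def resolventConst : ℝ := ‖memLp_one_add_norm_sq.toLp‖

theorem resolventConst_nonneg : 0 ≤ resolventConst := norm_nonneg _

/-- By Plancherel the left side is the L² norm of (1 + |ξ|²)⁻¹ times the transform of f, and the sup
norm of that transform is at most the L¹ norm of f. -/
theorem norm_fourierMultiplier_le (f : 𝓢(X, ℂ)) :
    ‖(fourierMultiplierCLM ℂ (fun ξ : X => (1 + ‖ξ‖ ^ 2) ^ (-1 : ℝ)) f).toLp 2‖
      ≤ resolventConst * ∫ x, ‖f x‖ := by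
  have hm : (fun ξ : X => (1 + ‖ξ‖ ^ 2) ^ (-1 : ℝ)).HasTemperateGrowth := by fun_prop
  rw [← norm_fourier_toL2_eq, fourierMultiplierCLM_apply, FourierTransform.fourier_fourierInv_eq]
  have h1 : (smulLeftCLM ℂ (fun ξ : X => (1 + ‖ξ‖ ^ 2) ^ (-1 : ℝ)) (𝓕 f)).toLp 2
      = ((memLp_one_add_norm_sq.toLp : Lp ℝ 2 (volume : Measure X))
        • ((𝓕 f).toLp ⊤ : Lp ℂ ⊤ (volume : Measure X)) : Lp ℂ 2 (volume : Measure X)) := by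
    refine Lp.ext ?_
    filter_upwards [coeFn_toLp (smulLeftCLM ℂ (fun ξ : X => (1 + ‖ξ‖ ^ 2) ^ (-1 : ℝ)) (𝓕 f)) 2,
      Lp.coeFn_lpSMul (r := 2) (memLp_one_add_norm_sq.toLp : Lp ℝ 2 (volume : Measure X))
        ((𝓕 f).toLp ⊤ : Lp ℂ ⊤ (volume : Measure X)),
      memLp_one_add_norm_sq.coeFn_toLp, coeFn_toLp (𝓕 f) ⊤] with ξ h1 h2 h3 h4
    rw [h1, h2, smulLeftCLM_apply_apply hm, Pi.smul_apply', h3, h4]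
  rw [h1]
  refine (Lp.norm_smul_le _ _).trans ?_
  refine mul_le_mul_of_nonneg_left ?_ resolventConst_nonneg
  refine (norm_fourier_Lp_top_leq_toLp_one f).trans ?_
  rw [norm_toLp_one]

theorem schwartz_isWeakDeriv (f : 𝓢(X, ℝ)) (j : Fin 3) :
    IsWeakDeriv (Pi.single j 1) (f.toLp 2 : L2 ℝ) ((∂_{e j} f).toLp 2 : L2 ℝ) := by
  have h1 : IsWeakDeriv (Pi.single j 1) (f : X → ℝ) ((∂_{e j} f : 𝓢(X, ℝ)) : X → ℝ) := by
    intro χ hχ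
    have h2 := integral_mul_lineDerivOp_right_eq_neg_left (μ := volume)
      f (hχ.2.toSchwartzMap hχ.1) (e j)
    rw [multiD_single]
    simp only [sum_single_one, pow_one, smul_eq_mul, neg_one_mul]
    simp only [mul_comm (Visco.partialD j χ _), mul_comm (χ _)]
    exact h2
  exact h1.congr (f.coeFn_toLp 2).symm ((∂_{e j} f).coeFn_toLp 2).symm

theorem postcomp_re_lineDeriv (f : 𝓢(X, ℂ)) (v : X) :
    postcompCLM Complex.reCLM (∂_{v} f) = ∂_{v} (postcompCLM Complex.reCLM f) := by
  ext x
  have h1 : HasFDerivAt (fun y => Complex.reCLM (f y)) (Complex.reCLM.comp (fderiv ℝ f x)) x :=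
    Complex.reCLM.hasFDerivAt.comp x (f.hasFDerivAt x)
  change Complex.reCLM (fderiv ℝ f x v) = fderiv ℝ (fun y => Complex.reCLM (f y)) x v
  rw [h1.fderiv]; rfl

theorem norm_toLp_re_le (f : 𝓢(X, ℂ)) :
    ‖(postcompCLM Complex.reCLM f).toLp 2‖ ≤ ‖f.toLp 2‖ := by
  refine Lp.norm_le_norm_of_ae_le ?_
  filter_upwards [(postcompCLM Complex.reCLM f).coeFn_toLp 2, f.coeFn_toLp 2] with x h1 h2
  rw [h1, h2]
  exact Complex.abs_re_le_norm _

/-- The resolvent of the complexified function does the job after taking real parts, which commute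
with derivatives and do not increase the L² norm. -/
theorem exists_real_resolvent (f : 𝓢(X, ℝ)) :
    ∃ g : 𝓢(X, ℝ), f = g - ((2 * Real.pi) ^ 2)⁻¹ • ∑ j, ∂_{e j} (∂_{e j} g) ∧
      ‖g.toLp 2‖ ≤ resolventConst * ∫ x, ‖f x‖ := by
  have h0 : postcompCLM Complex.reCLM (postcompCLM Complex.ofRealCLM f) = f := by
    ext x
    simp
  refine ⟨postcompCLM Complex.reCLM
    (fourierMultiplierCLM ℂ (fun ξ : X => (1 + ‖ξ‖ ^ 2) ^ (-1 : ℝ))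
      (postcompCLM Complex.ofRealCLM f)), ?_, ?_⟩
  · have h1 := congrArg (postcompCLM Complex.reCLM)
      (fourierMultiplier_one_add_norm_sq_mul (postcompCLM Complex.ofRealCLM f))
    rw [laplacian_eq_sum (EuclideanSpace.basisFun (Fin 3) ℝ), map_sub, map_smul, map_sum, h0] at h1
    simpa only [EuclideanSpace.basisFun_apply, postcomp_re_lineDeriv] using h1
  · refine (norm_toLp_re_le _).trans ((norm_fourierMultiplier_le _).trans (le_of_eq ?_))
    congr 2
    ext x
    simp

/-- For a test function `φ` there is `ψ ∈ L²` with `ψ - (2π)⁻² Δψ = φ`. -/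
theorem IsTest.exists_resolvent {φ : X → ℝ} (hφ : IsTest φ) :
    ∃ (ψ : L2 ℝ) (ψ₁ ψ₂ : Fin 3 → L2 ℝ),
      (∀ j, IsWeakDeriv (Pi.single j 1) ψ (ψ₁ j)) ∧
      (∀ j, IsWeakDeriv (Pi.single j 1) (ψ₁ j) (ψ₂ j)) ∧
      (hφ.memLp 2).toLp = ψ - ((2 * Real.pi) ^ 2)⁻¹ • ∑ j, ψ₂ j ∧
      ‖ψ‖ ≤ resolventConst * ∫ x, ‖φ x‖ := by
  obtain ⟨g, h1, h2⟩ := exists_real_resolvent (hφ.2.toSchwartzMap hφ.1)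
  have h3 := congrArg (toLpCLM ℝ ℝ 2 (volume : Measure X)) h1
  rw [map_sub, map_smul, map_sum] at h3
  have h4 : (hφ.memLp 2).toLp = toLpCLM ℝ ℝ 2 (volume : Measure X) (hφ.2.toSchwartzMap hφ.1) := by
    exact rfl
  refine ⟨g.toLp 2, fun j => (∂_{e j} g).toLp 2, fun j => (∂_{e j} (∂_{e j} g)).toLp 2,
    fun j => schwartz_isWeakDeriv _ j, fun j => schwartz_isWeakDeriv _ j, ?_, ?_⟩
  · rw [h4, h3]; rfl
  · exact h2

end

/-! ### From the resolvent to the embedding, by duality -/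

section

variable {V : Type} [NormedAddCommGroup V] [InnerProductSpace ℝ V] [CompleteSpace V]

/-- The pairing `(ψ, u) ↦ ∫ ψ u`. -/
def pairL : L2 ℝ →L[ℝ] L2 V →L[ℝ] V := (ContinuousLinearMap.lsmul ℝ ℝ).lpPairing volume 2 2

theorem pairL_apply (ψ : L2 ℝ) (u : L2 V) : pairL ψ u = ∫ x, ψ x • u x := by
  rw [pairL, ContinuousLinearMap.lpPairing_eq_integral]; rfl

theorem norm_pairL_le (ψ : L2 ℝ) (u : L2 V) : ‖pairL ψ u‖ ≤ ‖ψ‖ * ‖u‖ := by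
  have h0 : pairL ψ u = L1.integral
      ((ContinuousLinearMap.lsmul ℝ ℝ : ℝ →L[ℝ] V →L[ℝ] V).holder 1 ψ u) := by
    rw [pairL_apply, L1.integral_eq_integral]
    exact integral_congr_ae (ContinuousLinearMap.coeFn_holder
      (ContinuousLinearMap.lsmul ℝ ℝ : ℝ →L[ℝ] V →L[ℝ] V) ψ u).symm
  rw [h0]
  refine (L1.norm_integral_le _).trans ((ContinuousLinearMap.norm_holder_apply_apply_le _ _ _).trans ?_)
  have : ‖(ContinuousLinearMap.lsmul ℝ ℝ : ℝ →L[ℝ] V →L[ℝ] V)‖ ≤ 1 :=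
    ContinuousLinearMap.opNorm_lsmul_le
  calc _ ≤ 1 * ‖ψ‖ * ‖u‖ := by gcongr
    _ = _ := by ring

theorem pairL_trans (a : X) (ψ : L2 ℝ) (u : L2 V) :
    pairL (trans a ψ) u = pairL ψ (trans (-a) u) := by
  rw [pairL_apply, pairL_apply, ← integral_add_right_eq_self (fun x => ψ x • trans (-a) u x) a]
  refine integral_congr_ae ?_
  filter_upwards [trans_ae a ψ, ae_translate (trans_ae (-a) u) a] with x h1 h2
  rw [h1, h2]
  simp

/-- Translation can be moved from one factor to the other with the opposite sign; differentiating at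
zero gives integration by parts for two merely L² factors with L² derivatives. -/
theorem pairL_ibp {j : Fin 3} {ψ ψ' : L2 ℝ} {u u' : L2 V}
    (h : IsWeakDeriv (Pi.single j 1) ψ ψ') (h' : IsWeakDeriv (Pi.single j 1) u u') :
    pairL ψ' u = -pairL ψ u' := by
  have h1 : HasDerivAt (fun s : ℝ => pairL (trans (s • e j) ψ) u) (pairL ψ' u) 0 :=
    ((pairL (V := V)).flip u).hasFDerivAt.comp_hasDerivAt 0 h.hasDerivAt
  have h2 : HasDerivAt (fun s : ℝ => trans (-s • e j) u) (-u') 0 := by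
    have h0 : HasDerivAt (fun s : ℝ => trans (s • e j) u) u' (-0 : ℝ) := by
      simpa using h'.hasDerivAt
    have := h0.scomp (0 : ℝ) (hasDerivAt_neg (0 : ℝ))
    simpa [Function.comp_def] using this
  have h3 := (pairL (V := V) ψ).hasFDerivAt.comp_hasDerivAt 0 h2
  have h4 := h1.unique (h3.congr_of_eventuallyEq (Eventually.of_forall fun s => by
    simp [pairL_trans]))
  rw [h4, map_neg]

/-- Normalised bumps shrinking to x have L¹ norm 1, and by Lebesgue differentiation the tested
values converge to u(x) almost everywhere. -/
theorem ae_norm_le_of_testL_le {u : L2 V} {K : ℝ}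
    (h : ∀ (φ : X → ℝ) (hφ : IsTest φ), ‖testL hφ u‖ ≤ K * ∫ x, ‖φ x‖) :
    ∀ᵐ x, ‖u x‖ ≤ K := by
  let b : ℕ → ContDiffBump (0 : X) := fun n =>
    ⟨((n : ℝ) + 1)⁻¹, 2 * ((n : ℝ) + 1)⁻¹, by positivity, by
      have : 0 < ((n : ℝ) + 1)⁻¹ := by positivity
      linarith⟩
  have hr : Tendsto (fun n => (b n).rOut) atTop (𝓝 0) := by
    have := (tendsto_one_div_add_atTop_nhds_zero_nat (𝕜 := ℝ)).const_mul 2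
    simpa [b] using this
  filter_upwards [ContDiffBump.ae_convolution_tendsto_right_of_locallyIntegrable (K := 2) hr
    (Eventually.of_forall fun n => le_rfl)
    ((Lp.memLp u).locallyIntegrable (by norm_num))] with x hx
  refine le_of_tendsto hx.norm (Eventually.of_forall fun n => ?_)
  let φ : X → ℝ := fun z => (b n).normed volume (x - z)
  have hφ : IsTest φ :=
    ⟨(b n).contDiff_normed.comp (contDiff_const.sub contDiff_id),
      (b n).hasCompactSupport_normed.comp_homeomorph (Homeomorph.subLeft x)⟩
  have h1 := h φ hφ
  have h2 : ∫ z, ‖φ z‖ = 1 := by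
    simp only [φ, Real.norm_of_nonneg ((b n).nonneg_normed _)]
    rw [integral_sub_left_eq_self (fun z => (b n).normed volume z) volume x, (b n).integral_normed]
  rw [testL_apply, h2, mul_one] at h1
  rw [convolution_eq_swap]
  exact h1

/-- Writing φ = ψ − cΔψ and integrating by parts twice turns ∫φu into ∫ψ(u − cΔu), at most ‖ψ‖ times
a multiple of the H² norm of u. As ‖ψ‖ is controlled by the L¹ norm of φ, u defines a bounded
functional on L¹, hence lies in L^∞. -/
theorem exists_sobolev_const : ∃ C : ℝ, 0 ≤ C ∧ ∀ (u : Sob 2 V), ∀ᵐ x, ‖u.val x‖ ≤ C * ‖u‖ := by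
  let c := ((2 * Real.pi) ^ 2)⁻¹
  let L : Sob 2 V →L[ℝ] L2 V :=
    Sob.DL 0 - c • ∑ j : Fin 3, Sob.DL (Pi.single j 1 + Pi.single j 1)
  refine ⟨resolventConst * ‖L‖, mul_nonneg resolventConst_nonneg L.opNorm_nonneg, fun u => ?_⟩
  refine ae_norm_le_of_testL_le fun φ hφ => ?_
  obtain ⟨ψ, ψ₁, ψ₂, h1, h2, h3, h4⟩ := hφ.exists_resolvent
  have hm (j : Fin 3) : Pi.single j 1 ∈ multiIdx 1 := single_mem_multiIdx j
  have key : testL hφ u.val = pairL ψ (L u) := by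
    have e1 : testL hφ u.val = pairL ((hφ.memLp 2).toLp) u.val := rfl
    have e2 (j : Fin 3) : pairL (ψ₂ j) u.val = pairL ψ (u.D (Pi.single j 1 + Pi.single j 1)) := by
      rw [pairL_ibp (h2 j) (u.isWeakDeriv (multiIdx_mono one_le_two (hm j))),
        pairL_ibp (h1 j) (u.isWeakDeriv_D (hm j) j), neg_neg]
    rw [e1, h3]
    simp only [map_sub, map_smul, map_sum, sub_apply,
      smul_apply, sum_apply, e2, L, Sob.DL_apply]
    rfl
  rw [key]
  calc _ ≤ ‖ψ‖ * ‖L u‖ := norm_pairL_le _ _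
    _ ≤ (resolventConst * ∫ x, ‖φ x‖) * (‖L‖ * ‖u‖) :=
        mul_le_mul h4 (L.le_opNorm u) (norm_nonneg _) ((norm_nonneg _).trans h4)
    _ = _ := by ring

/-- The embedding `H² ⊆ L^∞`. -/
theorem exists_sobolev_embedding :
    ∃ J : Sob 2 V →L[ℝ] Lp V ⊤ (volume : Measure X), ∀ u, J u =ᵐ[volume] u.val := by
  obtain ⟨C, hC0, hC⟩ := exists_sobolev_const (V := V)
  have hmem (u : Sob 2 V) : MemLp (u.val : X → V) ⊤ :=
    memLp_top_of_bound (Lp.aestronglyMeasurable _) _ (hC u)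
  have hae (u : Sob 2 V) : (hmem u).toLp =ᵐ[volume] u.val := (hmem u).coeFn_toLp
  refine ⟨LinearMap.mkContinuous
    { toFun := fun u => (hmem u).toLp
      map_add' := fun u w => ?_
      map_smul' := fun c u => ?_ } C fun u => ?_, hae⟩
  · refine Lp.ext ?_
    filter_upwards [hae u, hae w, hae (u + w), Lp.coeFn_add (hmem u).toLp (hmem w).toLp,
      Lp.coeFn_add u.val w.val] with x h1 h2 h3 h4 h5
    rw [h3, h4, Pi.add_apply, h1, h2, Sob.val_eq, Sob.D_add]
    exact h5
  · refine Lp.ext ?_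
    filter_upwards [hae u, hae (c • u), Lp.coeFn_smul c (hmem u).toLp,
      Lp.coeFn_smul c u.val] with x h1 h3 h4 h5
    rw [h3, RingHom.id_apply, h4, Pi.smul_apply, h1, Sob.val_eq, Sob.D_smul]
    exact h5
  · refine norm_top_le_of_ae (by positivity) ?_
    filter_upwards [hae u, hC u] with x h1 h2
    exact (congrArg norm h1).trans_le h2

end

/-! ### Superposition operators -/

section

variable {V V' : Type} [NormedAddCommGroup V] [NormedSpace ℝ V] [FiniteDimensional ℝ V]
  [NormedAddCommGroup V'] [NormedSpace ℝ V']

/-- `L^∞(ℝ³; V)`. -/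
abbrev Linf (V : Type) [NormedAddCommGroup V] : Type := Lp V ⊤ (volume : Measure X)

theorem ae_norm_le_norm {W : Type} [NormedAddCommGroup W] (u : Linf W) : ∀ᵐ x, ‖u x‖ ≤ ‖u‖ := by
  have h := ae_le_eLpNormEssSup (f := (u : X → W)) (μ := volume)
  filter_upwards [h] with x hx
  rw [Lp.norm_def, eLpNorm_exponent_top, ← toReal_enorm]
  refine ENNReal.toReal_mono ?_ hx
  have := (Lp.memLp u).2
  rw [eLpNorm_exponent_top] at this
  exact this.ne

theorem exists_lipschitz_bound {g : V → V'} (hg : ContDiff ℝ 1 g) (R : ℝ) :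
    ∃ C : ℝ, 0 ≤ C ∧ ∀ a b : V, ‖a‖ ≤ R → ‖b‖ ≤ R → ‖g b - g a‖ ≤ C * ‖b - a‖ := by
  obtain ⟨C, hC⟩ := (isCompact_closedBall (0 : V) R).exists_bound_of_continuousOn
    (hg.continuous_fderiv (by norm_num)).continuousOn
  refine ⟨max C 0, le_max_right _ _, fun a b ha hb => ?_⟩
  exact (convex_closedBall (0 : V) R).norm_image_sub_le_of_norm_fderiv_le
    (fun x _ => (hg.differentiable (by norm_num)) x)
    (fun x hx => (hC x hx).trans (le_max_left _ _)) (by simpa using ha) (by simpa using hb)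

/-- The derivative of g is Lipschitz on the ball; apply the mean value inequality to g minus its
linearisation at a along the segment. -/
theorem exists_taylor_bound {g : V → V'} (hg : ContDiff ℝ 2 g) (R : ℝ) :
    ∃ C : ℝ, 0 ≤ C ∧ ∀ a b : V, ‖a‖ ≤ R → ‖b‖ ≤ R →
      ‖g b - g a - fderiv ℝ g a (b - a)‖ ≤ C * ‖b - a‖ * ‖b - a‖ := by
  obtain ⟨C, hC0, hC⟩ := exists_lipschitz_bound (hg.fderiv_right (m := 1) (by norm_num)) R
  refine ⟨C, hC0, fun a b ha hb => ?_⟩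
  have hd (x : V) : HasFDerivAt g (fderiv ℝ g x) x := (hg.differentiable (by norm_num) x).hasFDerivAt
  have h1 := (convex_segment a b).norm_image_sub_le_of_norm_hasFDerivWithin_le
    (f := fun x => g x - fderiv ℝ g a x) (f' := fun x => fderiv ℝ g x - fderiv ℝ g a)
    (C := C * ‖b - a‖)
    (fun x _ => ((hd x).sub (fderiv ℝ g a).hasFDerivAt).hasFDerivWithinAt)
    (fun x hx => ?_) (left_mem_segment ℝ a b) (right_mem_segment ℝ a b)
  · rw [map_sub]
    convert h1 using 2
    abel
  · have hxR : ‖x‖ ≤ R := by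
      have := (convex_closedBall (0 : V) R).segment_subset (x := a) (y := b)
        (by simpa using ha) (by simpa using hb) hx
      simpa using this
    refine (hC a x ha hxR).trans ?_
    gcongr
    simpa using norm_sub_le_of_mem_segment hx

theorem memLp_top_comp {V' : Type} [NormedAddCommGroup V'] {g : V → V'} (hg : Continuous g) (u : Linf V) :
    MemLp (fun x => g (u x)) ⊤ (volume : Measure X) := by
  obtain ⟨C, hC⟩ := (isCompact_closedBall (0 : V) ‖u‖).exists_bound_of_continuousOn hg.continuousOn
  refine memLp_top_of_bound (hg.comp_aestronglyMeasurable (Lp.aestronglyMeasurable u)) C ?_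
  filter_upwards [ae_norm_le_norm u] with x hx
  exact hC _ (by simpa using hx)

/-- The superposition operator `u ↦ g ∘ u` on `L^∞`. -/
def superpos {V' : Type} [NormedAddCommGroup V'] {g : V → V'} (hg : Continuous g) (u : Linf V) : Linf V' := (memLp_top_comp hg u).toLp

theorem superpos_ae {V' : Type} [NormedAddCommGroup V'] {g : V → V'} (hg : Continuous g) (u : Linf V) :
    superpos hg u =ᵐ[volume] fun x => g (u x) := (memLp_top_comp hg u).coeFn_toLp

theorem continuous_superpos {g : V → V'} (hg : ContDiff ℝ 1 g) :
    Continuous (superpos hg.continuous) := by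
  refine continuous_iff_continuousAt.2 fun u => ?_
  obtain ⟨C, hC0, hC⟩ := exists_lipschitz_bound hg (‖u‖ + 1)
  have hev : ∀ᶠ w in 𝓝 u, ‖superpos hg.continuous w - superpos hg.continuous u‖ ≤ C * ‖w - u‖ := by
    filter_upwards [Metric.ball_mem_nhds u one_pos] with w hw
    have hw' : ‖w‖ ≤ ‖u‖ + 1 := by
      rw [Metric.mem_ball, dist_eq_norm] at hw
      linarith [norm_sub_norm_le w u]
    refine Lp.norm_le_mul_norm_of_ae_le_mul ?_
    filter_upwards [superpos_ae hg.continuous w, superpos_ae hg.continuous u, Lp.coeFn_sub w u,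
      Lp.coeFn_sub (superpos hg.continuous w) (superpos hg.continuous u), ae_norm_le_norm u,
      ae_norm_le_norm w] with x h1 h2 h3 h4 h5 h6
    rw [h3, h4, Pi.sub_apply, Pi.sub_apply, h1, h2]
    exact hC _ _ (by linarith) (by linarith)
  rw [ContinuousAt, tendsto_iff_norm_sub_tendsto_zero]
  have h0 : Tendsto (fun w => C * ‖w - u‖) (𝓝 u) (𝓝 0) := by
    have : Continuous fun w : Linf V => C * ‖w - u‖ := by fun_prop
    simpa using this.tendsto u
  exact squeeze_zero' (Eventually.of_forall fun _ => norm_nonneg _) hev h0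

theorem memLp_superpos_sub {p : ENNReal} {g : V → V'} (hg : ContDiff ℝ 1 g) (u : Linf V)
    (w : Lp V p (volume : Measure X)) (h : u =ᵐ[volume] w) :
    MemLp (fun x => g (u x) - g 0) p (volume : Measure X) := by
  obtain ⟨C, hC0, hC⟩ := exists_lipschitz_bound hg ‖u‖
  refine (Lp.memLp w).of_le_mul (c := C)
    ((hg.continuous.comp_aestronglyMeasurable (Lp.aestronglyMeasurable u)).sub
      aestronglyMeasurable_const) ?_
  filter_upwards [ae_norm_le_norm u, h] with x h1 h2
  simpa [h2] using hC 0 (u x) (by simp) h1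

variable {E : Type*} [NormedAddCommGroup E] [NormedSpace ℝ E]

/-- ι and κ give the same function, seen in L^∞ and in L^p. In the quadratic Taylor remainder one
increment is measured in L^∞ and the other in L^p, so it is quadratically small in E. Subtracting
g(0) is what puts the result in L^p on a space of infinite measure. -/
theorem exists_contDiff_superpos {p : ENNReal} [Fact (1 ≤ p)] {g : V → V'} (hg : ContDiff ℝ 2 g)
    (ι : E →L[ℝ] Linf V) (κ : E →L[ℝ] Lp V p (volume : Measure X))
    (h : ∀ F, ι F =ᵐ[volume] κ F) :
    ∃ Ψ : E → Lp V' p (volume : Measure X), ContDiff ℝ 1 Ψ ∧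
      ∀ F, Ψ F =ᵐ[volume] fun x => g (ι F x) - g 0 := by
  have hg1 : ContDiff ℝ 1 g := hg.of_le (by norm_num)
  have hDg : ContDiff ℝ 1 (fderiv ℝ g) := hg.fderiv_right (by norm_num)
  let Ψ : E → Lp V' p (volume : Measure X) := fun F => (memLp_superpos_sub hg1 (ι F) (κ F) (h F)).toLp
  have hΨ (F : E) : Ψ F =ᵐ[volume] fun x => g (ι F x) - g 0 := MemLp.coeFn_toLp _
  let B : Linf (V →L[ℝ] V') →L[ℝ] Lp V p (volume : Measure X) →L[ℝ] Lp V' p (volume : Measure X) :=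
    (ContinuousLinearMap.id ℝ (V →L[ℝ] V')).holderL volume ⊤ p p
  have hB (a : Linf (V →L[ℝ] V')) (w : Lp V p (volume : Measure X)) :
      B a w =ᵐ[volume] fun x => a x (w x) := ContinuousLinearMap.coeFn_holder _ a w
  let Ψ' : E → E →L[ℝ] Lp V' p (volume : Measure X) :=
    fun F => (B (superpos hDg.continuous (ι F))).comp κ
  refine ⟨Ψ, contDiff_one_iff_hasFDerivAt.2 ⟨Ψ', ?_, fun F => ?_⟩, hΨ⟩
  · exact (B.continuous.comp ((continuous_superpos hDg).comp ι.continuous)).clm_comp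
      continuous_const
  · obtain ⟨C, hC0, hC⟩ := exists_taylor_bound hg (‖ι F‖ + ‖ι‖)
    rw [hasFDerivAt_iff_isLittleO_nhds_zero]
    have hbound : ∀ᶠ k in 𝓝 (0 : E),
        ‖Ψ (F + k) - Ψ F - Ψ' F k‖ ≤ (C * ‖ι‖ * ‖κ‖) * ‖‖k‖ ^ 2‖ := by
      filter_upwards [Metric.ball_mem_nhds (0 : E) one_pos] with k hk
      rw [Metric.mem_ball, dist_zero_right] at hk
      have hk' : ‖ι k‖ ≤ ‖ι‖ := (ι.le_opNorm k).trans (mul_le_of_le_one_right (norm_nonneg _) hk.le)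
      have h1 : ‖Ψ (F + k) - Ψ F - Ψ' F k‖ ≤ (C * ‖ι k‖) * ‖κ k‖ := by
        refine Lp.norm_le_mul_norm_of_ae_le_mul ?_
        filter_upwards [hΨ (F + k), hΨ F, hB (superpos hDg.continuous (ι F)) (κ k),
          superpos_ae hDg.continuous (ι F), Lp.coeFn_sub (Ψ (F + k) - Ψ F) (Ψ' F k),
          Lp.coeFn_sub (Ψ (F + k)) (Ψ F), ae_norm_le_norm (ι F), ae_norm_le_norm (ι k), h k,
          Lp.coeFn_add (ι F) (ι k)] with x h1 h2 h3 h4 h5 h6 h7 h8 h9 h10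
        have h11 : ι (F + k) x = ι F x + κ k x := by rw [map_add, h10, Pi.add_apply, h9]
        have h12 : Ψ' F k x = fderiv ℝ g (ι F x) (κ k x) := by
          rw [← h4]; exact h3
        rw [h5, Pi.sub_apply, h6, Pi.sub_apply, h1, h2, h11, h12, sub_sub_sub_cancel_right]
        rw [h9] at h8
        have h13 := hC (ι F x) (ι F x + κ k x) (by linarith [norm_nonneg ι])
          ((norm_add_le _ _).trans (by linarith))
        rw [add_sub_cancel_left] at h13
        exact h13.trans (by gcongr)
      refine h1.trans ?_
      rw [norm_pow, norm_norm]
      calc _ ≤ C * (‖ι‖ * ‖k‖) * (‖κ‖ * ‖k‖) := by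
            gcongr
            · exact ι.le_opNorm k
            · exact κ.le_opNorm k
        _ = _ := by ring
    exact (Asymptotics.IsBigO.of_bound _ hbound).trans_isLittleO
      (Asymptotics.isLittleO_norm_pow_id one_lt_two)

end

/-! ### Chain and product rules -/

/-- Chain rule through difference quotients. The tested Taylor remainder is at most a constant times
‖δ‖² with ‖δ‖ ≤ ‖f'‖|s|, so it vanishes after division by s, while the linear part converges in L²
because multiplication by the bounded function g'(f) is continuous. -/
theorem isWeakDeriv_superpos {V : Type} [NormedAddCommGroup V] [InnerProductSpace ℝ V]
    [FiniteDimensional ℝ V] {g : V → ℝ} (hg : ContDiff ℝ 2 g) {j : Fin 3} {f f' : L2 V}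
    {u w : L2 ℝ} (hf : IsWeakDeriv (Pi.single j 1) f f') (a : Linf V) (ha : a =ᵐ[volume] f)
    (hu : u =ᵐ[volume] fun x => g (f x) - g 0)
    (hw : w =ᵐ[volume] fun x => fderiv ℝ g (f x) (f' x)) :
    IsWeakDeriv (Pi.single j 1) u w := by
  have : CompleteSpace V := FiniteDimensional.complete ℝ V
  have hDg : ContDiff ℝ 1 (fderiv ℝ g) := hg.fderiv_right (by norm_num)
  obtain ⟨C, hC0, hC⟩ := exists_taylor_bound hg ‖a‖
  let B : L2 V →L[ℝ] L2 ℝ := (ContinuousLinearMap.id ℝ (V →L[ℝ] ℝ)).holderL volume ⊤ 2 2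
    (superpos hDg.continuous a)
  have hB (v : L2 V) : B v =ᵐ[volume] fun x => fderiv ℝ g (f x) (v x) := by
    filter_upwards [ContinuousLinearMap.coeFn_holder (r := 2) (ContinuousLinearMap.id ℝ (V →L[ℝ] ℝ))
      (superpos hDg.continuous a) v, superpos_ae hDg.continuous a, ha] with x h1 h2 h3
    rw [← h3, ← h2]; exact h1
  have hwB : w = B f' := by
    refine Lp.ext ?_
    filter_upwards [hw, hB f'] with x h1 h2
    rw [h1, h2]
  have hfa : ∀ᵐ x, ‖f x‖ ≤ ‖a‖ := by
    filter_upwards [ae_norm_le_norm a, ha] with x h1 h2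
    rwa [← h2]
  refine isWeakDeriv_of_tendsto fun φ hφ => ?_
  obtain ⟨M, hM⟩ := hφ.1.continuous.bounded_above_of_compact_support hφ.2
  have hM0 : 0 ≤ M := (norm_nonneg _).trans (hM 0)
  have hmain : Tendsto (fun s : ℝ => s⁻¹ • testL hφ (B (trans (s • e j) f - f))) (𝓝[≠] 0)
      (𝓝 (testL hφ w)) := by
    rw [hwB]
    refine ((((testL hφ).comp B).continuous.tendsto _).comp hf.hasDerivAt.tendsto_slope).congr
      fun s => ?_
    simp [slope, trans_zero]
  have hrem (s : ℝ) : ‖testL hφ (trans (s • e j) u - u) - testL hφ (B (trans (s • e j) f - f))‖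
      ≤ M * C * (‖f'‖ * |s|) ^ 2 := by
    set δ := trans (s • e j) f - f with hδ
    have hsq : Integrable fun x => ‖δ x‖ ^ 2 := (Lp.memLp δ).integrable_norm_pow (by norm_num)
    have hnorm : ∫ x, ‖δ x‖ ^ 2 = ‖δ‖ ^ 2 := by
      rw [← real_inner_self_eq_norm_sq, L2.inner_def]
      simp
    have h1 : ‖testL hφ (trans (s • e j) u - u - B δ)‖ ≤ ∫ x, M * C * ‖δ x‖ ^ 2 := by
      rw [testL_apply]
      refine norm_integral_le_of_norm_le (hsq.const_mul _) ?_
      filter_upwards [Lp.coeFn_sub (trans (s • e j) u - u) (B δ), Lp.coeFn_sub (trans (s • e j) u) u,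
        hB δ, Lp.coeFn_sub (trans (s • e j) f) f, trans_ae (s • e j) u, trans_ae (s • e j) f,
        hu, ae_translate hu (s • e j), hfa, ae_translate hfa (s • e j)]
        with x h1 h2 h3 h4 h5 h6 h7 h8 h9 h10
      have h11 : δ x = f (x + s • e j) - f x := by rw [hδ, h4, Pi.sub_apply, h6]
      rw [h1, Pi.sub_apply, h2, Pi.sub_apply, h5, h8, h7, h3, sub_sub_sub_cancel_right, h11,
        norm_smul, mul_assoc, sq, ← mul_assoc C]
      exact mul_le_mul (hM x) (hC _ _ h9 h10) (norm_nonneg _) hM0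
    rw [integral_const_mul, hnorm] at h1
    rw [← map_sub]
    refine h1.trans ?_
    gcongr
    exact hf.norm_trans_sub_le s
  have hzero : Tendsto (fun s : ℝ => s⁻¹ • (testL hφ (trans (s • e j) u - u)
      - testL hφ (B (trans (s • e j) f - f)))) (𝓝[≠] 0) (𝓝 0) := by
    have h0 : Tendsto (fun s : ℝ => M * C * ‖f'‖ ^ 2 * |s|) (𝓝[≠] 0) (𝓝 0) := by
      have : Continuous fun s : ℝ => M * C * ‖f'‖ ^ 2 * |s| := by fun_prop
      simpa using (this.tendsto 0).mono_left nhdsWithin_le_nhds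
    refine squeeze_zero_norm' ?_ h0
    filter_upwards [self_mem_nhdsWithin] with s hs
    have hs : 0 < |s| := abs_pos.2 hs
    rw [norm_smul, norm_inv, Real.norm_eq_abs, inv_mul_le_iff₀ hs]
    refine (hrem s).trans (le_of_eq (by ring))
  have := hzero.add hmain
  rw [zero_add] at this
  refine this.congr fun s => ?_
  rw [← smul_add, sub_add_cancel]

/-- Multiplication `L^∞ × L² → L²`. -/
def mulL : Linf ℝ →L[ℝ] L2 ℝ →L[ℝ] L2 ℝ := (ContinuousLinearMap.mul ℝ ℝ).holderL volume ⊤ 2 2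

theorem mulL_ae (a : Linf ℝ) (w : L2 ℝ) : mulL a w =ᵐ[volume] fun x => a x * w x :=
  ContinuousLinearMap.coeFn_holder _ a w

theorem isWeakDeriv_test_mul {j : Fin 3} {χ : X → ℝ} (hχ : IsTest χ) {u u' : L2 ℝ}
    (h : IsWeakDeriv (Pi.single j 1) u u') :
    IsWeakDeriv (Pi.single j 1) (fun x => χ x * u x)
      (fun x => partialD j χ x * u x + χ x * u' x) := by
  intro φ hφ
  have hprod : IsTest fun x => φ x * χ x := ⟨hφ.1.mul hχ.1, hφ.2.mul_right⟩
  have hd (x : X) : partialD j (fun x => φ x * χ x) x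
      = partialD j φ x * χ x + φ x * partialD j χ x := by
    have h1 := ((hφ.1.differentiable (by simp) x).hasFDerivAt).mul
      ((hχ.1.differentiable (by simp) x).hasFDerivAt)
    change fderiv ℝ (fun x => φ x * χ x) x (e j) = _
    rw [show (fun x => φ x * χ x) = φ * χ from rfl, h1.fderiv]
    simp only [partialD, add_apply, smul_apply, smul_eq_mul]
    ring
  have h1 := h _ hprod
  have hφ' := hφ.partialD j
  have hχ' := hχ.partialD j
  have i1 : Integrable fun x => (partialD j φ x * χ x) • u x :=
    IsTest.integrable_smul ⟨hφ'.1.mul hχ.1, hφ'.2.mul_right⟩ u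
  have i2 : Integrable fun x => (φ x * partialD j χ x) • u x :=
    IsTest.integrable_smul ⟨hφ.1.mul hχ'.1, hφ.2.mul_right⟩ u
  have i3 : Integrable fun x => (φ x * χ x) • u' x := hprod.integrable_smul u'
  rw [multiD_single] at h1 ⊢
  simp only [hd, add_smul, sum_single_one, pow_one, neg_smul, one_smul] at h1 ⊢
  rw [integral_add i1 i2] at h1
  simp only [smul_eq_mul, mul_add] at *
  simp only [← mul_assoc] at *
  rw [integral_add i2 i3]
  linarith

/-- The product is in general only L¹, hence the formulation for plain functions. Absorbing the test
function into the factor u keeps that factor in L², and the pairing can be integrated by parts. -/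
theorem isWeakDeriv_mul {j : Fin 3} {u u' w w' : L2 ℝ} (h : IsWeakDeriv (Pi.single j 1) u u')
    (h' : IsWeakDeriv (Pi.single j 1) w w') :
    IsWeakDeriv (Pi.single j 1) (fun x => u x * w x) (fun x => u' x * w x + u x * w' x) := by
  intro φ hφ
  have mul_mem {χ : X → ℝ} (hχ : IsTest χ) (a : L2 ℝ) : MemLp (fun x => χ x * a x) 2 := by
    obtain ⟨M, hM⟩ := hχ.1.continuous.bounded_above_of_compact_support hχ.2
    refine (Lp.memLp a).of_le_mul (c := M)
      (hχ.1.continuous.aestronglyMeasurable.mul (Lp.aestronglyMeasurable a))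
      (Eventually.of_forall fun x => ?_)
    rw [norm_mul]
    exact mul_le_mul_of_nonneg_right (hM x) (norm_nonneg _)
  have h1 := isWeakDeriv_test_mul hφ h
  have hφ' := hφ.partialD j
  have m1 := mul_mem hφ u
  have m2 := (mul_mem hφ' u).add (mul_mem hφ u')
  have h2 : IsWeakDeriv (Pi.single j 1) (m1.toLp : L2 ℝ) (m2.toLp : L2 ℝ) :=
    h1.congr m1.coeFn_toLp.symm m2.coeFn_toLp.symm
  have h3 := pairL_ibp h2 h'
  have e1 : pairL (m2.toLp : L2 ℝ) w
      = ∫ x, (partialD j φ x * u x * w x + φ x * u' x * w x) := by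
    rw [pairL_apply]
    refine integral_congr_ae ?_
    filter_upwards [m2.coeFn_toLp] with x hx
    rw [hx]; simp [add_mul]
  have e2 : pairL (m1.toLp : L2 ℝ) w' = ∫ x, φ x * u x * w' x := by
    rw [pairL_apply]
    refine integral_congr_ae ?_
    filter_upwards [m1.coeFn_toLp] with x hx
    rw [hx]; simp
  have int_mul {a : X → ℝ} (ha : MemLp a 2) (b : L2 ℝ) : Integrable fun x => a x * b x :=
    ha.integrable_mul (Lp.memLp b)
  rw [e1, e2, integral_add (int_mul (mul_mem hφ' u) w) (int_mul (mul_mem hφ u') w)] at h3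
  rw [multiD_single]
  simp only [sum_single_one, pow_one, smul_eq_mul, mul_add, ← mul_assoc]
  rw [integral_add (int_mul (mul_mem hφ u') w) (int_mul (mul_mem hφ u) w')]
  linarith

/-! ### Maps into Sobolev spaces given by their derivatives -/

section

variable {E : Type} [NormedAddCommGroup E] [NormedSpace ℝ E]

/-- A `C¹` map `P : E → L²` which has `k` weak derivatives that are `C¹` maps `E → L²`. -/
def SobMap : ℕ → (E → L2 ℝ) → Prop
  | 0, P => ContDiff ℝ 1 P
  | k + 1, P => ContDiff ℝ 1 P ∧ ∀ j : Fin 3, ∃ P' : E → L2 ℝ, SobMap k P' ∧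
      ∀ F, IsWeakDeriv (Pi.single j 1) (P F) (P' F)

theorem IsWeakDeriv.zero_L2 (γ : Fin 3 → ℕ) : IsWeakDeriv γ (0 : L2 ℝ) (0 : L2 ℝ) :=
  IsWeakDeriv.zero γ

theorem SobMap.add {k : ℕ} {P Q : E → L2 ℝ} (h : SobMap k P) (h' : SobMap k Q) :
    SobMap k fun F => P F + Q F := by
  induction k generalizing P Q with
  | zero => exact ContDiff.add (f := P) h h'
  | succ k ih =>
    refine ⟨h.1.add h'.1, fun j => ?_⟩
    obtain ⟨P', h1, h2⟩ := h.2 j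
    obtain ⟨Q', h3, h4⟩ := h'.2 j
    exact ⟨_, ih h1 h3, fun F => (h2 F).add (h4 F)⟩

theorem SobMap.zero (k : ℕ) : SobMap k fun _ : E => (0 : L2 ℝ) := by
  induction k with
  | zero => exact contDiff_const
  | succ k ih => exact ⟨contDiff_const, fun j => ⟨_, ih, fun _ => IsWeakDeriv.zero_L2 _⟩⟩

theorem SobMap.sum {k : ℕ} {ι : Type*} (s : Finset ι) {P : ι → E → L2 ℝ}
    (h : ∀ i ∈ s, SobMap k (P i)) : SobMap k fun F => ∑ i ∈ s, P i F := by
  classical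
  induction s using Finset.induction_on with
  | empty => simpa using SobMap.zero k
  | insert i s hi ih =>
    simp only [Finset.sum_insert hi]
    exact (h i (Finset.mem_insert_self _ _)).add
      (ih fun l hl => h l (Finset.mem_insert_of_mem hl))

/-- For each nonzero γ one decomposition γ = δ + e_j is fixed, and the derivative is read off along
the branch j; different branches need not be compared. -/
theorem SobMap.exists_family {k : ℕ} {P : E → L2 ℝ} (h : SobMap k P) :
    ∃ Q : (Fin 3 → ℕ) → E → L2 ℝ, Q 0 = P ∧ ∀ γ ∈ multiIdx k, ContDiff ℝ 1 (Q γ) ∧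
      ∀ F, IsWeakDeriv γ (P F) (Q γ F) := by
  classical
  induction k generalizing P with
  | zero =>
    refine ⟨fun _ => P, rfl, fun γ hγ => ⟨h, fun F => ?_⟩⟩
    have : γ = 0 := by
      ext i
      have := mem_multiIdx.1 hγ
      simp at this
      simp [this i]
    subst this
    exact isWeakDeriv_zero_self _
  | succ k ih =>
    choose P' hP' hd using h.2
    choose Q hQ0 hQ using fun j => ih (hP' j)
    choose! j δ hδ hγ using fun γ (h : γ ∈ multiIdx (k + 1)) => exists_eq_add_single (γ := γ) h
    refine ⟨fun γ => if γ = 0 then P else Q (j γ) (δ γ), by simp, fun γ hmem => ?_⟩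
    by_cases h0 : γ = 0
    · subst h0
      simp only [if_true]
      exact ⟨h.1, fun F => isWeakDeriv_zero_self _⟩
    · simp only [if_neg h0]
      obtain ⟨h1, h2⟩ := hQ (j γ) (δ γ) (hδ γ hmem h0)
      refine ⟨h1, fun F => ?_⟩
      have := (hd (j γ) F).trans_single (h2 F)
      rwa [← hγ γ hmem h0] at this

theorem SobMap.exists_contDiff {k : ℕ} {P : E → L2 ℝ} (h : SobMap k P) :
    ∃ Φ : E → Sob k ℝ, ContDiff ℝ 1 Φ ∧ ∀ F, (Φ F).val = P F := by
  obtain ⟨Q, hQ0, hQ⟩ := h.exists_family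
  let R : E → PiLp 2 fun _ : multiIdx k => L2 ℝ := fun F => WithLp.toLp 2 fun γ => Q γ.1 F
  have hR : ContDiff ℝ 1 R :=
    (PiLp.continuousLinearEquiv 2 ℝ (fun _ : multiIdx k => L2 ℝ)).symm.contDiff.comp
      (contDiff_pi.2 fun γ => (hQ γ.1 γ.2).1)
  have hmem (F : E) : R F ∈ sobolev ℝ k := fun γ => by
    have := (hQ γ.1 γ.2).2 F
    rw [← hQ0] at this
    exact this
  have : CompleteSpace (sobolev ℝ k) := inferInstanceAs (CompleteSpace (Sob k ℝ))
  -- R already takes values in the closed subspace. The projection acts as the identity there and,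
  -- being continuous and linear, transfers the C¹ property to the subtype.
  refine ⟨fun F => (sobolev ℝ k).orthogonalProjectionOnto (R F),
    (ContinuousLinearMap.contDiff _).comp hR, fun F => ?_⟩
  have : (sobolev ℝ k).orthogonalProjectionOnto (R F) = ⟨R F, hmem F⟩ :=
    Submodule.orthogonalProjectionOnto_mem_subspace_eq_self (⟨R F, hmem F⟩ : sobolev ℝ k)
  change Sob.val ((sobolev ℝ k).orthogonalProjectionOnto (R F)) = _
  rw [this, Sob.val_eq, Sob.D_of_mem _ (zero_mem_multiIdx k), ← hQ0]

end

/-! ### The superposition operator on `H³` -/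

/-- The `n`-th matrix entry. -/
abbrev entry (n : Fin 3 × Fin 3) : Mat →L[ℝ] ℝ := EuclideanSpace.proj n

/-- The matrix with a single non-zero entry. -/
abbrev unitMat (n : Fin 3 × Fin 3) : Mat := EuclideanSpace.single n 1

/-- The embedding `H² ⊆ L^∞`. -/
def linfEmb (V : Type) [NormedAddCommGroup V] [InnerProductSpace ℝ V] [CompleteSpace V] :
    Sob 2 V →L[ℝ] Linf V := (exists_sobolev_embedding (V := V)).choose

theorem linfEmb_ae {V : Type} [NormedAddCommGroup V] [InnerProductSpace ℝ V] [CompleteSpace V]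
    (u : Sob 2 V) : linfEmb V u =ᵐ[volume] u.val := (exists_sobolev_embedding (V := V)).choose_spec u

/-- `F ∈ H³` as an element of `L^∞`. -/
def linfMat : Sob 3 Mat →L[ℝ] Linf Mat := (linfEmb Mat).comp (Sob.inclL (by norm_num))

theorem linfMat_ae (F : Sob 3 Mat) : linfMat F =ᵐ[volume] F.val := by
  have := linfEmb_ae (Sob.inclL (by norm_num : 2 ≤ 3) F)
  rw [Sob.inclL_apply, Sob.val_incl] at this
  rwa [linfMat, ContinuousLinearMap.comp_apply, Sob.inclL_apply]

/-- The derivative `∂^γ F_n ∈ L²` of an entry. -/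
def entryD (γ : Fin 3 → ℕ) (n : Fin 3 × Fin 3) : Sob 3 Mat →L[ℝ] L2 ℝ :=
  (Sob.DL γ).comp (Sob.mapL (entry n))

theorem entryD_ae {γ : Fin 3 → ℕ} (hγ : γ ∈ multiIdx 3) (n : Fin 3 × Fin 3) (F : Sob 3 Mat) :
    entryD γ n F =ᵐ[volume] fun x => F.D γ x n := by
  have := compLpL_ae (entry n) (F.D γ)
  rw [entryD, ContinuousLinearMap.comp_apply, Sob.DL_apply, Sob.D_mapL _ _ hγ]
  exact this

theorem entryD_isWeakDeriv {γ : Fin 3 → ℕ} (hγ : γ ∈ multiIdx 2) (n : Fin 3 × Fin 3) (j : Fin 3)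
    (F : Sob 3 Mat) :
    IsWeakDeriv (Pi.single j 1) (entryD γ n F) (entryD (γ + Pi.single j 1) n F) := by
  simpa [entryD] using (Sob.mapL (entry n) F).isWeakDeriv_D hγ j

/-- The derivative `∂_j F_n ∈ L^∞` of an entry. -/
def entryPd (j : Fin 3) (n : Fin 3 × Fin 3) : Sob 3 Mat →L[ℝ] Linf ℝ :=
  (linfEmb ℝ).comp ((Sob.pdS j).comp (Sob.mapL (entry n)))

theorem entryPd_ae (j : Fin 3) (n : Fin 3 × Fin 3) (F : Sob 3 Mat) :
    entryPd j n F =ᵐ[volume] entryD (Pi.single j 1) n F := by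
  have := linfEmb_ae (Sob.pdS j (Sob.mapL (entry n) F))
  rw [Sob.val_pdS] at this
  simpa [entryD, entryPd, Sob.pd_eq] using this

theorem contDiff_mulL {E : Type} [NormedAddCommGroup E] [NormedSpace ℝ E] {a : E → Linf ℝ}
    {w : E → L2 ℝ} (ha : ContDiff ℝ 1 a) (hw : ContDiff ℝ 1 w) :
    ContDiff ℝ 1 fun F => mulL (a F) (w F) :=
  (mulL.contDiff.comp ha).clm_apply hw

/-- Maps `w : H³ → L²` whose products with superpositions `g(F)` have `k` derivatives. -/
def Multiplicable : ℕ → (Sob 3 Mat → L2 ℝ) → Prop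
  | 0, w => ContDiff ℝ 1 w
  | k + 1, w => ContDiff ℝ 1 w ∧
      (∀ j : Fin 3, ∃ w' : Sob 3 Mat → L2 ℝ, Multiplicable k w' ∧
        ∀ F, IsWeakDeriv (Pi.single j 1) (w F) (w' F)) ∧
      ∀ (j : Fin 3) (n : Fin 3 × Fin 3), Multiplicable k fun F => mulL (entryPd j n F) (w F)

theorem fderiv_mat_apply (g : Mat → ℝ) (A B : Mat) :
    fderiv ℝ g A B = ∑ n, fderiv ℝ g A (unitMat n) * B n := by
  have hB : B = ∑ n, B n • unitMat n := by
    ext m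
    simp [Finset.sum_apply, Pi.single_apply]
  conv_lhs => rw [hB]
  simp [map_sum, mul_comm]

theorem exists_superpos_L2 {g : Mat → ℝ} (hg : ContDiff ℝ ∞ g) :
    ∃ Ψ : Sob 3 Mat → L2 ℝ, ContDiff ℝ 1 Ψ ∧ ∀ F, Ψ F =ᵐ[volume] fun x => g (F.val x) - g 0 := by
  obtain ⟨Ψ, h1, h2⟩ := exists_contDiff_superpos (p := 2) (hg.of_le (by norm_cast)) linfMat
    (Sob.DL 0) fun F => by simpa [Sob.val_eq] using linfMat_ae F
  refine ⟨Ψ, h1, fun F => ?_⟩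
  filter_upwards [h2 F, linfMat_ae F] with x h3 h4
  rw [h3, h4]

/-- Constants belong to L^∞, so g(0) can be put back here. -/
theorem exists_superpos_Linf {g : Mat → ℝ} (hg : ContDiff ℝ ∞ g) :
    ∃ a : Sob 3 Mat → Linf ℝ, ContDiff ℝ 1 a ∧ ∀ F, a F =ᵐ[volume] fun x => g (F.val x) := by
  obtain ⟨Ψ, h1, h2⟩ := exists_contDiff_superpos (p := ⊤) (hg.of_le (by norm_cast)) linfMat
    linfMat fun F => ae_eq_rfl
  have hc : MemLp (fun _ : X => g 0) ⊤ := memLp_top_const _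
  refine ⟨fun F => Ψ F + hc.toLp, h1.add contDiff_const, fun F => ?_⟩
  filter_upwards [h2 F, linfMat_ae F, Lp.coeFn_add (Ψ F) hc.toLp, hc.coeFn_toLp] with x h3 h4 h5 h6
  rw [h5, Pi.add_apply, h3, h4, h6, sub_add_cancel]

theorem contDiff_fderiv_unitMat {g : Mat → ℝ} (hg : ContDiff ℝ ∞ g) (n : Fin 3 × Fin 3) :
    ContDiff ℝ ∞ fun A => fderiv ℝ g A (unitMat n) :=
  (hg.fderiv_right (m := ∞) (by simp)).clm_apply contDiff_const

theorem superpos_hasWeakDeriv {g : Mat → ℝ} (hg : ContDiff ℝ ∞ g) {F : Sob 3 Mat} {u : L2 ℝ}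
    (hu : u =ᵐ[volume] fun x => g (F.val x) - g 0) (j : Fin 3) {a : Fin 3 × Fin 3 → Linf ℝ}
    (ha : ∀ n, a n =ᵐ[volume] fun x => fderiv ℝ g (F.val x) (unitMat n)) :
    IsWeakDeriv (Pi.single j 1) u
      (∑ n, mulL (a n) (entryD (Pi.single j 1) n F) : L2 ℝ) := by
  have hmem : Pi.single j 1 ∈ multiIdx 3 := single_mem_multiIdx j
  refine isWeakDeriv_superpos (hg.of_le (by norm_cast)) (F.isWeakDeriv hmem) (linfMat F)
    (linfMat_ae F) hu ?_
  have h1 : ∀ᵐ x, ∀ n, mulL (a n) (entryD (Pi.single j 1) n F) x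
      = fderiv ℝ g (F.val x) (unitMat n) * F.D (Pi.single j 1) x n := by
    refine ae_all_iff.2 fun n => ?_
    filter_upwards [mulL_ae (a n) (entryD (Pi.single j 1) n F), ha n, entryD_ae hmem n F]
      with x h1 h2 h3
    rw [h1, h2, h3]
  filter_upwards [h1, Lp.coeFn_finsetSum Finset.univ fun n => mulL (a n) (entryD (Pi.single j 1) n F)]
    with x h1 h2
  rw [h2, fderiv_mat_apply, Finset.sum_apply]
  exact Finset.sum_congr rfl fun n _ => h1 n

/-- By the product rule, ∂_j(g(F) w) is the sum of ∂_n g(F) · (∂_j F_n w) over n plus g(F) ∂_j w.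
Each term is again a smooth function of F times a map of the class of order one less;
`Multiplicable` asks for exactly the closure that this induction needs. -/
theorem Multiplicable.sobMap {k : ℕ} {w : Sob 3 Mat → L2 ℝ} (hw : Multiplicable k w)
    {g : Mat → ℝ} (hg : ContDiff ℝ ∞ g) {a : Sob 3 Mat → Linf ℝ} (ha : ContDiff ℝ 1 a)
    (hag : ∀ F, a F =ᵐ[volume] fun x => g (F.val x)) : SobMap k fun F => mulL (a F) (w F) := by
  induction k generalizing w g a with
  | zero => exact contDiff_mulL ha hw
  | succ k ih =>
    refine ⟨contDiff_mulL ha hw.1, fun j => ?_⟩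
    obtain ⟨w', h1, h2⟩ := hw.2.1 j
    choose b hb1 hb2 using fun n => exists_superpos_Linf (contDiff_fderiv_unitMat hg n)
    obtain ⟨Ψ, hΨ1, hΨ2⟩ := exists_superpos_L2 hg
    refine ⟨fun F => (∑ n, mulL (b n F) (mulL (entryPd j n F) (w F))) + mulL (a F) (w' F),
      (SobMap.sum _ fun n _ => ih (hw.2.2 j n) (contDiff_fderiv_unitMat hg n) (hb1 n) (hb2 n)).add
        (ih h1 hg ha hag), fun F => ?_⟩
    -- The product rule needs both factors in L², so it is applied to g(F) − g(0); the missing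
    -- multiple g(0) w is added back in `h5`.
    have h3 := isWeakDeriv_mul (superpos_hasWeakDeriv hg (hΨ2 F) j fun n => hb2 n F) (h2 F)
    have h4 : IsWeakDeriv (Pi.single j 1) (mulL (a F) (w F) + (-g 0) • w F : L2 ℝ)
        ((∑ n, mulL (b n F) (mulL (entryPd j n F) (w F))) + mulL (a F) (w' F)
          + (-g 0) • w' F : L2 ℝ) := by
      refine h3.congr ?_ ?_
      · filter_upwards [Lp.coeFn_add (mulL (a F) (w F)) ((-g 0) • w F), mulL_ae (a F) (w F),
          Lp.coeFn_smul (-g 0) (w F), hag F, hΨ2 F] with x e1 e2 e3 e4 e5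
        rw [e1, Pi.add_apply, e2, e3, Pi.smul_apply, e4, e5, smul_eq_mul]
        ring
      · have e0 : ∀ᵐ x, ∀ n, mulL (b n F) (entryD (Pi.single j 1) n F) x * w F x
            = mulL (b n F) (mulL (entryPd j n F) (w F)) x := by
          refine ae_all_iff.2 fun n => ?_
          filter_upwards [mulL_ae (b n F) (entryD (Pi.single j 1) n F),
            mulL_ae (b n F) (mulL (entryPd j n F) (w F)), mulL_ae (entryPd j n F) (w F),
            entryPd_ae j n F] with x e1 e2 e3 e4
          rw [e1, e2, e3, e4, mul_assoc]
        filter_upwards [e0, Lp.coeFn_add ((∑ n, mulL (b n F) (mulL (entryPd j n F) (w F)))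
            + mulL (a F) (w' F)) ((-g 0) • w' F),
          Lp.coeFn_add (∑ n, mulL (b n F) (mulL (entryPd j n F) (w F))) (mulL (a F) (w' F)),
          Lp.coeFn_finsetSum Finset.univ fun n => mulL (b n F) (mulL (entryPd j n F) (w F)),
          Lp.coeFn_finsetSum Finset.univ fun n => mulL (b n F) (entryD (Pi.single j 1) n F),
          mulL_ae (a F) (w' F), Lp.coeFn_smul (-g 0) (w' F), hag F, hΨ2 F]
          with x e0 e1 e2 e3 e4 e5 e6 e7 e8
        rw [e1, Pi.add_apply, e2, Pi.add_apply, e3, e4, e5, e6, Pi.smul_apply, e7, e8,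
          Finset.sum_apply, Finset.sum_apply, Finset.sum_mul, Finset.sum_congr rfl fun n _ => e0 n,
          smul_eq_mul]
        ring
    have h5 := h4.add ((h2 F).smul (g 0))
    rwa [add_assoc, ← add_smul, neg_add_cancel, zero_smul, add_zero, add_assoc, ← add_smul,
      neg_add_cancel, zero_smul, add_zero] at h5

theorem Multiplicable.of_contDiff {w : Sob 3 Mat → L2 ℝ} (h : ContDiff ℝ 1 w) :
    Multiplicable 0 w := h

theorem Multiplicable.succ {k : ℕ} {w : Sob 3 Mat → L2 ℝ} (h : ContDiff ℝ 1 w)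
    (w' : Fin 3 → Sob 3 Mat → L2 ℝ) (h1 : ∀ j, Multiplicable k (w' j))
    (h2 : ∀ j F, IsWeakDeriv (Pi.single j 1) (w F) (w' j F))
    (h3 : ∀ j n, Multiplicable k fun F => mulL (entryPd j n F) (w F)) : Multiplicable (k + 1) w :=
  ⟨h, fun j => ⟨w' j, h1 j, h2 j⟩, h3⟩

theorem contDiff_entryD (γ : Fin 3 → ℕ) (n : Fin 3 × Fin 3) : ContDiff ℝ 1 (entryD γ n) :=
  ContinuousLinearMap.contDiff _

theorem contDiff_entryPd (j : Fin 3) (n : Fin 3 × Fin 3) : ContDiff ℝ 1 (entryPd j n) :=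
  ContinuousLinearMap.contDiff _

/-! ### Products of derivatives of F of total order at most three -/

theorem multiplicable_entryD_second (n : Fin 3 × Fin 3) (j k : Fin 3) :
    Multiplicable 1 (entryD (Pi.single j 1 + Pi.single k 1) n) :=
  Multiplicable.succ (contDiff_entryD _ _)
    (fun l => entryD (Pi.single j 1 + Pi.single k 1 + Pi.single l 1) n)
    (fun _ => Multiplicable.of_contDiff (contDiff_entryD _ _))
    (fun l F => entryD_isWeakDeriv
      (add_single_mem_multiIdx (single_mem_multiIdx (k := 0) j) k) n l F)
    (fun l m => Multiplicable.of_contDiff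
      (contDiff_mulL (contDiff_entryPd l m) (contDiff_entryD _ _)))

/-- The product `∂_k F_m ∂^γ F_n ∈ L²`. -/
def prodD (k : Fin 3) (m : Fin 3 × Fin 3) (γ : Fin 3 → ℕ) (n : Fin 3 × Fin 3) (F : Sob 3 Mat) :
    L2 ℝ := mulL (entryPd k m F) (entryD γ n F)

theorem contDiff_prodD (k : Fin 3) (m : Fin 3 × Fin 3) (γ : Fin 3 → ℕ) (n : Fin 3 × Fin 3) :
    ContDiff ℝ 1 (prodD k m γ n) :=
  contDiff_mulL (contDiff_entryPd k m) (contDiff_entryD γ n)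

theorem prodD_ae (k : Fin 3) (m : Fin 3 × Fin 3) (γ : Fin 3 → ℕ) (n : Fin 3 × Fin 3)
    (F : Sob 3 Mat) :
    prodD k m γ n F =ᵐ[volume] fun x => entryD (Pi.single k 1) m F x * entryD γ n F x := by
  filter_upwards [mulL_ae (entryPd k m F) (entryD γ n F), entryPd_ae k m F] with x e1 e2
  rw [prodD, e1, e2]

/-- When the derivative hits the factor treated as bounded, the roles are exchanged: the
undifferentiated first derivative becomes the L^∞ factor and the second derivative the L² factor. -/
theorem prodD_isWeakDeriv (m n : Fin 3 × Fin 3) (j k l : Fin 3) (F : Sob 3 Mat) :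
    IsWeakDeriv (Pi.single l 1) (prodD k m (Pi.single j 1) n F)
      (prodD j n (Pi.single k 1 + Pi.single l 1) m F
        + prodD k m (Pi.single j 1 + Pi.single l 1) n F : L2 ℝ) := by
  have h1 : Pi.single j 1 ∈ multiIdx 2 := single_mem_multiIdx j
  have h2 : Pi.single k 1 ∈ multiIdx 2 := single_mem_multiIdx k
  have h5 := entryD_isWeakDeriv h2 m l F
  have h6 := entryD_isWeakDeriv h1 n l F
  have e1 := prodD_ae k m (Pi.single j 1) n F
  have e2 := prodD_ae j n (Pi.single k 1 + Pi.single l 1) m F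
  have e3 := prodD_ae k m (Pi.single j 1 + Pi.single l 1) n F
  generalize prodD k m (Pi.single j 1) n F = p at *
  generalize prodD j n (Pi.single k 1 + Pi.single l 1) m F = q at *
  generalize prodD k m (Pi.single j 1 + Pi.single l 1) n F = r at *
  generalize entryD (Pi.single k 1 + Pi.single l 1) m F = a' at *
  generalize entryD (Pi.single j 1 + Pi.single l 1) n F = b' at *
  generalize entryD (Pi.single k 1) m F = a at *
  generalize entryD (Pi.single j 1) n F = b at *
  refine (isWeakDeriv_mul h5 h6).congr ?_ ?_
  · filter_upwards [e1] with x e1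
    rw [e1]
  · filter_upwards [e2, e3, Lp.coeFn_add q r] with x e2 e3 e5
    rw [e5, Pi.add_apply, e2, e3]
    ring

theorem multiplicable_entryPd_mul_entryD (m n : Fin 3 × Fin 3) (j k : Fin 3) :
    Multiplicable 1 (prodD k m (Pi.single j 1) n) := by
  have h1 (l : Fin 3) : ContDiff ℝ 1 fun F => prodD j n (Pi.single k 1 + Pi.single l 1) m F
      + prodD k m (Pi.single j 1 + Pi.single l 1) n F :=
    ContDiff.add (f := prodD j n (Pi.single k 1 + Pi.single l 1) m)
      (contDiff_prodD _ _ _ _) (contDiff_prodD _ _ _ _)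
  have h2 (l : Fin 3) (q : Fin 3 × Fin 3) :
      ContDiff ℝ 1 fun F => mulL (entryPd l q F) (prodD k m (Pi.single j 1) n F) :=
    contDiff_mulL (contDiff_entryPd l q) (contDiff_prodD k m (Pi.single j 1) n)
  refine Multiplicable.succ (contDiff_prodD k m (Pi.single j 1) n) _
    (fun l => Multiplicable.of_contDiff (h1 l)) ?_ (fun l q => Multiplicable.of_contDiff (h2 l q))
  intro l F
  exact prodD_isWeakDeriv m n j k l F

theorem multiplicable_entryD (n : Fin 3 × Fin 3) (j : Fin 3) :
    Multiplicable 2 (entryD (Pi.single j 1) n) :=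
  Multiplicable.succ (contDiff_entryD _ _) (fun k => entryD (Pi.single j 1 + Pi.single k 1) n)
    (fun k => multiplicable_entryD_second n j k)
    (fun k F => entryD_isWeakDeriv (single_mem_multiIdx j) n k F)
    (fun k m => multiplicable_entryPd_mul_entryD m n j k)

/-- The chain rule supplies one derivative explicitly; the remaining two come from
`multiplicable_entryD`. All products that occur have at most one factor outside L^∞. -/
theorem exists_superpos_sob {g : Mat → ℝ} (hg : ContDiff ℝ ∞ g) :
    ∃ Φ : Sob 3 Mat → Sob 3 ℝ, ContDiff ℝ 1 Φ ∧
      ∀ F, (Φ F).val =ᵐ[volume] fun x => g (F.val x) - g 0 := by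
  obtain ⟨Ψ, hΨ1, hΨ2⟩ := exists_superpos_L2 hg
  choose b hb1 hb2 using fun n => exists_superpos_Linf (contDiff_fderiv_unitMat hg n)
  have : SobMap 3 Ψ := ⟨hΨ1, fun j => ⟨fun F => ∑ n, mulL (b n F) (entryD (Pi.single j 1) n F),
    SobMap.sum _ fun n _ => (multiplicable_entryD n j).sobMap (contDiff_fderiv_unitMat hg n)
      (hb1 n) (hb2 n), fun F => superpos_hasWeakDeriv hg (hΨ2 F) j fun n => hb2 n F⟩⟩
  obtain ⟨Φ, h1, h2⟩ := this.exists_contDiff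
  exact ⟨Φ, h1, fun F => by rw [h2]; exact hΨ2 F⟩

/-- The superposition operator `F ↦ T(F)` is `C¹` on `H³`. -/
theorem exists_superpos_mat {T : Mat → Mat} (hT : ContDiff ℝ ∞ T) (hT0 : T 0 = 0) :
    ∃ Φ : Sob 3 Mat → Sob 3 Mat, ContDiff ℝ 1 Φ ∧
      ∀ F, (Φ F).val =ᵐ[volume] fun x => T (F.val x) := by
  choose Φ h1 h2 using fun n : Fin 3 × Fin 3 =>
    exists_superpos_sob (g := fun A => T A n) ((entry n).contDiff.comp hT)
  let inj (n : Fin 3 × Fin 3) : ℝ →L[ℝ] Mat :=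
    (ContinuousLinearMap.id ℝ ℝ).smulRight (unitMat n)
  refine ⟨fun F => ∑ n, Sob.mapL (inj n) (Φ n F),
    ContDiff.sum fun n _ => (ContinuousLinearMap.contDiff _).comp (h1 n), fun F => ?_⟩
  have hv : (∑ n, Sob.mapL (inj n) (Φ n F)).val = ∑ n, (inj n).compLpL 2 volume (Φ n F).val := by
    simp only [Sob.val_eq, ← Sob.DL_apply, map_sum]
    simp only [Sob.DL_apply, Sob.D_mapL _ _ (zero_mem_multiIdx 3)]
  rw [hv]
  have h3 : ∀ᵐ x, ∀ n, (inj n).compLpL 2 volume (Φ n F).val x = T (F.val x) n • unitMat n := by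
    refine ae_all_iff.2 fun n => ?_
    filter_upwards [compLpL_ae (inj n) (Φ n F).val, h2 n F] with x e1 e2
    rw [e1, e2, hT0]
    simp [inj]
  filter_upwards [h3, Lp.coeFn_finsetSum Finset.univ fun n => (inj n).compLpL 2 volume (Φ n F).val]
    with x e1 e2
  rw [e2, Finset.sum_apply, Finset.sum_congr rfl fun n _ => e1 n]
  ext m
  simp [Pi.single_apply]

/-! ### Groups generated by limits of commuting bounded operators -/

section

open NormedSpace

variable {E G : Type*} [NormedAddCommGroup E] [NormedSpace ℝ E] [CompleteSpace E]
  [NormedAddCommGroup G] [NormedSpace ℝ G] [CompleteSpace G]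

theorem exp_add_of_commute_clm {A B : E →L[ℝ] E} (h : Commute A B) :
    exp (A + B) = exp A * exp B := by
  let : NormedAlgebra ℚ (E →L[ℝ] E) := NormedAlgebra.restrictScalars ℚ ℝ (E →L[ℝ] E)
  exact exp_add_of_commute h

theorem hasDerivAt_exp_smul_apply (A : E →L[ℝ] E) (u : E) (t : ℝ) :
    HasDerivAt (fun s : ℝ => exp (s • A) u) (exp (t • A) (A u)) t :=
  (hasDerivAt_exp_smul_const (𝕂 := ℝ) A t).clm_apply (hasDerivAt_const t u) |>.congr_deriv (by simp)

theorem exp_smul_comm_apply {E : Type*} [NormedAddCommGroup E] [NormedSpace ℝ E] (A : E →L[ℝ] E) (s : ℝ) (u : E) :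
    exp (s • A) (A u) = A (exp (s • A) u) := by
  have : Commute A (exp (s • A)) := ((Commute.refl A).smul_right s).exp_right
  exact (DFunLike.congr_fun this.eq u).symm

/-- Duhamel: differentiate exp(−sA) exp(sB) u in s. The bound M is used once for exp(−sA) in the
derivative and once for the outer exp(tA). -/
theorem norm_exp_smul_sub_le {A B : E →L[ℝ] E} {M δ : ℝ} (hA : ∀ t : ℝ, ‖exp (t • A)‖ ≤ M)
    {u : E} (hδ : ∀ s : ℝ, ‖(A - B) (exp (s • B) u)‖ ≤ δ) (t : ℝ) :
    ‖exp (t • B) u - exp (t • A) u‖ ≤ M * (M * δ * |t|) := by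
  have hM : 0 ≤ M := (norm_nonneg _).trans (hA 0)
  have hd (s : ℝ) : HasDerivAt (fun s : ℝ => exp (s • -A) (exp (s • B) u))
      (exp (s • -A) (-((A - B) (exp (s • B) u)))) s := by
    refine ((hasDerivAt_exp_smul_const (𝕂 := ℝ) (-A) s).clm_apply
      (hasDerivAt_exp_smul_apply B u s)).congr_deriv ?_
    rw [mul_apply_eq_comp, exp_smul_comm_apply B, ← map_add]
    simp
    abel_nf
  have hb (s : ℝ) (w : E) : ‖exp (s • -A) w‖ ≤ M * ‖w‖ := by
    refine (ContinuousLinearMap.le_opNorm _ _).trans (mul_le_mul_of_nonneg_right ?_ (norm_nonneg _))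
    rw [smul_neg, ← neg_smul]
    exact hA _
  have h1 : ‖exp (t • -A) (exp (t • B) u) - u‖ ≤ M * δ * |t| := by
    have := Convex.norm_image_sub_le_of_norm_hasDerivWithin_le (s := univ) (x := (0 : ℝ)) (y := t)
      (C := M * δ) (fun s _ => (hd s).hasDerivWithinAt)
      (fun s _ => (hb s _).trans (by rw [norm_neg]; exact mul_le_mul_of_nonneg_left (hδ s) hM))
      convex_univ (mem_univ _) (mem_univ _)
    simpa using this
  have h2 : exp (t • A) (exp (t • -A) (exp (t • B) u)) = exp (t • B) u := by
    rw [← mul_apply_eq_comp, ← exp_add_of_commute_clm, ← smul_add, add_neg_cancel]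
    · simp
    · exact (((Commute.refl A).neg_right).smul_left t).smul_right t
  rw [← h2, ← map_sub]
  refine (ContinuousLinearMap.le_opNorm _ _).trans ?_
  exact mul_le_mul (hA t) h1 (norm_nonneg _) hM

/-- Uniformly stable bounded operators, consistent on a dense set, generate a group. -/
theorem exists_group (A : ℕ → E →L[ℝ] E) {M : ℝ}
    (hM : ∀ n (t : ℝ), ‖exp (t • A n)‖ ≤ M) (hA : Dense {u | ∀ δ > 0, ∃ N, ∀ m ≥ N, ∀ n ≥ N, ∀ s : ℝ,
      ‖(A m - A n) (exp (s • A n) u)‖ ≤ δ}) :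
    ∃ U : ℝ → E →L[ℝ] E, U 0 = 1 ∧ (∀ s t u, U (s + t) u = U s (U t u)) ∧ (∀ t, ‖U t‖ ≤ M) ∧
      (∀ u, Continuous fun t => U t u) ∧
      ∀ t u, Tendsto (fun n => exp (t • A n) u) atTop (𝓝 (U t u)) := by
  have hM0 : 0 ≤ M := (norm_nonneg _).trans (hM 0 0)
  have hexp (n : ℕ) (t : ℝ) (u : E) : ‖exp (t • A n) u‖ ≤ M * ‖u‖ :=
    (ContinuousLinearMap.le_opNorm _ _).trans (mul_le_mul_of_nonneg_right (hM n t) (norm_nonneg _))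
  -- The exponentials are Cauchy uniformly on bounded time intervals. Replacing u by a nearby
  -- consistent vector w costs δ/4 twice, and the comparison at w another δ/4.
  have key (u : E) (R : ℝ) {δ : ℝ} (hδ : 0 < δ) : ∃ N, ∀ m ≥ N, ∀ n ≥ N, ∀ t ∈ Icc (-R) R,
      dist (exp (t • A m) u) (exp (t • A n) u) < δ := by
    obtain ⟨w, hw, huw⟩ := Metric.mem_closure_iff.1 (hA u) (δ / (4 * (M + 1))) (by positivity)
    obtain ⟨N, hN⟩ := hw (δ / (4 * (M ^ 2 + 1) * (|R| + 1))) (by positivity)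
    refine ⟨N, fun m hm n hn t ht => ?_⟩
    have htR : |t| ≤ |R| + 1 := by
      have := abs_le.2 ht
      linarith [le_abs_self R]
    have h1 (n : ℕ) : ‖exp (t • A n) u - exp (t • A n) w‖ ≤ δ / 4 := by
      rw [← map_sub]
      refine (hexp _ _ _).trans ?_
      rw [← dist_eq_norm]
      calc M * dist u w ≤ (M + 1) * (δ / (4 * (M + 1))) :=
            mul_le_mul (by linarith) huw.le dist_nonneg (by positivity)
        _ = δ / 4 := by field_simp
    have h2 : ‖exp (t • A m) w - exp (t • A n) w‖ ≤ δ / 4 := by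
      refine (norm_exp_smul_sub_le (hM n) (hN n hn m hm) t).trans ?_
      calc M * (M * (δ / (4 * (M ^ 2 + 1) * (|R| + 1))) * |t|)
          = M ^ 2 * (δ / (4 * (M ^ 2 + 1) * (|R| + 1))) * |t| := by ring
        _ ≤ (M ^ 2 + 1) * (δ / (4 * (M ^ 2 + 1) * (|R| + 1))) * (|R| + 1) := by
            gcongr
            linarith
        _ = δ / 4 := by field_simp
    calc dist (exp (t • A m) u) (exp (t • A n) u)
        ≤ dist (exp (t • A m) u) (exp (t • A m) w) + dist (exp (t • A m) w) (exp (t • A n) w)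
          + dist (exp (t • A n) w) (exp (t • A n) u) := dist_triangle4 _ _ _ _
      _ < δ := by
          rw [dist_comm (exp (t • A n) w), dist_eq_norm, dist_eq_norm, dist_eq_norm]
          linarith [h1 m, h1 n]
  have hlim (t : ℝ) (u : E) : ∃ z, Tendsto (fun n => exp (t • A n) u) atTop (𝓝 z) := by
    refine cauchySeq_tendsto_of_complete (Metric.cauchySeq_iff.2 fun δ hδ => ?_)
    obtain ⟨N, hN⟩ := key u |t| hδ
    exact ⟨N, fun m hm n hn => hN m hm n hn t (abs_le.1 le_rfl)⟩
  choose f hf using hlim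
  let U (t : ℝ) : E →L[ℝ] E :=
    continuousLinearMapOfTendsto (fun n => exp (t • A n)) (tendsto_pi_nhds.2 (hf t))
  have hU (t : ℝ) (u : E) : Tendsto (fun n => exp (t • A n) u) atTop (𝓝 (U t u)) := hf t u
  have hUM (t : ℝ) : ‖U t‖ ≤ M := ContinuousLinearMap.opNorm_le_bound _ hM0 fun u =>
    le_of_tendsto (hU t u).norm (Eventually.of_forall fun n => hexp n t u)
  refine ⟨U, ?_, fun s t u => ?_, hUM, fun u => ?_, hU⟩
  · ext u
    refine tendsto_nhds_unique (hU 0 u) ?_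
    simp
  · refine tendsto_nhds_unique (hU (s + t) u) ?_
    have h1 : Tendsto (fun n => exp (s • A n) (exp (t • A n) u - U t u)) atTop (𝓝 0) := by
      refine squeeze_zero_norm (fun n => hexp n s _) ?_
      simpa using ((hU t u).sub_const (U t u)).norm.const_mul M
    have h2 := h1.add (hU s (U t u))
    rw [zero_add] at h2
    refine h2.congr fun n => ?_
    rw [map_sub, sub_add_cancel, ← mul_apply_eq_comp, ← exp_add_of_commute_clm, add_smul]
    exact ((Commute.refl (A n)).smul_left s).smul_right t
  · rw [continuous_iff_continuousAt]
    intro t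
    have hmem : Icc (-(|t| + 1)) (|t| + 1) ∈ 𝓝 t := by
      refine Icc_mem_nhds ?_ ?_
      · linarith [neg_abs_le t]
      · linarith [le_abs_self t]
    have hcont : ContinuousOn (fun t => U t u) (Icc (-(|t| + 1)) (|t| + 1)) := by
      refine TendstoUniformlyOn.continuousOn (F := fun n (t : ℝ) => exp (t • A n) u) (p := atTop) ?_
        (Eventually.of_forall fun n => ?_).frequently
      · refine Metric.tendstoUniformlyOn_iff.2 fun δ hδ => ?_
        obtain ⟨N, hN⟩ := key u (|t| + 1) (half_pos hδ)
        filter_upwards [eventually_ge_atTop N] with n hn s hs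
        have : dist (U s u) (exp (s • A n) u) ≤ δ / 2 :=
          le_of_tendsto ((hU s u).dist tendsto_const_nhds)
            ((eventually_ge_atTop N).mono fun m hm => (hN m hm n hn s hs).le)
        linarith
      · exact fun s _ => (hasDerivAt_exp_smul_apply (A n) u s).continuousAt.continuousWithinAt
    exact hcont.continuousAt hmem

theorem exp_smul_comm_of_comm {E : Type*} [NormedAddCommGroup E] [NormedSpace ℝ E]
    {A B : E →L[ℝ] E} (h : ∀ u, B (A u) = A (B u)) (t : ℝ) (u : E) :
    B (exp (t • A) u) = exp (t • A) (B u) := by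
  have h1 : Commute B A := ContinuousLinearMap.ext h
  exact DFunLike.congr_fun ((h1.smul_right t).exp_right).eq u

/-- The difference operators commute with the generators and so pass through exp(sA_n). The
difference of two generators along the orbit is thus controlled by D_{m,j}u − D_{n,j}u, uniformly in
s. -/
theorem consistent_of_tendsto {ι : Type*} [Fintype ι] {A : ℕ → E →L[ℝ] E} {N : ι → E →L[ℝ] E}
    {D : ℕ → ι → E →L[ℝ] E} (hA : ∀ n u, A n u = ∑ j, N j (D n j u))
    (hc : ∀ m n j u, D m j (A n u) = A n (D m j u)) {M : ℝ}
    (hM : ∀ n (t : ℝ), ‖exp (t • A n)‖ ≤ M) {u : E} {z : ι → E}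
    (hu : ∀ j, Tendsto (fun n => D n j u) atTop (𝓝 (z j))) {δ : ℝ} (hδ : 0 < δ) :
    ∃ n₀, ∀ m ≥ n₀, ∀ n ≥ n₀, ∀ s : ℝ, ‖(A m - A n) (exp (s • A n) u)‖ ≤ δ := by
  have hM0 : 0 ≤ M := (norm_nonneg _).trans (hM 0 0)
  set K : ℝ := ∑ j, ‖N j‖ * M
  have hK : 0 ≤ K := Finset.sum_nonneg fun j _ => by positivity
  have hC : CauchySeq fun (n : ℕ) (j : ι) => D n j u := (tendsto_pi_nhds.2 hu).cauchySeq
  obtain ⟨n₀, hN⟩ := Metric.cauchySeq_iff.1 hC (δ / (K + 1)) (by positivity)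
  refine ⟨n₀, fun m hm n hn s => ?_⟩
  have h1 (j : ι) : ‖D m j u - D n j u‖ ≤ δ / (K + 1) := by
    rw [← dist_eq_norm]
    exact (dist_le_pi_dist (fun j => D m j u) (fun j => D n j u) j).trans (hN m hm n hn).le
  rw [sub_apply, hA, hA, ← Finset.sum_sub_distrib]
  have h2 (j : ι) : ‖N j (D m j (exp (s • A n) u)) - N j (D n j (exp (s • A n) u))‖
      ≤ ‖N j‖ * M * (δ / (K + 1)) := by
    rw [← map_sub, exp_smul_comm_of_comm (hc m n j), exp_smul_comm_of_comm (hc n n j), ← map_sub,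
      mul_assoc]
    refine (ContinuousLinearMap.le_opNorm _ _).trans
      (mul_le_mul_of_nonneg_left ?_ (norm_nonneg _))
    exact (ContinuousLinearMap.le_opNorm _ _).trans
      (mul_le_mul (hM _ _) (h1 j) (norm_nonneg _) hM0)
  refine (norm_sum_le _ _).trans ((Finset.sum_le_sum fun j _ => h2 j).trans ?_)
  rw [← Finset.sum_mul, ← mul_div_assoc, div_le_iff₀ (by positivity)]
  nlinarith

/-- The generators A_n are not uniformly bounded on E, but the compositions J ∘ A_n into the weaker
space G are, by Banach–Steinhaus. Dominated convergence passes to the limit in the integrated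
equation, whose integrand is continuous and can be differentiated back. -/
theorem hasDerivAt_group {A : ℕ → E →L[ℝ] E} {M : ℝ}
    (hM : ∀ n (t : ℝ), ‖exp (t • A n)‖ ≤ M) {U : ℝ → E →L[ℝ] E} 
    (hcont : ∀ u, Continuous fun t => U t u)
    (hU : ∀ t u, Tendsto (fun n => exp (t • A n) u) atTop (𝓝 (U t u)))
    (J B : E →L[ℝ] G) (hB : ∀ u, Tendsto (fun n => J (A n u)) atTop (𝓝 (B u))) (u : E) (t : ℝ) :
    HasDerivAt (fun s => J (U s u)) (B (U t u)) t := by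
  have hexp (n : ℕ) (t : ℝ) (u : E) : ‖exp (t • A n) u‖ ≤ M * ‖u‖ :=
    (ContinuousLinearMap.le_opNorm _ _).trans (mul_le_mul_of_nonneg_right (hM n t) (norm_nonneg _))
  obtain ⟨K, hK⟩ := banach_steinhaus (g := fun n => J.comp (A n)) fun w => by
    obtain ⟨C, hC⟩ := (hB w).norm.bddAbove_range
    exact ⟨C, fun n => hC ⟨n, rfl⟩⟩
  have hJA (n : ℕ) (w : E) : ‖J (A n w)‖ ≤ K * ‖w‖ :=
    (ContinuousLinearMap.le_opNorm (J.comp (A n)) w).trans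
      (mul_le_mul_of_nonneg_right (hK n) (norm_nonneg _))
  have hK0 : 0 ≤ K := (norm_nonneg _).trans (hK 0)
  have hBc : Continuous fun s => B (U s u) := B.continuous.comp (hcont u)
  have hint (t : ℝ) : J (U t u) - J u = ∫ s in (0 : ℝ)..t, B (U s u) := by
    have h1 (n : ℕ) : J (exp (t • A n) u) - J u = ∫ s in (0 : ℝ)..t, J (A n (exp (s • A n) u)) := by
      have hd (s : ℝ) : HasDerivAt (fun s : ℝ => J (exp (s • A n) u)) (J (A n (exp (s • A n) u))) s := by
        have := J.hasFDerivAt.comp_hasDerivAt s (hasDerivAt_exp_smul_apply (A n) u s)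
        rwa [exp_smul_comm_apply] at this
      rw [intervalIntegral.integral_eq_sub_of_hasDerivAt (fun s _ => hd s)]
      · simp
      · refine Continuous.intervalIntegrable ?_ _ _
        refine (J.comp (A n)).continuous.comp ?_
        exact continuous_iff_continuousAt.2 fun s => (hasDerivAt_exp_smul_apply (A n) u s).continuousAt
    have h2 : Tendsto (fun n => ∫ s in (0 : ℝ)..t, J (A n (exp (s • A n) u))) atTop
        (𝓝 (∫ s in (0 : ℝ)..t, B (U s u))) := by
      refine intervalIntegral.tendsto_integral_filter_of_dominated_convergence
        (fun _ => K * (M * ‖u‖)) (Eventually.of_forall fun n => ?_)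
        (Eventually.of_forall fun n => Eventually.of_forall fun s _ => ?_) (by simp)
        (Eventually.of_forall fun s _ => ?_)
      · refine Continuous.aestronglyMeasurable ?_
        refine (J.comp (A n)).continuous.comp ?_
        exact continuous_iff_continuousAt.2 fun s => (hasDerivAt_exp_smul_apply (A n) u s).continuousAt
      · exact (hJA n _).trans (mul_le_mul_of_nonneg_left (hexp n s u) hK0)
      · have h3 : Tendsto (fun n => J (A n (exp (s • A n) u - U s u))) atTop (𝓝 0) := by
          refine squeeze_zero_norm (fun n => hJA n _) ?_
          simpa using ((hU s u).sub_const (U s u)).norm.const_mul K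
        have h4 := h3.add (hB (U s u))
        rw [zero_add] at h4
        refine h4.congr fun n => ?_
        rw [map_sub, map_sub, sub_add_cancel]
    refine tendsto_nhds_unique ?_ h2
    simp only [← h1]
    exact (((J.continuous.tendsto _).comp (hU t u)).sub_const _)
  have h5 : HasDerivAt (fun s => J u + ∫ r in (0 : ℝ)..s, B (U r u)) (B (U t u)) t :=
    (intervalIntegral.integral_hasDerivAt_right (hBc.intervalIntegrable _ _)
      hBc.aestronglyMeasurable.stronglyMeasurableAtFilter hBc.continuousAt).const_add _
  refine h5.congr_of_eventuallyEq (Eventually.of_forall fun s => ?_)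
  simp only [← hint, add_sub_cancel]

end

/-! ### Gradient and divergence on Sobolev spaces -/

theorem Sob.mapL_incl {V V' : Type} [NormedAddCommGroup V] [InnerProductSpace ℝ V]
    [NormedAddCommGroup V'] [InnerProductSpace ℝ V'] [CompleteSpace V] [CompleteSpace V']
    {k l : ℕ} (h : k ≤ l) (L : V →L[ℝ] V') (u : Sob l V) :
    Sob.mapL L (Sob.incl h u) = Sob.incl h (Sob.mapL L u) := by
  refine Sob.ext_D fun γ hγ => ?_
  rw [Sob.D_mapL _ _ hγ, Sob.D_incl _ _ hγ, Sob.D_incl _ _ hγ, Sob.D_mapL _ _ (multiIdx_mono h hγ)]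

theorem Sob.pdS_mapL {V V' : Type} [NormedAddCommGroup V] [InnerProductSpace ℝ V]
    [NormedAddCommGroup V'] [InnerProductSpace ℝ V'] [CompleteSpace V] [CompleteSpace V']
    {k : ℕ} (L : V →L[ℝ] V') (j : Fin 3) (u : Sob (k + 1) V) :
    Sob.pdS j (Sob.mapL L u) = Sob.mapL L (Sob.pdS j u) := by
  refine Sob.ext_D fun γ hγ => ?_
  rw [Sob.D_pdS _ _ hγ, Sob.D_mapL _ _ hγ, Sob.D_pdS _ _ hγ,
    Sob.D_mapL _ _ (add_single_mem_multiIdx hγ j)]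

theorem inner_compLpL {V V' : Type} [NormedAddCommGroup V] [InnerProductSpace ℝ V]
    [NormedAddCommGroup V'] [InnerProductSpace ℝ V'] {L : V →L[ℝ] V'} {L' : V' →L[ℝ] V}
    (h : ∀ x y, inner ℝ (L x) y = inner ℝ x (L' y)) (u : L2 V) (w : L2 V') :
    inner ℝ (L.compLpL 2 volume u) w = inner ℝ u (L'.compLpL 2 volume w) := by
  rw [MeasureTheory.L2.inner_def, MeasureTheory.L2.inner_def]
  refine integral_congr_ae ?_
  filter_upwards [compLpL_ae L u, compLpL_ae L' w] with x h1 h2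
  rw [h1, h2, h]

theorem Sob.inner_mapL {V V' : Type} [NormedAddCommGroup V] [InnerProductSpace ℝ V]
    [NormedAddCommGroup V'] [InnerProductSpace ℝ V'] [CompleteSpace V] [CompleteSpace V']
    {k : ℕ} {L : V →L[ℝ] V'} {L' : V' →L[ℝ] V} (h : ∀ x y, inner ℝ (L x) y = inner ℝ x (L' y))
    (u : Sob k V) (w : Sob k V') :
    inner ℝ (Sob.mapL L u) w = inner ℝ u (Sob.mapL L' w) := by
  rw [Sob.inner_eq, Sob.inner_eq]
  refine Finset.sum_congr rfl fun γ hγ => ?_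
  rw [Sob.D_mapL _ _ hγ, Sob.D_mapL _ _ hγ, inner_compLpL h]

/-- The matrix with `α`-th column `w` and zero elsewhere. -/
def colMat (α : Fin 3) : Vec →L[ℝ] Mat :=
  LinearMap.toContinuousLinearMap
    { toFun := fun w => WithLp.toLp 2 fun p => if p.2 = α then w p.1 else 0
      map_add' := fun w z => by
        ext p
        by_cases h : p.2 = α <;> simp [h]
      map_smul' := fun c w => by
        ext p
        by_cases h : p.2 = α <;> simp [h] }

theorem colMat_apply (α : Fin 3) (w : Vec) (p : Fin 3 × Fin 3) :
    colMat α w p = if p.2 = α then w p.1 else 0 := rfl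

/-- The `α`-th column of a matrix. -/
def matCol (α : Fin 3) : Mat →L[ℝ] Vec :=
  LinearMap.toContinuousLinearMap
    { toFun := fun M => WithLp.toLp 2 fun i => M (i, α)
      map_add' := fun w z => by
        ext p
        simp
      map_smul' := fun c w => by
        ext p
        simp }

theorem matCol_apply (α : Fin 3) (M : Mat) (i : Fin 3) : matCol α M i = M (i, α) := rfl

theorem inner_colMat (α : Fin 3) (w : Vec) (M : Mat) :
    inner ℝ (colMat α w) M = inner ℝ w (matCol α M) := by
  simp only [PiLp.inner_apply, colMat_apply, matCol_apply, Fintype.sum_prod_type]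
  refine Finset.sum_congr rfl fun i _ => ?_
  rw [Finset.sum_eq_single α] <;> simp +contextual

/-- The gradient `(∂_α v_i)_{iα}`. -/
def grad {k : ℕ} : Sob (k + 1) Vec →L[ℝ] Sob k Mat :=
  ∑ α, (Sob.mapL (colMat α)).comp (Sob.pdS α)

/-- The divergence `(∂_α S_{iα})_i`. -/
def dvg {k : ℕ} : Sob (k + 1) Mat →L[ℝ] Sob k Vec :=
  ∑ α, (Sob.mapL (matCol α)).comp (Sob.pdS α)

/-- The gradient with difference quotients. -/
def gradQ {k : ℕ} (h : ℝ) : Sob k Vec →L[ℝ] Sob k Mat :=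
  ∑ α, (Sob.mapL (colMat α)).comp (Sob.diffQ h α)

/-- The divergence with difference quotients. -/
def dvgQ {k : ℕ} (h : ℝ) : Sob k Mat →L[ℝ] Sob k Vec :=
  ∑ α, (Sob.mapL (matCol α)).comp (Sob.diffQ h α)

theorem inner_grad {k : ℕ} (v : Sob (k + 1) Vec) (M : Sob (k + 1) Mat) :
    inner ℝ (grad v) (Sob.incl (Nat.le_succ k) M)
      = -inner ℝ (Sob.incl (Nat.le_succ k) v) (dvg M) := by
  simp only [grad, dvg, sum_apply, ContinuousLinearMap.comp_apply, sum_inner, inner_sum,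
    ← Finset.sum_neg_distrib]
  refine Finset.sum_congr rfl fun α _ => ?_
  rw [Sob.inner_mapL (inner_colMat α), Sob.mapL_incl, Sob.inner_pdS, Sob.pdS_mapL]

theorem inner_gradQ {k : ℕ} (h : ℝ) (v : Sob k Vec) (M : Sob k Mat) :
    inner ℝ (gradQ h v) M = -inner ℝ v (dvgQ h M) := by
  simp only [gradQ, dvgQ, sum_apply, ContinuousLinearMap.comp_apply, sum_inner, inner_sum,
    ← Finset.sum_neg_distrib]
  refine Finset.sum_congr rfl fun α _ => ?_
  rw [Sob.inner_mapL (inner_colMat α), Sob.inner_diffQ, Sob.diffQ_mapL]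

theorem grad_val_ae {k : ℕ} (v : Sob (k + 1) Vec) :
    (grad v).val =ᵐ[volume] fun x => WithLp.toLp 2 fun p : Fin 3 × Fin 3 => v.pd p.2 x p.1 := by
  have hv : (grad v).val = ∑ α, (colMat α).compLpL 2 volume (v.pd α) := by
    rw [Sob.val_eq, ← Sob.DL_apply, grad, sum_apply, map_sum]
    refine Finset.sum_congr rfl fun α _ => ?_
    rw [ContinuousLinearMap.comp_apply, Sob.DL_apply, Sob.D_mapL _ _ (zero_mem_multiIdx _),
      ← Sob.val_eq, Sob.val_pdS]
  rw [hv]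
  filter_upwards [Lp.coeFn_finsetSum Finset.univ fun α => (colMat α).compLpL 2 volume (v.pd α),
    ae_all_iff.2 fun α => compLpL_ae (colMat α) (v.pd α)] with x h1 h2
  rw [h1, Finset.sum_apply]
  ext p
  simp [h2, colMat_apply]

theorem dvg_val_ae {k : ℕ} (M : Sob (k + 1) Mat) :
    (dvg M).val =ᵐ[volume] fun x => WithLp.toLp 2 fun i : Fin 3 => ∑ α, M.pd α x (i, α) := by
  have hv : (dvg M).val = ∑ α, (matCol α).compLpL 2 volume (M.pd α) := by
    rw [Sob.val_eq, ← Sob.DL_apply, dvg, sum_apply, map_sum]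
    refine Finset.sum_congr rfl fun α _ => ?_
    rw [ContinuousLinearMap.comp_apply, Sob.DL_apply, Sob.D_mapL _ _ (zero_mem_multiIdx _),
      ← Sob.val_eq, Sob.val_pdS]
  rw [hv]
  filter_upwards [Lp.coeFn_finsetSum Finset.univ fun α => (matCol α).compLpL 2 volume (M.pd α),
    ae_all_iff.2 fun α => compLpL_ae (matCol α) (M.pd α)] with x h1 h2
  rw [h1, Finset.sum_apply]
  ext i
  simp [h2, matCol_apply]

/-! ### The linear relaxation group -/

/-- Componentwise difference quotients. -/
def State.diffQ {k : ℕ} (h : ℝ) (j : Fin 3) : State k →L[ℝ] State k :=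
  (Sob.diffQ h j).prodMap ((Sob.diffQ h j).prodMap (Sob.diffQ h j))

/-- Componentwise derivatives. -/
def State.pdS {k : ℕ} (j : Fin 3) : State (k + 1) →L[ℝ] State k :=
  (Sob.pdS j).prodMap ((Sob.pdS j).prodMap (Sob.pdS j))

/-- The inclusion of triples as a continuous linear map. -/
def State.inclL {k l : ℕ} (h : k ≤ l) : State l →L[ℝ] State k :=
  (Sob.inclL h).prodMap ((Sob.inclL h).prodMap (Sob.inclL h))

theorem State.inclL_apply {k l : ℕ} (h : k ≤ l) (W : State l) :
    State.inclL h W = State.incl h W :=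
  Prod.ext (Sob.inclL_apply h W.1) (Prod.ext (Sob.inclL_apply h W.2.1) (Sob.inclL_apply h W.2.2))

/-- The velocity component. -/
def State.velL {k : ℕ} : State k →L[ℝ] Sob k Vec :=
  (ContinuousLinearMap.fst ℝ (Sob k Vec) (Sob k Mat)).comp
    (ContinuousLinearMap.snd ℝ (Sob k Mat) (Sob k Vec × Sob k Mat))

/-- The stress component. -/
def State.stressL {k : ℕ} : State k →L[ℝ] Sob k Mat :=
  (ContinuousLinearMap.snd ℝ (Sob k Vec) (Sob k Mat)).comp
    (ContinuousLinearMap.snd ℝ (Sob k Mat) (Sob k Vec × Sob k Mat))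

theorem State.diffQ_apply {k : ℕ} (h : ℝ) (j : Fin 3) (W : State k) :
    State.diffQ h j W = (Sob.diffQ h j W.1, Sob.diffQ h j W.2.1, Sob.diffQ h j W.2.2) := rfl

/-- The coefficient matrices of the relaxation system. -/
def State.coeff {k : ℕ} (c : ℝ) (j : Fin 3) : State k →L[ℝ] State k :=
  ((Sob.mapL (colMat j)).comp State.velL).prod
    (((Sob.mapL (matCol j)).comp State.stressL).prod
      ((Sob.mapL (c • colMat j)).comp State.velL))

theorem State.coeff_apply {k : ℕ} (c : ℝ) (j : Fin 3) (W : State k) :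
    State.coeff c j W = (Sob.mapL (colMat j) W.2.1, Sob.mapL (matCol j) W.2.2,
      Sob.mapL (c • colMat j) W.2.1) := rfl

theorem State.coeff_diffQ {k : ℕ} (c h : ℝ) (i j : Fin 3) (W : State k) :
    State.diffQ h i (State.coeff c j W) = State.coeff c j (State.diffQ h i W) := by
  rw [State.coeff_apply, State.diffQ_apply, State.coeff_apply, State.diffQ_apply, Sob.diffQ_mapL,
    Sob.diffQ_mapL, Sob.diffQ_mapL]

theorem State.diffQ_comm {k : ℕ} (h h' : ℝ) (i j : Fin 3) (W : State k) :
    State.diffQ h i (State.diffQ h' j W) = State.diffQ h' j (State.diffQ h i W) :=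
  Prod.ext (Sob.diffQ_comm _ _ _ _ _)
    (Prod.ext (Sob.diffQ_comm _ _ _ _ _) (Sob.diffQ_comm _ _ _ _ _))

theorem Sob.mapL_smul {V V' : Type} [NormedAddCommGroup V] [InnerProductSpace ℝ V]
    [NormedAddCommGroup V'] [InnerProductSpace ℝ V'] [CompleteSpace V] [CompleteSpace V']
    {k : ℕ} (c : ℝ) (L : V →L[ℝ] V') (u : Sob k V) :
    Sob.mapL (c • L) u = c • Sob.mapL L u := by
  refine Sob.ext_D fun γ hγ => ?_
  rw [Sob.D_smul, Sob.D_mapL _ _ hγ, Sob.D_mapL _ _ hγ, ContinuousLinearMap.smul_compLpL]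
  rfl

/-- The discretized relaxation operator. -/
def relaxQ {k : ℕ} (c h : ℝ) : State k →L[ℝ] State k :=
  ∑ j, (State.coeff c j).comp (State.diffQ h j)

/-- The linear relaxation operator `(F, v, S) ↦ (∇v, div S, c ∇v)`. -/
def relaxL {k : ℕ} (c : ℝ) : State (k + 1) →L[ℝ] State k :=
  ∑ j, (State.coeff c j).comp (State.pdS j)

theorem relaxQ_eq_sum {k : ℕ} (c h : ℝ) (W : State k) :
    relaxQ c h W = ∑ j, State.coeff c j (State.diffQ h j W) := by
  rw [relaxQ, sum_apply]
  rfl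

theorem relaxL_eq_sum {k : ℕ} (c : ℝ) (W : State (k + 1)) :
    relaxL c W = ∑ j, State.coeff c j (State.pdS j W) := by
  rw [relaxL, sum_apply]
  rfl

theorem sum_coeff {k : ℕ} (c : ℝ) (W : Fin 3 → State k) :
    ∑ j, State.coeff c j (W j) = (∑ j, Sob.mapL (colMat j) (W j).2.1,
      ∑ j, Sob.mapL (matCol j) (W j).2.2, c • ∑ j, Sob.mapL (colMat j) (W j).2.1) := by
  refine Prod.ext ?_ (Prod.ext ?_ ?_)
  · rw [Prod.fst_sum]
    rfl
  · rw [Prod.snd_sum, Prod.fst_sum]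
    rfl
  · rw [Prod.snd_sum, Prod.snd_sum, Finset.smul_sum]
    exact Finset.sum_congr rfl fun j _ => Sob.mapL_smul c (colMat j) (W j).2.1

theorem relaxL_apply {k : ℕ} (c : ℝ) (W : State (k + 1)) :
    relaxL c W = (grad W.2.1, dvg W.2.2, c • grad W.2.1) := by
  rw [relaxL_eq_sum, sum_coeff, grad, dvg, sum_apply, sum_apply]
  rfl

theorem relaxQ_apply {k : ℕ} (c h : ℝ) (W : State k) :
    relaxQ c h W = (gradQ h W.2.1, dvgQ h W.2.2, c • gradQ h W.2.1) := by
  rw [relaxQ_eq_sum, sum_coeff, gradQ, dvgQ, sum_apply, sum_apply]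
  rfl

theorem State.diffQ_relaxQ {k : ℕ} (c h h' : ℝ) (i : Fin 3) (W : State k) :
    State.diffQ h i (relaxQ c h' W) = relaxQ c h' (State.diffQ h i W) := by
  rw [relaxQ_eq_sum, relaxQ_eq_sum, map_sum]
  exact Finset.sum_congr rfl fun j _ => by rw [State.coeff_diffQ, State.diffQ_comm h h']

/-! ### The energy as a quadratic form and its conservation -/

/-- The bilinear form of the energy. -/
def energyForm {k : ℕ} (μ ε : ℝ) (W Z : State k) : ℝ :=
  μ * inner ℝ W.1 Z.1 - ε * (inner ℝ W.1 Z.2.2 + inner ℝ W.2.2 Z.1)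
    + (μ - ε) * inner ℝ W.2.1 Z.2.1 + ε * inner ℝ W.2.2 Z.2.2

theorem energyForm_self {k : ℕ} (μ ε : ℝ) (W : State k) :
    energyForm μ ε W W = μ * ‖W.1‖ ^ 2 - 2 * ε * inner ℝ W.1 W.2.2
      + (μ - ε) * ‖W.2.1‖ ^ 2 + ε * ‖W.2.2‖ ^ 2 := by
  simp only [energyForm, real_inner_self_eq_norm_sq, real_inner_comm W.1 W.2.2]
  ring

/-- The factor ε clears the denominators in the symmetrizer, and summation over multi-indices
produces H³ inner products. -/
theorem highEnergy_eq {μ ε : ℝ} (hε : ε ≠ 0) (W : State 3) :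
    highEnergy μ ε W = energyForm μ ε W W := by
  rw [energyForm_self, Sob.norm_sq_eq, Sob.norm_sq_eq, Sob.norm_sq_eq, Sob.inner_eq, highEnergy,
    Finset.mul_sum, Finset.mul_sum, Finset.mul_sum, Finset.mul_sum, ← Finset.sum_sub_distrib,
    ← Finset.sum_add_distrib, ← Finset.sum_add_distrib]
  refine Finset.sum_congr rfl fun γ _ => ?_
  simp only [energy, symmetrizer, inner_sub_left, inner_add_left, inner_neg_left,
    real_inner_smul_left, real_inner_self_eq_norm_sq, real_inner_comm (W.1.D γ) (W.2.2.D γ)]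
  field_simp
  ring

/-- The cross term is at most 2ε‖F‖² + (ε/2)‖S‖², and ε ≤ μ/4 leaves μ − 2ε ≥ μ/2. The coefficients
of F and v do not degenerate as ε → 0; only that of S does. -/
theorem energyForm_lower {k : ℕ} {μ ε : ℝ} (hε : 0 < ε) (hεμ : ε ≤ μ / 4) (W : State k) :
    μ / 2 * ‖W.1‖ ^ 2 + μ / 2 * ‖W.2.1‖ ^ 2 + ε / 2 * ‖W.2.2‖ ^ 2 ≤ energyForm μ ε W W := by
  rw [energyForm_self]
  have h1 := real_inner_le_norm W.1 W.2.2
  nlinarith [sq_nonneg (2 * ‖W.1‖ - ‖W.2.2‖), sq_nonneg ‖W.1‖, sq_nonneg ‖W.2.1‖]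

theorem energyForm_upper {k : ℕ} {μ ε : ℝ} (hε : 0 < ε) (hεμ : ε ≤ μ / 4) (W : State k) :
    energyForm μ ε W W ≤ 4 * μ * ‖W‖ ^ 2 := by
  rw [energyForm_self]
  have h1 := neg_le_of_abs_le (abs_real_inner_le_norm W.1 W.2.2)
  have h2 : ‖W.1‖ ≤ ‖W‖ := norm_fst_le W
  have h3 : ‖W.2.1‖ ≤ ‖W‖ := (norm_fst_le W.2).trans (norm_snd_le W)
  have h4 : ‖W.2.2‖ ≤ ‖W‖ := (norm_snd_le W.2).trans (norm_snd_le W)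
  have a1 : ‖W.1‖ ^ 2 ≤ ‖W‖ ^ 2 := by gcongr
  have a2 : ‖W.2.1‖ ^ 2 ≤ ‖W‖ ^ 2 := by gcongr
  have a3 : ‖W.2.2‖ ^ 2 ≤ ‖W‖ ^ 2 := by gcongr
  have a4 : ‖W.1‖ * ‖W.2.2‖ ≤ ‖W‖ ^ 2 := by
    rw [pow_two]
    gcongr
  nlinarith [sq_nonneg ‖W.1‖, sq_nonneg ‖W.2.1‖, sq_nonneg ‖W.2.2‖, sq_nonneg ‖W‖]

theorem norm_sq_le_energyForm {k : ℕ} {μ ε : ℝ} (hε : 0 < ε) (hεμ : ε ≤ μ / 4) (W : State k) :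
    ε / 2 * ‖W‖ ^ 2 ≤ energyForm μ ε W W := by
  have h := energyForm_lower hε hεμ W
  have h1 := sq_nonneg ‖W.1‖
  have h2 := sq_nonneg ‖W.2.1‖
  have h3 := sq_nonneg ‖W.2.2‖
  refine le_trans ?_ h
  rw [Prod.norm_def, Prod.norm_def]
  rcases max_choice ‖W.1‖ (max ‖W.2.1‖ ‖W.2.2‖) with h4 | h4 <;> rw [h4]
  · nlinarith
  · rcases max_choice ‖W.2.1‖ ‖W.2.2‖ with h5 | h5 <;> rw [h5] <;> nlinarith

theorem continuous_energyForm {k : ℕ} (μ ε : ℝ) :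
    Continuous fun W : State k => energyForm μ ε W W := by
  unfold energyForm
  fun_prop

theorem HasDerivWithinAt.fst_comp {E G : Type*} [NormedAddCommGroup E] [NormedSpace ℝ E]
    [NormedAddCommGroup G] [NormedSpace ℝ G] {f : ℝ → E × G} {f' : E × G} {s : Set ℝ} {t : ℝ}
    (h : HasDerivWithinAt f f' s t) : HasDerivWithinAt (fun r => (f r).1) f'.1 s t :=
  (ContinuousLinearMap.fst ℝ E G).hasFDerivAt.comp_hasDerivWithinAt t h

theorem HasDerivWithinAt.snd_comp {E G : Type*} [NormedAddCommGroup E] [NormedSpace ℝ E]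
    [NormedAddCommGroup G] [NormedSpace ℝ G] {f : ℝ → E × G} {f' : E × G} {s : Set ℝ} {t : ℝ}
    (h : HasDerivWithinAt f f' s t) : HasDerivWithinAt (fun r => (f r).2) f'.2 s t :=
  (ContinuousLinearMap.snd ℝ E G).hasFDerivAt.comp_hasDerivWithinAt t h

theorem hasDerivWithinAt_energyForm {k : ℕ} (μ ε : ℝ) {f : ℝ → State k} {f' : State k} {t : ℝ}
    {s : Set ℝ} (h : HasDerivWithinAt f f' s t) :
    HasDerivWithinAt (fun r => energyForm μ ε (f r) (f r)) (2 * energyForm μ ε f' (f t)) s t := by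
  have h1 : HasDerivWithinAt (fun r => (f r).1) f'.1 s t := HasDerivWithinAt.fst_comp h
  have h0 : HasDerivWithinAt (fun r => (f r).2) f'.2 s t := HasDerivWithinAt.snd_comp h
  have h2 : HasDerivWithinAt (fun r => (f r).2.1) f'.2.1 s t := HasDerivWithinAt.fst_comp h0
  have h3 : HasDerivWithinAt (fun r => (f r).2.2) f'.2.2 s t := HasDerivWithinAt.snd_comp h0
  refine (((((h1.inner ℝ h1).const_mul μ).sub (((h1.inner ℝ h3).add (h3.inner ℝ h1)).const_mul ε)).add
    ((h2.inner ℝ h2).const_mul (μ - ε))).add ((h3.inner ℝ h3).const_mul ε)).congr_deriv ?_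
  simp only [energyForm, real_inner_comm f'.1, real_inner_comm f'.2.1, real_inner_comm f'.2.2]
  ring

/-- The coefficient μ/ε makes both ⟨∇v, F⟩ terms cancel; what is left is (μ − ε)(⟨∇v, S⟩ + ⟨div S,
v⟩), zero because the discrete gradient and divergence are negative adjoints. -/
theorem energyForm_relaxQ {k : ℕ} {μ ε : ℝ} (hε : ε ≠ 0) (h : ℝ) (W : State k) :
    energyForm μ ε (relaxQ (μ / ε) h W) W = 0 := by
  rw [relaxQ_apply]
  simp only [energyForm, real_inner_smul_left, inner_gradQ, ← real_inner_comm (dvgQ h _)]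
  field_simp
  ring

/-! ### The approximate groups and their limit on H³ -/

section

open NormedSpace

theorem exp_zero_smul_apply {E : Type*} [NormedAddCommGroup E] [NormedSpace ℝ E]
    (A : E →L[ℝ] E) (u : E) : exp ((0 : ℝ) • A) u = u := by
  simp

theorem energyForm_exp_relaxQ {k : ℕ} {μ ε : ℝ} (hε : ε ≠ 0) (h t : ℝ) (W : State k) :
    energyForm μ ε (exp (t • relaxQ (k := k) (μ / ε) h) W) (exp (t • relaxQ (k := k) (μ / ε) h) W)
      = energyForm μ ε W W := by
  have hd (s : ℝ) : HasDerivAt (fun r : ℝ => energyForm μ ε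
      (exp (r • relaxQ (k := k) (μ / ε) h) W) (exp (r • relaxQ (k := k) (μ / ε) h) W)) 0 s := by
    have := hasDerivWithinAt_energyForm μ ε
      (hasDerivAt_exp_smul_apply (relaxQ (k := k) (μ / ε) h) W s).hasDerivWithinAt (s := univ)
    rw [exp_smul_comm_apply, energyForm_relaxQ hε, mul_zero] at this
    exact this.hasDerivAt univ_mem
  have := is_const_of_deriv_eq_zero (fun s => (hd s).differentiableAt) (fun s => (hd s).deriv) t 0
  exact this.trans (congrArg (fun w => energyForm μ ε w w) (exp_zero_smul_apply _ W))

/-- The energy is conserved and lies between (ε/2)‖W‖² and 4μ‖W‖²; the bound is the root of the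
quotient, uniform in the step h and in time. -/
theorem norm_exp_relaxQ_le {k : ℕ} {μ ε : ℝ} (hε : 0 < ε) (hεμ : ε ≤ μ / 4) (h t : ℝ) :
    ‖exp (t • relaxQ (k := k) (μ / ε) h)‖ ≤ Real.sqrt (8 * μ / ε) := by
  refine ContinuousLinearMap.opNorm_le_bound _ (Real.sqrt_nonneg _) fun W => ?_
  have h1 := norm_sq_le_energyForm hε hεμ (exp (t • relaxQ (k := k) (μ / ε) h) W)
  rw [energyForm_exp_relaxQ hε.ne'] at h1
  have h2 := h1.trans (energyForm_upper hε hεμ W)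
  refine le_of_sq_le_sq ?_ (by positivity)
  rw [mul_pow, Real.sq_sqrt (by have : 0 < μ := by linarith
                                positivity), div_mul_eq_mul_div, le_div_iff₀ hε]
  linarith

theorem dense_differentiable_state (k : ℕ) : Dense {W : State k |
    ∀ j, ∃ Z, Tendsto (fun s => State.diffQ s j W) (𝓝[≠] 0) (𝓝 Z)} := by
  refine ((Sob.dense_differentiable (V := Mat) k).prod
    ((Sob.dense_differentiable (V := Vec) k).prod
      (Sob.dense_differentiable (V := Mat) k))).mono fun W hW j => ?_
  obtain ⟨F', hF⟩ := hW.1 j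
  obtain ⟨v', hv⟩ := hW.2.1 j
  obtain ⟨S', hS⟩ := hW.2.2 j
  exact ⟨(F', v', S'), (Sob.tendsto_diffQ hF).prodMk_nhds
    ((Sob.tendsto_diffQ hv).prodMk_nhds (Sob.tendsto_diffQ hS))⟩

theorem tendsto_step : Tendsto (fun n : ℕ => 1 / ((n : ℝ) + 1)) atTop (𝓝[≠] 0) :=
  tendsto_nhdsWithin_iff.2 ⟨tendsto_one_div_add_atTop_nhds_zero_nat,
    Eventually.of_forall fun _ => (Nat.one_div_pos_of_nat (α := ℝ)).ne'⟩

theorem State.coeff_incl {k l : ℕ} (h : k ≤ l) (c : ℝ) (j : Fin 3) (W : State l) :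
    State.coeff c j (State.incl h W) = State.incl h (State.coeff c j W) :=
  Prod.ext (Sob.mapL_incl h _ _) (Prod.ext (Sob.mapL_incl h _ _) (Sob.mapL_incl h _ _))

theorem State.diffQ_incl {k l : ℕ} (hkl : k ≤ l) (h : ℝ) (j : Fin 3) (W : State l) :
    State.diffQ h j (State.incl hkl W) = State.incl hkl (State.diffQ h j W) :=
  Prod.ext (Sob.diffQ_incl hkl _ _ _)
    (Prod.ext (Sob.diffQ_incl hkl _ _ _) (Sob.diffQ_incl hkl _ _ _))

/-- Giving up one derivative, the discrete operators converge at every W, not just on a dense set;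
this identifies the generator of the limit group. -/
theorem tendsto_incl_relaxQ {k : ℕ} (c : ℝ) (W : State (k + 1)) :
    Tendsto (fun n : ℕ => State.inclL (Nat.le_succ k) (relaxQ c (1 / ((n : ℝ) + 1)) W)) atTop
      (𝓝 (relaxL c W)) := by
  simp only [relaxL_eq_sum, relaxQ_eq_sum, map_sum, State.inclL_apply]
  simp only [← State.coeff_incl, ← State.diffQ_incl]
  refine tendsto_finsetSum _ fun j _ => ?_
  refine ((State.coeff c j).continuous.tendsto _).comp ?_
  refine Tendsto.comp (y := 𝓝[≠] 0) (g := fun h => State.diffQ h j (State.incl (Nat.le_succ k) W))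
    ?_ tendsto_step
  exact (Sob.tendsto_diffQ (Sob.hasDerivAt_transS j W.1)).prodMk_nhds
    ((Sob.tendsto_diffQ (Sob.hasDerivAt_transS j W.2.1)).prodMk_nhds
      (Sob.tendsto_diffQ (Sob.hasDerivAt_transS j W.2.2)))

/-- The group generated by the linear relaxation operator on `H³`. -/
theorem exists_relaxGroup {μ ε : ℝ} (hε : 0 < ε) (hεμ : ε ≤ μ / 4) :
    ∃ U : ℝ → State 3 →L[ℝ] State 3, U 0 = 1 ∧ (∀ s t W, U (s + t) W = U s (U t W)) ∧
      (∀ t, ‖U t‖ ≤ Real.sqrt (8 * μ / ε)) ∧ (∀ W, Continuous fun t => U t W) ∧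
      (∀ t W, energyForm μ ε (U t W) (U t W) = energyForm μ ε W W) ∧
      ∀ W t, HasDerivAt (fun s => State.incl (by norm_num : 2 ≤ 3) (U s W))
        (relaxL (k := 2) (μ / ε) (U t W)) t := by
  have hM (h t : ℝ) : ‖exp (t • relaxQ (k := 3) (μ / ε) h)‖ ≤ Real.sqrt (8 * μ / ε) :=
    norm_exp_relaxQ_le hε hεμ h t
  obtain ⟨U, h0, hadd, hbd, hcont, hlim⟩ := exists_group
    (fun n : ℕ => relaxQ (k := 3) (μ / ε) (1 / ((n : ℝ) + 1))) (fun n t => hM _ t)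
    ((dense_differentiable_state 3).mono fun W hW δ hδ => by
      choose Z hZ using hW
      exact consistent_of_tendsto (fun n W => relaxQ_eq_sum (μ / ε) (1 / ((n : ℝ) + 1)) W)
        (fun m n j W => State.diffQ_relaxQ (μ / ε) _ _ j W) (fun n t => hM _ t)
        (fun j => (hZ j).comp tendsto_step) hδ)
  refine ⟨U, h0, hadd, hbd, hcont, fun t W => ?_, fun W t => ?_⟩
  · refine tendsto_nhds_unique (((continuous_energyForm μ ε).tendsto _).comp (hlim t W)) ?_
    refine tendsto_const_nhds.congr fun n => ?_
    exact (energyForm_exp_relaxQ hε.ne' _ t W).symm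
  · have h := hasDerivAt_group (fun n t => hM _ t) hcont hlim (State.inclL (Nat.le_succ 2))
      (relaxL (k := 2) (μ / ε)) (fun W => tendsto_incl_relaxQ (μ / ε) W) W t
    simp only [State.inclL_apply] at h
    exact h

end

/-! ### Semilinear equations for groups preserving an energy -/

/-- Grönwall: e^{−Ks}(f + d) is nonincreasing. -/
theorem exp_mul_le_of_hasDerivWithinAt {τ K d : ℝ} {f f' : ℝ → ℝ}
    (hf : ∀ t ∈ Icc 0 τ, HasDerivWithinAt f (f' t) (Icc 0 τ) t)
    (hK : ∀ t ∈ Icc 0 τ, f' t ≤ K * (f t + d)) {t : ℝ} (ht : t ∈ Icc 0 τ) :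
    f t + d ≤ Real.exp (K * t) * (f 0 + d) := by
  have hd (s : ℝ) (hs : s ∈ Icc 0 τ) : HasDerivWithinAt (fun s => Real.exp (-(K * s)) * (f s + d))
      (Real.exp (-(K * s)) * (f' s - K * (f s + d))) (Icc 0 τ) s := by
    have h1 : HasDerivAt (fun s : ℝ => Real.exp (-(K * s))) (Real.exp (-(K * s)) * (-K)) s := by
      simpa using ((hasDerivAt_id s).const_mul K).neg.exp
    refine (h1.hasDerivWithinAt.mul ((hf s hs).add_const d)).congr_deriv ?_
    ring
  have hanti : AntitoneOn (fun s => Real.exp (-(K * s)) * (f s + d)) (Icc 0 τ) := by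
    refine antitoneOn_of_hasDerivWithinAt_nonpos (convex_Icc _ _)
      (fun s hs => (hd s hs).continuousWithinAt)
      (fun s hs => (hd s (interior_subset hs)).mono interior_subset) fun s hs => ?_
    exact mul_nonpos_of_nonneg_of_nonpos (Real.exp_nonneg _)
      (sub_nonpos.2 (hK s (interior_subset hs)))
  have h := hanti (left_mem_Icc.2 (ht.1.trans ht.2)) ht ht.1
  simp only [mul_zero, neg_zero, Real.exp_zero, one_mul] at h
  calc f t + d = Real.exp (K * t) * (Real.exp (-(K * t)) * (f t + d)) := by
        rw [← mul_assoc, ← Real.exp_add, add_neg_cancel, Real.exp_zero, one_mul]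
    _ ≤ _ := mul_le_mul_of_nonneg_left h (Real.exp_nonneg _)

/-- A Lipschitz cutoff which is `1` on `(-∞, ρ/2]` and `0` on `[ρ, ∞)`. -/
def cutoff (ρ x : ℝ) : ℝ := max 0 (min 1 (2 - 2 / ρ * x))

theorem cutoff_nonneg (ρ x : ℝ) : 0 ≤ cutoff ρ x := le_max_left _ _

theorem cutoff_le_one (ρ x : ℝ) : cutoff ρ x ≤ 1 := max_le zero_le_one (min_le_left _ _)

theorem cutoff_eq_one {ρ x : ℝ} (hρ : 0 < ρ) (hx : x ≤ ρ / 2) : cutoff ρ x = 1 := by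
  have : 2 / ρ * x ≤ 1 := by
    rw [div_mul_eq_mul_div, div_le_one hρ]
    linarith
  rw [cutoff, min_eq_left (by linarith), max_eq_right zero_le_one]

theorem cutoff_eq_zero {ρ x : ℝ} (hρ : 0 < ρ) (hx : ρ ≤ x) : cutoff ρ x = 0 := by
  have : 2 ≤ 2 / ρ * x := by
    rw [div_mul_eq_mul_div, le_div_iff₀ hρ]
    linarith
  exact max_eq_left ((min_le_right _ _).trans (by linarith))

theorem abs_cutoff_sub_le {ρ : ℝ} (hρ : 0 < ρ) (x y : ℝ) :
    |cutoff ρ x - cutoff ρ y| ≤ 2 / ρ * |x - y| := by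
  have h1 : |cutoff ρ x - cutoff ρ y| ≤ |min 1 (2 - 2 / ρ * x) - min 1 (2 - 2 / ρ * y)| := by
    have := abs_max_sub_max_le_max 0 (min 1 (2 - 2 / ρ * x)) 0 (min 1 (2 - 2 / ρ * y))
    simpa [cutoff] using this
  have h2 : |min 1 (2 - 2 / ρ * x) - min 1 (2 - 2 / ρ * y)|
      ≤ |(2 - 2 / ρ * x) - (2 - 2 / ρ * y)| := by
    have := abs_min_sub_min_le_max 1 (2 - 2 / ρ * x) 1 (2 - 2 / ρ * y)
    simpa using this
  refine h1.trans (h2.trans_eq ?_)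
  rw [sub_sub_sub_cancel_left, ← mul_sub, abs_mul, abs_of_pos (by positivity), abs_sub_comm]

section

variable {E : Type*} [NormedAddCommGroup E] [NormedSpace ℝ E]

/-- A field bounded by B keeps the solution in the ball of radius Bτ, so a local Lipschitz constant
on that one ball gives Picard–Lindelöf on all of [0, τ]. -/
theorem exists_solution_of_bounded [CompleteSpace E] {τ : ℝ} (hτ : 0 ≤ τ) {g : ℝ → E → E} (x₀ : E)
    {B : ℝ} (hB : ∀ t ∈ Icc 0 τ, ∀ x, ‖g t x‖ ≤ B)
    (hc : ∀ x, ContinuousOn (fun t => g t x) (Icc 0 τ))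
    (hL : ∀ R, ∃ K : ℝ, ∀ t ∈ Icc 0 τ, ∀ x y, ‖x‖ ≤ R → ‖y‖ ≤ R → ‖g t x - g t y‖ ≤ K * ‖x - y‖) :
    ∃ α : ℝ → E, α 0 = x₀ ∧ ∀ t ∈ Icc 0 τ, HasDerivWithinAt α (g t (α t)) (Icc 0 τ) t := by
  have hB0 : 0 ≤ B := (norm_nonneg _).trans (hB 0 (left_mem_Icc.2 hτ) 0)
  obtain ⟨K, hK⟩ := hL (‖x₀‖ + B * τ)
  have hmem : ∀ x ∈ Metric.closedBall x₀ (B * τ), ‖x‖ ≤ ‖x₀‖ + B * τ := fun x hx => by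
    have := norm_le_norm_add_norm_sub x₀ x
    rw [Metric.mem_closedBall, dist_eq_norm] at hx
    rw [norm_sub_rev] at this
    linarith
  have hP : IsPicardLindelof g (⟨0, left_mem_Icc.2 hτ⟩ : Icc 0 τ) x₀ ⟨B * τ, by positivity⟩ 0
      ⟨B, hB0⟩ K.toNNReal :=
    { lipschitzOnWith := fun t ht => LipschitzOnWith.of_dist_le_mul fun x hx y hy => by
        rw [dist_eq_norm, dist_eq_norm]
        exact (hK t ht x y (hmem x hx) (hmem y hy)).trans
          (mul_le_mul_of_nonneg_right (Real.le_coe_toNNReal K) (norm_nonneg _))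
      continuousOn := fun x _ => hc x
      norm_le := fun t ht x _ => hB t ht x
      mul_max_le := by
        simp only [NNReal.coe_zero, sub_zero, sub_self, max_eq_left hτ]
        exact le_rfl }
  exact hP.exists_eq_forall_mem_Icc_hasDerivWithinAt₀

/-- A strongly continuous group of operators preserving a coercive quadratic form. -/
structure IsEnergyGroup (U : ℝ → E →L[ℝ] E) (b : E → E → ℝ) (M c C : ℝ) : Prop where
  zero : U 0 = 1
  add : ∀ s t x, U (s + t) x = U s (U t x)
  norm_le : ∀ t, ‖U t‖ ≤ M
  cont : ∀ x, Continuous fun t => U t x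
  inv : ∀ t x y, b (U t x) (U t y) = b x y
  smul_left : ∀ (r : ℝ) x y, b (r • x) y = r * b x y
  pos : 0 < c
  lower : ∀ x, c * ‖x‖ ^ 2 ≤ b x x
  lip : ∀ x y, |b x x - b y y| ≤ C * (‖x‖ + ‖y‖) * ‖x - y‖
  deriv : ∀ (f : ℝ → E) (f' : E) (s : Set ℝ) (t : ℝ), HasDerivWithinAt f f' s t →
    HasDerivWithinAt (fun r => b (f r) (f r)) (2 * b f' (f t)) s t

namespace IsEnergyGroup

variable {U : ℝ → E →L[ℝ] E} {b : E → E → ℝ} {M c C : ℝ}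

theorem norm_apply_le (h : IsEnergyGroup U b M c C) (t : ℝ) (x : E) : ‖U t x‖ ≤ M * ‖x‖ :=
  (ContinuousLinearMap.le_opNorm _ _).trans
    (mul_le_mul_of_nonneg_right (h.norm_le t) (norm_nonneg _))

theorem nonneg (h : IsEnergyGroup U b M c C) : 0 ≤ M := (norm_nonneg _).trans (h.norm_le 0)

theorem apply_neg (h : IsEnergyGroup U b M c C) (t : ℝ) (x : E) : U t (U (-t) x) = x := by
  rw [← h.add, add_neg_cancel, h.zero]
  rfl

/-- Strong continuity together with the uniform bound M gives joint continuity. -/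
theorem continuous_uncurry (h : IsEnergyGroup U b M c C) : Continuous fun p : ℝ × E => U p.1 p.2 := by
  refine continuous_iff_continuousAt.2 fun p => ?_
  have h1 : Tendsto (fun r : ℝ × E => U r.1 (r.2 - p.2)) (𝓝 p) (𝓝 0) := by
    refine squeeze_zero_norm (fun r => h.norm_apply_le r.1 _) ?_
    have : Continuous fun r : ℝ × E => M * ‖r.2 - p.2‖ := by fun_prop
    simpa using this.tendsto p
  have h2 : Tendsto (fun r : ℝ × E => U r.1 p.2) (𝓝 p) (𝓝 (U p.1 p.2)) :=
    ((h.cont p.2).comp continuous_fst).tendsto p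
  have h3 := h1.add h2
  rw [zero_add] at h3
  refine h3.congr fun r => ?_
  rw [map_sub, sub_add_cancel]

theorem norm_le_sqrt (h : IsEnergyGroup U b M c C) {ρ : ℝ} {x : E} (hx : b x x ≤ ρ) :
    ‖x‖ ≤ Real.sqrt (ρ / c) := by
  refine Real.le_sqrt_of_sq_le ?_
  rw [le_div_iff₀ h.pos]
  linarith [h.lower x]

/-- Semilinear equations have a solution on all of `[0, τ]` as long as an a priori estimate keeps
the energy in the region where the nonlinearity is controlled. -/
theorem exists_semilinear [CompleteSpace E] (h : IsEnergyGroup U b M c C) {τ : ℝ} (hτ : 0 ≤ τ)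
    {n : ℝ → E → E} (hn : ContinuousOn (fun p : ℝ × E => n p.1 p.2) (Icc 0 τ ×ˢ univ))
    {ρ L N : ℝ} (hρ : 0 < ρ)
    (hN : ∀ t ∈ Icc 0 τ, ∀ x, b x x ≤ ρ → ‖n t x‖ ≤ N)
    (hL : ∀ t ∈ Icc 0 τ, ∀ x y, b x x ≤ ρ → b y y ≤ ρ → ‖n t x - n t y‖ ≤ L * ‖x - y‖)
    {K d : ℝ} (hK0 : 0 ≤ K) (hd : 0 ≤ d)
    (hK : ∀ t ∈ Icc 0 τ, ∀ x, b x x ≤ ρ → 2 * b (n t x) x ≤ K * (b x x + d))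
    {x₀ : E} (hx₀ : Real.exp (K * τ) * (b x₀ x₀ + d) ≤ ρ / 2) :
    ∃ Z : ℝ → E, Z 0 = x₀ ∧
      (∀ t ∈ Icc 0 τ, HasDerivWithinAt Z (U (-t) (n t (U t (Z t)))) (Icc 0 τ) t) ∧
      ∀ t ∈ Icc 0 τ, b (Z t) (Z t) + d ≤ Real.exp (K * τ) * (b x₀ x₀ + d) := by
  have hM := h.nonneg
  have hb0 (x : E) : 0 ≤ b x x :=
    le_trans (mul_nonneg h.pos.le (sq_nonneg _)) (h.lower x)
  have h0 : (0 : ℝ) ∈ Icc 0 τ := left_mem_Icc.2 hτ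
  have hN0 : 0 ≤ N := by
    have hx : b x₀ x₀ ≤ ρ := by
      have h1 : 1 * (b x₀ x₀ + d) ≤ Real.exp (K * τ) * (b x₀ x₀ + d) :=
        mul_le_mul_of_nonneg_right (Real.one_le_exp (by positivity)) (by linarith [hb0 x₀])
      linarith
    exact (norm_nonneg _).trans (hN 0 h0 x₀ hx)
  -- The truncation depends on x only through b x x, which U preserves, so it is compatible with
  -- passing to Z = U(−t)W. It makes the field of the ODE globally bounded.
  let θ (x : E) : ℝ := cutoff ρ (b x x)
  let g (t : ℝ) (x : E) : E := θ x • U (-t) (n t (U t x))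
  have hgz {t : ℝ} {x : E} (hx : ρ ≤ b x x) : g t x = 0 := by
    simp only [g, θ, cutoff_eq_zero hρ hx, zero_smul]
  have hUn {t : ℝ} (ht : t ∈ Icc 0 τ) {x : E} (hx : b x x ≤ ρ) :
      ‖U (-t) (n t (U t x))‖ ≤ M * N :=
    (h.norm_apply_le _ _).trans
      (mul_le_mul_of_nonneg_left (hN t ht _ (by rwa [h.inv])) hM)
  have hB : ∀ t ∈ Icc 0 τ, ∀ x, ‖g t x‖ ≤ M * N := fun t ht x => by
    rcases le_total ρ (b x x) with hx | hx
    · rw [hgz hx, norm_zero]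
      positivity
    · rw [norm_smul, Real.norm_eq_abs, abs_of_nonneg (cutoff_nonneg _ _)]
      calc θ x * ‖U (-t) (n t (U t x))‖ ≤ 1 * (M * N) :=
            mul_le_mul (cutoff_le_one _ _) (hUn ht hx) (norm_nonneg _) zero_le_one
        _ = M * N := one_mul _
  have hc : ∀ x, ContinuousOn (fun t => g t x) (Icc 0 τ) := fun x => by
    refine ContinuousOn.const_smul ?_ _
    have h1 : ContinuousOn (fun t : ℝ => n t (U t x)) (Icc 0 τ) :=
      hn.comp (f := fun t : ℝ => (t, U t x)) (continuous_id.prodMk (h.cont x)).continuousOn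
        fun t ht => ⟨ht, mem_univ _⟩
    exact h.continuous_uncurry.comp_continuousOn (continuous_neg.continuousOn.prodMk h1)
  have hθ (R : ℝ) (x y : E) (hx : ‖x‖ ≤ R) (hy : ‖y‖ ≤ R) :
      |θ x - θ y| ≤ 2 / ρ * (|C| * (R + R)) * ‖x - y‖ := by
    refine (abs_cutoff_sub_le hρ _ _).trans ?_
    rw [mul_assoc]
    refine mul_le_mul_of_nonneg_left ((h.lip x y).trans ?_) (by positivity)
    gcongr
    exact le_abs_self C
  -- It suffices that one of the two points has energy at most ρ: if the other lies outside, its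
  -- field vanishes and only the variation of the cutoff counts.
  have hone (R : ℝ) (hR : 0 ≤ R) (t : ℝ) (ht : t ∈ Icc 0 τ) (x y : E) (hx : ‖x‖ ≤ R) (hy : ‖y‖ ≤ R)
      (hbx : b x x ≤ ρ) : ‖g t x - g t y‖
        ≤ (2 / ρ * (|C| * (R + R)) * (M * N) + M * (|L| * M)) * ‖x - y‖ := by
    have e1 : ‖(θ x - θ y) • U (-t) (n t (U t x))‖
        ≤ 2 / ρ * (|C| * (R + R)) * ‖x - y‖ * (M * N) := by
      rw [norm_smul, Real.norm_eq_abs]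
      exact mul_le_mul (hθ R x y hx hy) (hUn ht hbx) (norm_nonneg _) (by positivity)
    rcases le_total ρ (b y y) with hby | hby
    · have : g t x - g t y = (θ x - θ y) • U (-t) (n t (U t x)) := by
        have e2 : θ y = 0 := cutoff_eq_zero hρ hby
        rw [hgz hby, e2, sub_zero, sub_zero]
      rw [this]
      refine e1.trans ?_
      have : 0 ≤ M * (|L| * M) * ‖x - y‖ := by positivity
      nlinarith
    · have e2 : g t x - g t y = (θ x - θ y) • U (-t) (n t (U t x))
          + θ y • U (-t) (n t (U t x) - n t (U t y)) := by
        simp only [g, map_sub, smul_sub, sub_smul]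
        abel
      have e3 : ‖θ y • U (-t) (n t (U t x) - n t (U t y))‖ ≤ M * (|L| * M) * ‖x - y‖ := by
        rw [norm_smul, Real.norm_eq_abs, abs_of_nonneg (cutoff_nonneg _ _)]
        calc θ y * ‖U (-t) (n t (U t x) - n t (U t y))‖
            ≤ 1 * (M * (|L| * (M * ‖x - y‖))) := by
              refine mul_le_mul (cutoff_le_one _ _) ?_ (norm_nonneg _) zero_le_one
              refine (h.norm_apply_le _ _).trans (mul_le_mul_of_nonneg_left ?_ hM)
              refine (hL t ht _ _ (by rwa [h.inv]) (by rwa [h.inv])).trans ?_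
              refine mul_le_mul (le_abs_self L) ?_ (norm_nonneg _) (abs_nonneg _)
              rw [← map_sub]
              exact h.norm_apply_le _ _
          _ = _ := by ring
      rw [e2]
      refine (norm_add_le _ _).trans ((add_le_add e1 e3).trans_eq ?_)
      ring
  obtain ⟨Z, hZ0, hZ⟩ := exists_solution_of_bounded hτ x₀ hB hc fun R => by
    rcases lt_or_ge R 0 with hR | hR
    · exact ⟨0, fun t _ x y hx => absurd (norm_nonneg x) (by linarith)⟩
    refine ⟨2 / ρ * (|C| * (R + R)) * (M * N) + M * (|L| * M), fun t ht x y hx hy => ?_⟩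
    rcases le_total (b x x) ρ with hbx | hbx
    · exact hone R hR t ht x y hx hy hbx
    · rcases le_total (b y y) ρ with hby | hby
      · rw [norm_sub_rev, norm_sub_rev x]
        exact hone R hR t ht y x hy hx hby
      · rw [hgz hbx, hgz hby, sub_zero, norm_zero]
        positivity
  -- The a priori inequality survives truncation, because the factor θ lies in [0, 1] and its right
  -- side is nonnegative. By `hx₀` the energy then stays below ρ/2, where the cutoff equals 1, so
  -- the truncated equation is the original one.
  have hE : ∀ t ∈ Icc 0 τ, b (Z t) (Z t) + d ≤ Real.exp (K * τ) * (b x₀ x₀ + d) := fun t ht => by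
    have hdb (s : ℝ) (hs : s ∈ Icc 0 τ) := h.deriv Z _ _ _ (hZ s hs)
    have h1 := exp_mul_le_of_hasDerivWithinAt (K := K) (d := d) hdb (fun s hs => by
      rcases le_total ρ (b (Z s) (Z s)) with hx | hx
      · rw [hgz hx, ← zero_smul ℝ (0 : E), h.smul_left, zero_mul, mul_zero]
        exact mul_nonneg hK0 (by linarith [hb0 (Z s)])
      · have e1 : b (g s (Z s)) (Z s) = θ (Z s) * b (n s (U s (Z s))) (U s (Z s)) := by
          rw [h.smul_left, ← h.inv s (U (-s) _), h.apply_neg]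
        have e2 := hK s hs (U s (Z s)) (by rwa [h.inv])
        rw [h.inv] at e2
        have e3 : 0 ≤ K * (b (Z s) (Z s) + d) := mul_nonneg hK0 (by linarith [hb0 (Z s)])
        rw [e1]
        have e4 := cutoff_nonneg ρ (b (Z s) (Z s))
        have e5 := cutoff_le_one ρ (b (Z s) (Z s))
        calc 2 * (θ (Z s) * b (n s (U s (Z s))) (U s (Z s)))
            = θ (Z s) * (2 * b (n s (U s (Z s))) (U s (Z s))) := by ring
          _ ≤ θ (Z s) * (K * (b (Z s) (Z s) + d)) := mul_le_mul_of_nonneg_left e2 e4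
          _ ≤ 1 * (K * (b (Z s) (Z s) + d)) := mul_le_mul_of_nonneg_right e5 e3
          _ = _ := one_mul _) ht
    rw [hZ0] at h1
    refine h1.trans (mul_le_mul_of_nonneg_right ?_ (by linarith [hb0 x₀]))
    exact Real.exp_le_exp.2 (mul_le_mul_of_nonneg_left ht.2 hK0)
  refine ⟨Z, hZ0, fun t ht => ?_, hE⟩
  have h1 : θ (Z t) = 1 := cutoff_eq_one hρ (by linarith [hE t ht])
  have h2 := hZ t ht
  simp only [g, h1, one_smul] at h2
  exact h2

/-- The product rule for `U(t) Z(t)`. -/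
theorem hasDerivWithinAt_apply {G : Type*} [NormedAddCommGroup G] [NormedSpace ℝ G]
    (h : IsEnergyGroup U b M c C) {J B : E →L[ℝ] G}
    (hJ : ∀ x t, HasDerivAt (fun s => J (U s x)) (B (U t x)) t) {Z : ℝ → E} {Z' : E} {s : Set ℝ}
    {t : ℝ} (hZ : HasDerivWithinAt Z Z' s t) :
    HasDerivWithinAt (fun r => J (U r (Z r))) (B (U t (Z t)) + J (U t Z')) s t := by
  -- U(r)Z(r) is split as U(r)(Z(r) − Z(t)) + U(r)Z(t). The first part is differentiable in E by
  -- joint continuity; only the second needs the weaker space G.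
  have h1 : HasDerivWithinAt (fun r => U r (Z r - Z t)) (U t Z') s t := by
    rw [hasDerivWithinAt_iff_tendsto_slope]
    have h2 := hasDerivWithinAt_iff_tendsto_slope.1 hZ
    have h3 : Tendsto (fun r => (r, slope Z t r)) (𝓝[s \ {t}] t) (𝓝 (t, Z')) :=
      (tendsto_nhdsWithin_of_tendsto_nhds tendsto_id).prodMk_nhds h2
    refine ((h.continuous_uncurry.tendsto (t, Z')).comp h3).congr fun r => ?_
    simp [slope_def_module]
  have h4 := (J.hasFDerivAt.comp_hasDerivWithinAt t h1).add (hJ (Z t) t).hasDerivWithinAt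
  rw [add_comm (B _)]
  refine h4.congr_of_eventuallyEq (Eventually.of_forall fun r => ?_) ?_
  · simp
  · simp

end IsEnergyGroup

end

/-! ### The relaxation group preserves the energy -/

section

variable {k : ℕ}

theorem energyForm_add_left (μ ε : ℝ) (W W' Z : State k) :
    energyForm μ ε (W + W') Z = energyForm μ ε W Z + energyForm μ ε W' Z := by
  simp only [energyForm, Prod.fst_add, Prod.snd_add, inner_add_left]
  ring

theorem energyForm_smul_left (μ ε r : ℝ) (W Z : State k) :
    energyForm μ ε (r • W) Z = r * energyForm μ ε W Z := by
  have h1 : (r • W).1 = r • W.1 := rfl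
  have h2 : (r • W).2.1 = r • W.2.1 := rfl
  have h3 : (r • W).2.2 = r • W.2.2 := rfl
  rw [energyForm, energyForm, h1, h2, h3]
  simp only [real_inner_smul_left]
  ring

theorem energyForm_comm (μ ε : ℝ) (W Z : State k) : energyForm μ ε W Z = energyForm μ ε Z W := by
  simp only [energyForm, real_inner_comm Z.1, real_inner_comm Z.2.1, real_inner_comm Z.2.2]
  ring

theorem energyForm_add_self (μ ε : ℝ) (W Z : State k) :
    energyForm μ ε (W + Z) (W + Z)
      = energyForm μ ε W W + 2 * energyForm μ ε W Z + energyForm μ ε Z Z := by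
  rw [energyForm_add_left, energyForm_comm μ ε W (W + Z), energyForm_comm μ ε Z (W + Z),
    energyForm_add_left, energyForm_add_left, energyForm_comm μ ε Z W]
  ring

theorem abs_energyForm_le (μ ε : ℝ) (W Z : State k) :
    |energyForm μ ε W Z| ≤ (|μ| + 2 * |ε| + |μ - ε| + |ε|) * ‖W‖ * ‖Z‖ := by
  have a1 (W : State k) : ‖W.1‖ ≤ ‖W‖ := norm_fst_le W
  have a2 (W : State k) : ‖W.2.1‖ ≤ ‖W‖ := (norm_fst_le W.2).trans (norm_snd_le W)
  have a3 (W : State k) : ‖W.2.2‖ ≤ ‖W‖ := (norm_snd_le W.2).trans (norm_snd_le W)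
  have h1 : |inner ℝ W.1 Z.1| ≤ ‖W‖ * ‖Z‖ := (abs_real_inner_le_norm _ _).trans
    (mul_le_mul (a1 W) (a1 Z) (norm_nonneg _) (norm_nonneg _))
  have h2 : |inner ℝ W.1 Z.2.2| ≤ ‖W‖ * ‖Z‖ := (abs_real_inner_le_norm _ _).trans
    (mul_le_mul (a1 W) (a3 Z) (norm_nonneg _) (norm_nonneg _))
  have h3 : |inner ℝ W.2.2 Z.1| ≤ ‖W‖ * ‖Z‖ := (abs_real_inner_le_norm _ _).trans
    (mul_le_mul (a3 W) (a1 Z) (norm_nonneg _) (norm_nonneg _))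
  have h4 : |inner ℝ W.2.1 Z.2.1| ≤ ‖W‖ * ‖Z‖ := (abs_real_inner_le_norm _ _).trans
    (mul_le_mul (a2 W) (a2 Z) (norm_nonneg _) (norm_nonneg _))
  have h5 : |inner ℝ W.2.2 Z.2.2| ≤ ‖W‖ * ‖Z‖ := (abs_real_inner_le_norm _ _).trans
    (mul_le_mul (a3 W) (a3 Z) (norm_nonneg _) (norm_nonneg _))
  rw [mul_assoc]
  generalize ‖W‖ * ‖Z‖ = p at *
  have e1 : |μ * inner ℝ W.1 Z.1| ≤ |μ| * p := by
    rw [abs_mul]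
    exact mul_le_mul_of_nonneg_left h1 (abs_nonneg _)
  have e2 : |ε * (inner ℝ W.1 Z.2.2 + inner ℝ W.2.2 Z.1)| ≤ |ε| * (p + p) := by
    rw [abs_mul]
    exact mul_le_mul_of_nonneg_left ((abs_add_le _ _).trans (add_le_add h2 h3)) (abs_nonneg _)
  have e3 : |(μ - ε) * inner ℝ W.2.1 Z.2.1| ≤ |μ - ε| * p := by
    rw [abs_mul]
    exact mul_le_mul_of_nonneg_left h4 (abs_nonneg _)
  have e4 : |ε * inner ℝ W.2.2 Z.2.2| ≤ |ε| * p := by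
    rw [abs_mul]
    exact mul_le_mul_of_nonneg_left h5 (abs_nonneg _)
  refine (abs_add_le _ _).trans ((add_le_add ((abs_add_le _ _).trans (add_le_add
    ((abs_sub _ _).trans (add_le_add e1 e2)) e3)) e4).trans_eq ?_)
  ring

/-- By symmetry of the form the difference factors as the form evaluated at W + Z and W − Z. -/
theorem abs_energyForm_sub_le (μ ε : ℝ) (W Z : State k) :
    |energyForm μ ε W W - energyForm μ ε Z Z|
      ≤ (|μ| + 2 * |ε| + |μ - ε| + |ε|) * (‖W‖ + ‖Z‖) * ‖W - Z‖ := by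
  have h : energyForm μ ε W W - energyForm μ ε Z Z = energyForm μ ε (W + Z) (W - Z) := by
    have e1 := energyForm_add_self μ ε (W - Z) Z
    have e2 := energyForm_add_left μ ε (W - Z) (Z + Z) (W - Z)
    have e3 := energyForm_add_left μ ε Z Z (W - Z)
    rw [sub_add_cancel] at e1
    rw [show W - Z + (Z + Z) = W + Z by abel] at e2
    rw [e2, e3, energyForm_comm μ ε Z (W - Z), e1]
    ring
  rw [h]
  refine (abs_energyForm_le μ ε _ _).trans ?_
  gcongr
  exact norm_add_le _ _

/-- Polarisation extends conservation of the quadratic form to the bilinear form. -/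
theorem exists_isEnergyGroup {μ ε : ℝ} (hε : 0 < ε) (hεμ : ε ≤ μ / 4) :
    ∃ (U : ℝ → State 3 →L[ℝ] State 3) (M C : ℝ),
      IsEnergyGroup U (energyForm μ ε) M (ε / 2) C ∧
      ∀ W t, HasDerivAt (fun s => State.incl (by norm_num : 2 ≤ 3) (U s W))
        (relaxL (k := 2) (μ / ε) (U t W)) t := by
  obtain ⟨U, h0, hadd, hbd, hcont, hinv, hd⟩ := exists_relaxGroup hε hεμ
  refine ⟨U, _, _, ⟨h0, hadd, hbd, hcont, fun t x y => ?_, energyForm_smul_left μ ε, by positivity,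
    norm_sq_le_energyForm hε hεμ, abs_energyForm_sub_le μ ε,
    fun f f' s t h => hasDerivWithinAt_energyForm μ ε h⟩, hd⟩
  have h1 := energyForm_add_self μ ε (U t x) (U t y)
  have h2 := energyForm_add_self μ ε x y
  rw [← map_add, hinv, hinv, hinv] at h1
  linarith

end

/-! ### Strong solutions as curves in Sobolev spaces -/

theorem Sob.val_add {V : Type} [NormedAddCommGroup V] [InnerProductSpace ℝ V] {k : ℕ}
    (u w : Sob k V) : (u + w).val = u.val + w.val := Sob.D_add u w 0

theorem Sob.val_sub {V : Type} [NormedAddCommGroup V] [InnerProductSpace ℝ V] {k : ℕ}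
    (u w : Sob k V) : (u - w).val = u.val - w.val := Sob.D_sub u w 0

theorem Sob.val_smul {V : Type} [NormedAddCommGroup V] [InnerProductSpace ℝ V] {k : ℕ}
    (c : ℝ) (u : Sob k V) : (c • u).val = c • u.val := Sob.D_smul c u 0

/-- The right-hand side of the relaxation system. -/
def relaxRHS (Φ : Sob 3 Mat → Sob 3 Mat) (μ ε : ℝ) (W : State 3) : State 2 :=
  (grad W.2.1, dvg W.2.2,
    (μ / ε) • grad W.2.1 + (1 / ε) • Sob.incl (by norm_num) (Φ W.1 - W.2.2))

theorem relaxRHS_trd_ae {T : Mat → Mat} {Φ : Sob 3 Mat → Sob 3 Mat}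
    (hΦ : ∀ F, (Φ F).val =ᵐ[volume] fun x => T (F.val x)) (μ ε : ℝ) (W : State 3) :
    (relaxRHS Φ μ ε W).2.2.val =ᵐ[volume] fun x =>
      (μ / ε) • (WithLp.toLp 2 fun p : Fin 3 × Fin 3 => W.2.1.pd p.2 x p.1 : Mat)
        + (1 / ε) • (T (W.1.val x) - W.2.2.val x) := by
  change ((μ / ε) • grad W.2.1 + (1 / ε) • Sob.incl _ (Φ W.1 - W.2.2) : Sob 2 Mat).val =ᵐ[volume] _
  rw [Sob.val_add, Sob.val_smul, Sob.val_smul, Sob.val_incl, Sob.val_sub]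
  filter_upwards [Lp.coeFn_add ((μ / ε) • (grad W.2.1).val) ((1 / ε) • ((Φ W.1).val - W.2.2.val)),
    Lp.coeFn_smul (μ / ε) (grad W.2.1).val, Lp.coeFn_smul (1 / ε) ((Φ W.1).val - W.2.2.val),
    Lp.coeFn_sub (Φ W.1).val W.2.2.val, hΦ W.1, grad_val_ae W.2.1] with x h1 h2 h3 h4 h5 h6
  rw [h1, Pi.add_apply, h2, h3, Pi.smul_apply, Pi.smul_apply, h4, Pi.sub_apply, h5, h6]

theorem continuous_grad {k : ℕ} : Continuous (grad : Sob (k + 1) Vec → Sob k Mat) :=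
  grad.continuous

theorem continuous_dvg {k : ℕ} : Continuous (dvg : Sob (k + 1) Mat → Sob k Vec) :=
  dvg.continuous

theorem Sob.continuous_incl {V : Type} [NormedAddCommGroup V] [InnerProductSpace ℝ V] {k l : ℕ}
    (h : k ≤ l) : Continuous (Sob.incl h : Sob l V → Sob k V) :=
  (Sob.inclL h).continuous.congr fun u => Sob.inclL_apply h u

theorem continuous_relaxRHS {Φ : Sob 3 Mat → Sob 3 Mat} (hΦ : Continuous Φ) (μ ε : ℝ) :
    Continuous (relaxRHS Φ μ ε) := by
  have h1 : Continuous fun W : State 3 => grad (k := 2) W.2.1 :=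
    continuous_grad.comp (continuous_fst.comp continuous_snd)
  have h2 : Continuous fun W : State 3 => dvg (k := 2) W.2.2 :=
    continuous_dvg.comp (continuous_snd.comp continuous_snd)
  have h3 : Continuous fun W : State 3 => Φ W.1 - W.2.2 :=
    (hΦ.comp continuous_fst).sub (continuous_snd.comp continuous_snd)
  have h4 : Continuous fun W : State 3 => Sob.incl (by norm_num : 2 ≤ 3) (Φ W.1 - W.2.2) :=
    (Sob.continuous_incl _).comp h3
  exact h1.prodMk (h2.prodMk ((h1.const_smul (μ / ε)).add (h4.const_smul (1 / ε))))

theorem contDiffOn_one_Icc {E : Type*} [NormedAddCommGroup E] [NormedSpace ℝ E] {τ : ℝ}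
    (hτ : 0 < τ) {f f' : ℝ → E} (hf : ∀ t ∈ Icc 0 τ, HasDerivWithinAt f (f' t) (Icc 0 τ) t)
    (hc : ContinuousOn f' (Icc 0 τ)) : ContDiffOn ℝ 1 f (Icc 0 τ) := by
  have := (contDiffOn_succ_iff_derivWithin (n := 0) (𝕜 := ℝ) (f := f) (uniqueDiffOn_Icc hτ)).2
    ⟨fun t ht => (hf t ht).differentiableWithinAt, by simp,
      contDiffOn_zero.2 (hc.congr fun t ht => (hf t ht).derivWithin (uniqueDiffOn_Icc hτ t ht))⟩
  simpa using this

/-- The componentwise almost everywhere equations are one evolution equation in H². Its right side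
is continuous along a curve continuous in H³, so C¹ regularity in H² is automatic. -/
theorem isRelaxationSolution_iff {T : Mat → Mat} {Φ : Sob 3 Mat → Sob 3 Mat}
    (hΦc : Continuous Φ) (hΦ : ∀ F, (Φ F).val =ᵐ[volume] fun x => T (F.val x)) {μ ε τ : ℝ}
    (hτ : 0 < τ) {U₀ : State 3} {U : ℝ → State 3} :
    IsRelaxationSolution T μ ε τ U₀ U ↔ U 0 = U₀ ∧ ContinuousOn U (Icc 0 τ) ∧
      ∀ t ∈ Icc 0 τ, HasDerivWithinAt (fun s => (State.incl (by norm_num) (U s) : State 2))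
        (relaxRHS Φ μ ε (U t)) (Icc 0 τ) t := by
  constructor
  · intro h
    refine ⟨h.initial, h.continuousOn, fun t ht => ?_⟩
    have hd := (h.contDiffOn.differentiableOn one_ne_zero t ht).hasDerivWithinAt
    have h1 := h.eq_F t ht
    have h2 := h.eq_v t ht
    have h3 := h.eq_S t ht
    generalize derivWithin (fun s => (State.incl (by norm_num) (U s) : State 2)) (Icc 0 τ) t = D
      at hd h1 h2 h3
    suffices D = relaxRHS Φ μ ε (U t) by rwa [← this]
    refine Prod.ext (Sob.ext_val (Lp.ext ?_)) (Prod.ext (Sob.ext_val (Lp.ext ?_))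
      (Sob.ext_val (Lp.ext ?_)))
    · filter_upwards [grad_val_ae (U t).2.1, ae_all_iff.2 fun i => ae_all_iff.2 (h1 i)] with x e1 e2
      refine Eq.trans ?_ e1.symm
      ext p
      exact e2 p.1 p.2
    · filter_upwards [dvg_val_ae (U t).2.2, ae_all_iff.2 h2] with x e1 e2
      refine Eq.trans ?_ e1.symm
      ext i
      exact e2 i
    · filter_upwards [relaxRHS_trd_ae hΦ μ ε (U t), ae_all_iff.2 fun i => ae_all_iff.2 (h3 i)]
        with x e1 e2
      rw [e1]
      ext p
      have := e2 p.1 p.2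
      simp only [PiLp.add_apply, PiLp.smul_apply, PiLp.sub_apply, smul_eq_mul]
      linear_combination this
  · rintro ⟨h0, hc, hd⟩
    have hdw (t : ℝ) (ht : t ∈ Icc 0 τ) := (hd t ht).derivWithin (uniqueDiffOn_Icc hτ t ht)
    refine ⟨h0, hc, ?_, fun t ht i α => ?_, fun t ht i => ?_, fun t ht i α => ?_⟩
    · exact contDiffOn_one_Icc hτ hd ((continuous_relaxRHS hΦc μ ε).comp_continuousOn hc)
    · rw [hdw t ht]
      filter_upwards [grad_val_ae (U t).2.1] with x e1
      exact congrArg (fun A : Mat => A (i, α)) e1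
    · rw [hdw t ht]
      filter_upwards [dvg_val_ae (U t).2.2] with x e1
      exact congrArg (fun A : Vec => A i) e1
    · rw [hdw t ht]
      filter_upwards [relaxRHS_trd_ae hΦ μ ε (U t)] with x e1
      rw [e1]
      simp only [PiLp.add_apply, PiLp.smul_apply, PiLp.sub_apply, smul_eq_mul]
      ring

/-! ### Lipschitz bounds near compact sets -/

/-- Compactness bounds the derivative on s, and a bound larger by one holds on a uniform thickening,
which fixes the radius r. It is applied to the curve t ↦ F̂(t) in H³. -/
theorem exists_lipschitz_near_compact {E G : Type*} [NormedAddCommGroup E] [NormedSpace ℝ E]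
    [NormedAddCommGroup G] [NormedSpace ℝ G] {Φ : E → G} (hΦ : ContDiff ℝ 1 Φ) {s : Set E}
    (hs : IsCompact s) :
    ∃ r > 0, ∃ L : ℝ, 0 ≤ L ∧ ∀ x ∈ s, ∀ y z, ‖y‖ < r → ‖z‖ < r →
      ‖Φ (x + y) - Φ (x + z)‖ ≤ L * ‖y - z‖ := by
  have hc : Continuous fun x => ‖fderiv ℝ Φ x‖ := (hΦ.continuous_fderiv one_ne_zero).norm
  obtain ⟨B, hB⟩ := (hs.image hc).bddAbove
  have hopen : IsOpen {x | ‖fderiv ℝ Φ x‖ < max B 0 + 1} := isOpen_lt hc continuous_const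
  obtain ⟨r, hr, hsub⟩ := hs.exists_thickening_subset_open hopen fun x hx =>
    lt_of_le_of_lt ((hB (mem_image_of_mem _ hx)).trans (le_max_left B 0)) (lt_add_one _)
  refine ⟨r, hr, max B 0 + 1, by positivity, fun x hx y z hy hz => ?_⟩
  have hmem {w : E} (hw : ‖w‖ < r) : x + w ∈ Metric.ball x r := by simpa using hw
  have := (convex_ball x r).norm_image_sub_le_of_norm_fderiv_le (𝕜 := ℝ) (f := Φ)
    (fun w _ => (hΦ.differentiable one_ne_zero) w)
    (fun w hw => (show ‖fderiv ℝ Φ w‖ < max B 0 + 1 from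
      hsub (Metric.mem_thickening_iff.2 ⟨x, hx, hw⟩)).le) (hmem hz) (hmem hy)
  simpa using this

/-! ### The equilibrium solution -/

theorem Sob.pdS_incl {V : Type} [NormedAddCommGroup V] [InnerProductSpace ℝ V] {k l : ℕ}
    (h : k + 1 ≤ l + 1) (j : Fin 3) (u : Sob (l + 1) V) :
    Sob.pdS j (Sob.incl h u) = Sob.incl (Nat.le_of_succ_le_succ h) (Sob.pdS j u) := by
  refine Sob.ext_D fun γ hγ => ?_
  rw [Sob.D_pdS _ _ hγ, Sob.D_incl _ _ (add_single_mem_multiIdx hγ j), Sob.D_incl _ _ hγ,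
    Sob.D_pdS _ _ (multiIdx_mono (Nat.le_of_succ_le_succ h) hγ)]

theorem Sob.incl_sum {V ι : Type} [NormedAddCommGroup V] [InnerProductSpace ℝ V] {k l : ℕ}
    (h : k ≤ l) (s : Finset ι) (u : ι → Sob l V) :
    Sob.incl h (∑ i ∈ s, u i) = ∑ i ∈ s, Sob.incl h (u i) := by
  simp only [← Sob.inclL_apply, map_sum]

theorem Sob.incl_add {V : Type} [NormedAddCommGroup V] [InnerProductSpace ℝ V] {k l : ℕ}
    (h : k ≤ l) (u w : Sob l V) : Sob.incl h (u + w) = Sob.incl h u + Sob.incl h w := rfl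

theorem Sob.incl_sub {V : Type} [NormedAddCommGroup V] [InnerProductSpace ℝ V] {k l : ℕ}
    (h : k ≤ l) (u w : Sob l V) : Sob.incl h (u - w) = Sob.incl h u - Sob.incl h w := rfl

theorem Sob.incl_smul {V : Type} [NormedAddCommGroup V] [InnerProductSpace ℝ V] {k l : ℕ}
    (h : k ≤ l) (c : ℝ) (u : Sob l V) : Sob.incl h (c • u) = c • Sob.incl h u := rfl

theorem Sob.incl_incl {V : Type} [NormedAddCommGroup V] [InnerProductSpace ℝ V] {k l m : ℕ}
    (h : k ≤ l) (h' : l ≤ m) (u : Sob m V) :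
    Sob.incl h (Sob.incl h' u) = Sob.incl (h.trans h') u := rfl

theorem grad_eq_sum {k : ℕ} (v : Sob (k + 1) Vec) :
    grad v = ∑ α, Sob.mapL (colMat α) (Sob.pdS α v) := by
  rw [grad, sum_apply]
  rfl

theorem dvg_eq_sum {k : ℕ} (M : Sob (k + 1) Mat) :
    dvg M = ∑ α, Sob.mapL (matCol α) (Sob.pdS α M) := by
  rw [dvg, sum_apply]
  rfl

theorem grad_incl {k l : ℕ} (h : k + 1 ≤ l + 1) (v : Sob (l + 1) Vec) :
    grad (Sob.incl h v) = Sob.incl (Nat.le_of_succ_le_succ h) (grad v) := by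
  simp only [grad_eq_sum, Sob.incl_sum, Sob.pdS_incl, Sob.mapL_incl]

theorem dvg_incl {k l : ℕ} (h : k + 1 ≤ l + 1) (M : Sob (l + 1) Mat) :
    dvg (Sob.incl h M) = Sob.incl (Nat.le_of_succ_le_succ h) (dvg M) := by
  simp only [dvg_eq_sum, Sob.incl_sum, Sob.pdS_incl, Sob.mapL_incl]

theorem grad_pd_ae {k : ℕ} (v : Sob (k + 2) Vec) (α : Fin 3) :
    (grad v).pd α =ᵐ[volume] fun x => WithLp.toLp 2 fun p : Fin 3 × Fin 3 =>
      v.D (Pi.single p.2 1 + Pi.single α 1) x p.1 := by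
  have h := grad_val_ae (Sob.pdS α v)
  have e1 : grad (Sob.pdS α v) = Sob.pdS α (grad v) := by
    simp only [grad_eq_sum, map_sum, Sob.pdS_mapL]
    refine Finset.sum_congr rfl fun β _ => congrArg _ ?_
    refine Sob.ext_D fun γ hγ => ?_
    rw [Sob.D_pdS _ _ hγ, Sob.D_pdS _ _ hγ, Sob.D_pdS _ _ (add_single_mem_multiIdx hγ _),
      Sob.D_pdS _ _ (add_single_mem_multiIdx hγ _), add_right_comm γ]
  rw [e1, Sob.val_pdS] at h
  filter_upwards [h] with x hx
  rw [hx]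
  ext p
  simp only [Sob.pd_eq]
  rw [Sob.D_pdS _ _ (single_mem_multiIdx _)]

theorem dvg_grad_ae {k : ℕ} (v : Sob (k + 2) Vec) :
    (dvg (grad v)).val =ᵐ[volume] fun x => WithLp.toLp 2 fun i : Fin 3 =>
      ∑ α, v.D (Pi.single α 2) x i := by
  filter_upwards [dvg_val_ae (grad v), ae_all_iff.2 fun α => grad_pd_ae v α] with x h1 h2
  rw [h1]
  ext i
  change ∑ α, (grad v).pd α x (i, α) = ∑ α, v.D (Pi.single α 2) x i
  refine Finset.sum_congr rfl fun α _ => ?_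
  rw [h2 α]
  change (v.D (Pi.single α 1 + Pi.single α 1)) x i = _
  have e : (Pi.single α 1 + Pi.single α 1 : Fin 3 → ℕ) = Pi.single α 2 := by
    rw [← Pi.single_add]
  rw [e]

theorem integrable_test_mul {ι : Type} [Fintype ι] {φ : X → ℝ} (hφ : IsTest φ)
    (u : L2 (EuclideanSpace ℝ ι)) (p : ι) : Integrable fun x => φ x * u x p := by
  have := (EuclideanSpace.proj (𝕜 := ℝ) p).integrable_comp (hφ.integrable_smul u)
  simpa using this

theorem integral_test_apply {ι : Type} [Fintype ι] {φ : X → ℝ} (hφ : IsTest φ)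
    (u : L2 (EuclideanSpace ℝ ι)) (p : ι) :
    (∫ x, φ x • u x) p = ∫ x, φ x * u x p := by
  have := (EuclideanSpace.proj (𝕜 := ℝ) p).integral_comp_comm (hφ.integrable_smul u)
  simpa using this.symm

theorem IsWeakDeriv.integral_mul {u w : L2 Mat} {α : Fin 3} (h : IsWeakDeriv (Pi.single α 1) u w)
    {φ : X → ℝ} (hφ : IsTest φ) (p : Fin 3 × Fin 3) :
    ∫ x, partialD α φ x * u x p = -∫ x, φ x * w x p := by
  have h1 := congrArg (fun A : Mat => A p) (h φ hφ)
  rw [multiD_single, sum_single_one] at h1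
  simp only [pow_one, PiLp.smul_apply, integral_test_apply (hφ.partialD α), integral_test_apply hφ]
    at h1
  simpa using h1

/-- If Ŝ differs from an L² function by an L² function, the constant T(0) is itself in L²(ℝ³), and
in infinite measure that forces it to vanish. So T(0) = 0 is hidden in the assumption on the initial
deviation. -/
theorem T_zero_of_isDeviation {T : Mat → Mat} (hT : ContDiff ℝ ∞ T) {μ : ℝ} {F : Sob 4 Mat}
    {v : Sob 4 Vec} {U W : State 3} (h : IsDeviation T μ F v U W) : T 0 = 0 := by
  obtain ⟨Φ, -, hΦ⟩ := exists_superpos_mat (T := fun A => T A - T 0) (hT.sub contDiff_const)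
    (sub_self _)
  have h1 := hΦ (Sob.incl (by norm_num) F)
  have hae : (fun _ => T 0) =ᵐ[volume] (U.2.2.val - W.2.2.val - μ • (grad v).val
      - (Φ (Sob.incl (by norm_num) F)).val : L2 Mat) := by
    filter_upwards [h.trd, h1, grad_val_ae v,
      Lp.coeFn_sub (U.2.2.val - W.2.2.val - μ • (grad v).val) (Φ (Sob.incl (by norm_num) F)).val,
      Lp.coeFn_sub (U.2.2.val - W.2.2.val) (μ • (grad v).val),
      Lp.coeFn_sub U.2.2.val W.2.2.val, Lp.coeFn_smul μ (grad v).val] with x e1 e2 e3 e4 e5 e6 e7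
    rw [e4, Pi.sub_apply, e5, Pi.sub_apply, e6, Pi.sub_apply, e7, Pi.smul_apply, e1, e2, e3,
      Sob.val_incl, equilibriumStress]
    abel
  have h2 := (memLp_congr_ae hae).2 (Lp.memLp _)
  rw [memLp_const_iff (by norm_num) (by norm_num)] at h2
  exact h2.resolve_right (by simp)

/-- The stress `T(F) + μ ∇v ∈ H³`. -/
def stress (Φ : Sob 3 Mat → Sob 3 Mat) (μ : ℝ) (F : Sob 4 Mat) (v : Sob 4 Vec) : Sob 3 Mat :=
  Φ (Sob.incl (by norm_num) F) + μ • grad v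

theorem stress_ae {T : Mat → Mat} {Φ : Sob 3 Mat → Sob 3 Mat}
    (hΦ : ∀ F, (Φ F).val =ᵐ[volume] fun x => T (F.val x)) (μ : ℝ) (F : Sob 4 Mat) (v : Sob 4 Vec) :
    (stress Φ μ F v).val =ᵐ[volume] equilibriumStress T μ F v := by
  rw [stress, Sob.val_add, Sob.val_smul]
  filter_upwards [Lp.coeFn_add (Φ (Sob.incl (by norm_num) F)).val (μ • (grad v).val),
    Lp.coeFn_smul μ (grad v).val, hΦ (Sob.incl (by norm_num) F), grad_val_ae v] with x h1 h2 h3 h4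
  rw [h1, Pi.add_apply, h2, Pi.smul_apply, h3, h4, equilibriumStress, Sob.val_incl]

/-- The distributional momentum equation holds in the strong sense. -/
theorem val_eq_dvg_stress {T : Mat → Mat} {Φ : Sob 3 Mat → Sob 3 Mat}
    (hΦ : ∀ F, (Φ F).val =ᵐ[volume] fun x => T (F.val x)) {μ : ℝ} {F : Sob 4 Mat} {v v' : Sob 4 Vec}
    (h : ∀ i : Fin 3, ∀ φ : X → ℝ, IsTest φ →
      ∫ x, φ x * (v'.val x i - μ * ∑ α : Fin 3, v.D (Pi.single α 2) x i)
        = - ∫ x, ∑ α : Fin 3, partialD α φ x * T (F.val x) (i, α)) :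
    v'.val = (dvg (stress Φ μ F v)).val := by
  refine eq_of_testL fun φ hφ => ?_
  rw [testL_apply, testL_apply]
  ext i
  rw [integral_test_apply hφ, integral_test_apply hφ]
  set Ψ : Sob 3 Mat := Φ (Sob.incl (by norm_num) F)
  have hΨ : Ψ.val =ᵐ[volume] fun x => T (F.val x) := by
    have := hΦ (Sob.incl (by norm_num) F)
    rwa [Sob.val_incl] at this
  have h1 : ∫ x, ∑ α : Fin 3, partialD α φ x * T (F.val x) (i, α)
      = -∫ x, φ x * (dvg Ψ).val x i := by
    calc ∫ x, ∑ α : Fin 3, partialD α φ x * T (F.val x) (i, α)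
        = ∫ x, ∑ α : Fin 3, partialD α φ x * Ψ.val x (i, α) := by
          refine integral_congr_ae ?_
          filter_upwards [hΨ] with x hx
          simp only [hx]
      _ = ∑ α : Fin 3, ∫ x, partialD α φ x * Ψ.val x (i, α) :=
          integral_finsetSum _ fun α _ => integrable_test_mul (hφ.partialD α) _ _
      _ = ∑ α : Fin 3, -∫ x, φ x * Ψ.pd α x (i, α) :=
          Finset.sum_congr rfl fun α _ =>
            (Ψ.isWeakDeriv (single_mem_multiIdx α)).integral_mul hφ (i, α)
      _ = -∫ x, ∑ α : Fin 3, φ x * Ψ.pd α x (i, α) := by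
          rw [integral_finsetSum _ fun α _ => integrable_test_mul hφ (Ψ.pd α) (i, α),
            Finset.sum_neg_distrib]
      _ = -∫ x, φ x * (dvg Ψ).val x i := by
          congr 1
          refine integral_congr_ae ?_
          filter_upwards [dvg_val_ae Ψ] with x hx
          simp only [hx, Finset.mul_sum]
  have h2 : ∫ x, φ x * (v'.val x i - μ * ∑ α : Fin 3, v.D (Pi.single α 2) x i)
      = (∫ x, φ x * v'.val x i) - μ * ∫ x, φ x * (dvg (grad v)).val x i := by
    rw [← integral_const_mul, ← integral_sub (integrable_test_mul hφ _ _)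
      ((integrable_test_mul hφ _ _).const_mul μ)]
    refine integral_congr_ae ?_
    filter_upwards [dvg_grad_ae v] with x hx
    simp only [hx]
    ring
  have h3 : ∫ x, φ x * (dvg (stress Φ μ F v)).val x i
      = (∫ x, φ x * (dvg Ψ).val x i) + μ * ∫ x, φ x * (dvg (grad v)).val x i := by
    rw [← integral_const_mul, ← integral_add (integrable_test_mul hφ _ _)
      ((integrable_test_mul hφ _ _).const_mul μ)]
    refine integral_congr_ae ?_
    have e0 : (dvg (stress Φ μ F v)).val = (dvg Ψ).val + μ • (dvg (grad v)).val := by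
      rw [stress, map_add, map_smul, Sob.val_add, Sob.val_smul]
    rw [e0]
    filter_upwards [Lp.coeFn_add (dvg Ψ).val (μ • (dvg (grad v)).val),
      Lp.coeFn_smul μ (dvg (grad v)).val] with x e1 e2
    rw [e1, Pi.add_apply, e2, Pi.smul_apply, PiLp.add_apply, PiLp.smul_apply, smul_eq_mul]
    ring
  have h4 := h i φ hφ
  rw [h1, h2, neg_neg] at h4
  linarith

/-- The equilibrium `(F̂, v̂, Ŝ)`. -/
def equilState (Φ : Sob 3 Mat → Sob 3 Mat) (μ : ℝ) (F : Sob 4 Mat) (v : Sob 4 Vec) : State 3 :=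
  (Sob.incl (by norm_num) F, Sob.incl (by norm_num) v, stress Φ μ F v)

theorem hasDerivWithinAt_incl {V : Type} [NormedAddCommGroup V] [InnerProductSpace ℝ V] {k l : ℕ}
    (h : k ≤ l) {f : ℝ → Sob l V} {f' : Sob l V} {s : Set ℝ} {t : ℝ}
    (hf : HasDerivWithinAt f f' s t) :
    HasDerivWithinAt (fun r => Sob.incl h (f r)) (Sob.incl h f') s t := by
  have := (Sob.inclL h).hasFDerivAt.comp_hasDerivWithinAt t hf
  simp only [Function.comp_def, Sob.inclL_apply] at this
  exact this

theorem contDiffOn_stress {Φ : Sob 3 Mat → Sob 3 Mat} (hΦ : ContDiff ℝ 1 Φ) (μ : ℝ)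
    {F : ℝ → Sob 4 Mat} {v : ℝ → Sob 4 Vec} {s : Set ℝ} (hF : ContDiffOn ℝ 1 F s)
    (hv : ContDiffOn ℝ 1 v s) : ContDiffOn ℝ 1 (fun t => stress Φ μ (F t) (v t)) s := by
  have h1 := (Sob.inclL (V := Mat) (by norm_num : 3 ≤ 4)).contDiff.comp_contDiffOn hF
  simp only [Function.comp_def, Sob.inclL_apply] at h1
  have h2 : ContDiffOn ℝ 1 (fun t => grad (k := 3) (v t)) s :=
    (grad (k := 3)).contDiff.comp_contDiffOn hv
  exact (hΦ.comp_contDiffOn h1).add (h2.const_smul μ)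

/-- The H⁴ regularity of F̂ and v̂ makes Ŝ a C¹ curve in H³, and R is its time derivative. The first
two equations have the form of the relaxation system exactly. -/
theorem exists_equilibrium_curve {T : Mat → Mat} {Φ : Sob 3 Mat → Sob 3 Mat}
    (hΦc : ContDiff ℝ 1 Φ) (hΦ : ∀ F, (Φ F).val =ᵐ[volume] fun x => T (F.val x)) {μ τ : ℝ}
    (hτ : 0 < τ) {F : ℝ → Sob 4 Mat} {v : ℝ → Sob 4 Vec} (h : IsEquilibriumSolution T μ τ F v) :
    ∃ R : ℝ → Sob 3 Mat, ContinuousOn R (Icc 0 τ) ∧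
      ContinuousOn (fun t => equilState Φ μ (F t) (v t)) (Icc 0 τ) ∧
      ∀ t ∈ Icc 0 τ, HasDerivWithinAt
        (fun s => State.incl (by norm_num : 2 ≤ 3) (equilState Φ μ (F s) (v s)))
        ((grad (equilState Φ μ (F t) (v t)).2.1, dvg (equilState Φ μ (F t) (v t)).2.2,
          Sob.incl (by norm_num) (R t)) : State 2) (Icc 0 τ) t := by
  have hS := contDiffOn_stress hΦc μ h.contDiffOn_F h.contDiffOn_v
  refine ⟨derivWithin (fun t => stress Φ μ (F t) (v t)) (Icc 0 τ),
    hS.continuousOn_derivWithin (uniqueDiffOn_Icc hτ) le_rfl, ?_, fun t ht => ?_⟩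
  · have h1 : ContinuousOn (fun t => Sob.incl (by norm_num : 3 ≤ 4) (F t)) (Icc 0 τ) :=
      (Sob.continuous_incl _).comp_continuousOn h.contDiffOn_F.continuousOn
    have h2 : ContinuousOn (fun t => Sob.incl (by norm_num : 3 ≤ 4) (v t)) (Icc 0 τ) :=
      (Sob.continuous_incl _).comp_continuousOn h.contDiffOn_v.continuousOn
    exact h1.prodMk (h2.prodMk hS.continuousOn)
  · have hF := (h.contDiffOn_F.differentiableOn one_ne_zero t ht).hasDerivWithinAt
    have hv := (h.contDiffOn_v.differentiableOn one_ne_zero t ht).hasDerivWithinAt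
    have hS' := (hS.differentiableOn one_ne_zero t ht).hasDerivWithinAt
    have eF := h.eq_F t ht
    have ev := h.eq_v t ht
    generalize derivWithin F (Icc 0 τ) t = F' at hF eF
    generalize derivWithin v (Icc 0 τ) t = v' at hv ev
    have e1 : Sob.incl (by norm_num : 2 ≤ 4) F'
        = grad (k := 2) (Sob.incl (by norm_num : 3 ≤ 4) (v t)) := by
      refine Sob.ext_val (Lp.ext ?_)
      rw [Sob.val_incl, grad_incl, Sob.val_incl]
      filter_upwards [grad_val_ae (v t), ae_all_iff.2 fun i => ae_all_iff.2 (eF i)] with x h1 h2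
      rw [h1]
      ext p
      exact h2 p.1 p.2
    have e2 : Sob.incl (by norm_num : 2 ≤ 4) v' = dvg (k := 2) (stress Φ μ (F t) (v t)) := by
      refine Sob.ext_val ?_
      rw [Sob.val_incl]
      exact val_eq_dvg_stress hΦ ev
    have d1 := hasDerivWithinAt_incl (by norm_num : 2 ≤ 4) hF
    have d2 := hasDerivWithinAt_incl (by norm_num : 2 ≤ 4) hv
    have d3 := hasDerivWithinAt_incl (by norm_num : 2 ≤ 3) hS'
    rw [e1] at d1
    rw [e2] at d2
    exact d1.prodMk (d2.prodMk d3)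

/-! ### The deviation equation and its ε-uniform estimate -/

/-- The nonlinearity of the deviation equation. -/
def deviationForce (Φ : Sob 3 Mat → Sob 3 Mat) (ε : ℝ) (A R : Sob 3 Mat) (W : State 3) : Sob 3 Mat :=
  (1 / ε) • (Φ (A + W.1) - Φ A - W.2.2) - R

theorem energyForm_stress {k : ℕ} (μ ε : ℝ) (N : Sob k Mat) (W : State k) :
    energyForm μ ε (0, 0, N) W = ε * inner ℝ N (W.2.2 - W.1) := by
  simp only [energyForm, inner_zero_left, inner_sub_right]
  ring

theorem norm_stress {k : ℕ} (N : Sob k Mat) : ‖((0, 0, N) : State k)‖ = ‖N‖ := by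
  simp [Prod.norm_def]

/-- The damping −2‖s‖² pays for two Young inequalities, 2(L + 1)‖f‖‖s‖ ≤ ‖s‖² + (L + 1)²‖f‖² and
2εR₀‖s‖ ≤ ‖s‖² + ε²R₀²; the term 2εR₀‖f‖ costs another ‖f‖² + ε²R₀². -/
theorem deviation_estimate {H : Type*} [NormedAddCommGroup H] [InnerProductSpace ℝ H]
    {q f s R : H} {L R₀ ε : ℝ} (hε : 0 ≤ ε)
    (hq : ‖q‖ ≤ L * ‖f‖) (hR : ‖R‖ ≤ R₀) :
    2 * inner ℝ (q - s - ε • R) (s - f)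
      ≤ ((L + 1) ^ 2 + 2 * L + 1) * ‖f‖ ^ 2 + 2 * R₀ ^ 2 * ε ^ 2 := by
  have hR₀ : 0 ≤ R₀ := (norm_nonneg _).trans hR
  have e1 := (abs_le.1 (abs_real_inner_le_norm q s)).2
  have e2 := (abs_le.1 (abs_real_inner_le_norm q f)).1
  have e3 := (abs_le.1 (abs_real_inner_le_norm s f)).2
  have e4 := (abs_le.1 (abs_real_inner_le_norm R s)).1
  have e5 := (abs_le.1 (abs_real_inner_le_norm R f)).2
  have hf := norm_nonneg f
  have hs := norm_nonneg s
  have g1 : ‖q‖ * ‖s‖ ≤ L * ‖f‖ * ‖s‖ := mul_le_mul_of_nonneg_right hq hs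
  have g2 : ‖q‖ * ‖f‖ ≤ L * ‖f‖ * ‖f‖ := mul_le_mul_of_nonneg_right hq hf
  have g4 : ε * (‖R‖ * ‖s‖) ≤ ε * (R₀ * ‖s‖) := by gcongr
  have g5 : ε * (‖R‖ * ‖f‖) ≤ ε * (R₀ * ‖f‖) := by gcongr
  have h4 : -(ε * inner ℝ R s) ≤ ε * (‖R‖ * ‖s‖) := by nlinarith
  have h5 : ε * inner ℝ R f ≤ ε * (‖R‖ * ‖f‖) := mul_le_mul_of_nonneg_left e5 hε
  simp only [inner_sub_left, inner_sub_right, real_inner_smul_left, real_inner_self_eq_norm_sq]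
  nlinarith [sq_nonneg (‖s‖ - (L + 1) * ‖f‖), sq_nonneg (‖s‖ - ε * R₀), sq_nonneg (‖f‖ - ε * R₀)]

theorem continuousOn_deviationForce {Φ : Sob 3 Mat → Sob 3 Mat} (hΦ : Continuous Φ) (ε : ℝ)
    {I : Set ℝ} {A R : ℝ → Sob 3 Mat} (hA : ContinuousOn A I) (hR : ContinuousOn R I) :
    ContinuousOn (fun p : ℝ × State 3 =>
      ((0, 0, deviationForce Φ ε (A p.1) (R p.1) p.2) : State 3)) (I ×ˢ univ) := by
  have c1 : ContinuousOn (fun p : ℝ × State 3 => A p.1) (I ×ˢ univ) :=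
    hA.comp continuousOn_fst fun p hp => hp.1
  have c2 : ContinuousOn (fun p : ℝ × State 3 => R p.1) (I ×ˢ univ) :=
    hR.comp continuousOn_fst fun p hp => hp.1
  have c3 : Continuous fun p : ℝ × State 3 => p.2.1 := continuous_fst.comp continuous_snd
  have c4 : Continuous fun p : ℝ × State 3 => p.2.2.2 :=
    continuous_snd.comp (continuous_snd.comp continuous_snd)
  have c5 : ContinuousOn (fun p : ℝ × State 3 => deviationForce Φ ε (A p.1) (R p.1) p.2)
      (I ×ˢ univ) :=
    ((((hΦ.comp_continuousOn (c1.add c3.continuousOn)).sub (hΦ.comp_continuousOn c1)).sub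
      c4.continuousOn).const_smul (1 / ε)).sub c2
  exact continuousOn_const.prodMk (continuousOn_const.prodMk c5)

theorem norm_deviationForce_le {Φ : Sob 3 Mat → Sob 3 Mat} {ε L R₀ : ℝ} (hε : 0 < ε) (hL : 0 ≤ L)
    {A R : Sob 3 Mat} (hR : ‖R‖ ≤ R₀) {x : State 3} (hx : ‖Φ (A + x.1) - Φ A‖ ≤ L * ‖x.1‖) :
    ‖((0, 0, deviationForce Φ ε A R x) : State 3)‖ ≤ 1 / ε * ((L + 1) * ‖x‖) + R₀ := by
  rw [norm_stress, deviationForce]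
  refine (norm_sub_le _ _).trans (add_le_add ?_ hR)
  rw [norm_smul, Real.norm_eq_abs, abs_of_pos (by positivity)]
  refine mul_le_mul_of_nonneg_left ?_ (by positivity)
  calc ‖Φ (A + x.1) - Φ A - x.2.2‖ ≤ L * ‖x‖ + ‖x‖ :=
        (norm_sub_le _ _).trans (add_le_add (hx.trans
          (mul_le_mul_of_nonneg_left (norm_fst_le x) hL))
          ((norm_snd_le x.2).trans (norm_snd_le x)))
    _ = (L + 1) * ‖x‖ := by ring

theorem norm_deviationForce_sub_le {Φ : Sob 3 Mat → Sob 3 Mat} {ε L : ℝ} (hε : 0 < ε) (hL : 0 ≤ L)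
    {A R : Sob 3 Mat} {x y : State 3} (h : ‖Φ (A + x.1) - Φ (A + y.1)‖ ≤ L * ‖x.1 - y.1‖) :
    ‖((0, 0, deviationForce Φ ε A R x) : State 3) - ((0, 0, deviationForce Φ ε A R y) : State 3)‖
      ≤ 1 / ε * (L + 1) * ‖x - y‖ := by
  have e1 : ((0, 0, deviationForce Φ ε A R x) : State 3)
      - ((0, 0, deviationForce Φ ε A R y) : State 3)
      = (0, 0, (1 / ε) • ((Φ (A + x.1) - Φ (A + y.1)) - (x.2.2 - y.2.2))) := by
    refine Prod.ext (sub_zero _) (Prod.ext (sub_zero _) ?_)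
    change deviationForce Φ ε A R x - deviationForce Φ ε A R y = _
    rw [deviationForce, deviationForce, sub_sub_sub_cancel_right, ← smul_sub]
    congr 1
    abel
  rw [e1, norm_stress, norm_smul, Real.norm_eq_abs, abs_of_pos (by positivity), mul_assoc]
  refine mul_le_mul_of_nonneg_left ?_ (by positivity)
  calc ‖Φ (A + x.1) - Φ (A + y.1) - (x.2.2 - y.2.2)‖
      ≤ L * ‖x - y‖ + ‖x - y‖ :=
        (norm_sub_le _ _).trans (add_le_add (h.trans
          (mul_le_mul_of_nonneg_left (norm_fst_le (x - y)) hL))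
          ((norm_snd_le (x - y).2).trans (norm_snd_le (x - y))))
    _ = (L + 1) * ‖x - y‖ := by ring

/-- Pairing with the energy multiplies the force by ε and cancels its 1/ε. The factor 2/μ in K comes
from bounding ‖F‖² by the energy; K does not involve ε. -/
theorem energyForm_deviationForce_le {Φ : Sob 3 Mat → Sob 3 Mat} {μ ε L R₀ K : ℝ} (hε : 0 < ε)
    (hεμ : ε ≤ μ / 4) (hL : 0 ≤ L) (hK : K = 2 / μ * ((L + 1) ^ 2 + 2 * L + 1) + 2 * R₀ ^ 2)
    {A R : Sob 3 Mat} (hR : ‖R‖ ≤ R₀) {x : State 3} (hx : ‖Φ (A + x.1) - Φ A‖ ≤ L * ‖x.1‖) :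
    2 * energyForm μ ε (0, 0, deviationForce Φ ε A R x) x
      ≤ K * (energyForm μ ε x x + ε ^ 2) := by
  have hμ : 0 < μ := by linarith
  have h1 := deviation_estimate (s := x.2.2) hε.le hx hR
  have h2 : 2 * energyForm μ ε (0, 0, deviationForce Φ ε A R x) x
      = 2 * inner ℝ (Φ (A + x.1) - Φ A - x.2.2 - ε • R) (x.2.2 - x.1) := by
    rw [energyForm_stress, ← real_inner_smul_left, deviationForce, smul_sub, smul_smul,
      mul_one_div_cancel hε.ne', one_smul]
  rw [h2]
  refine h1.trans ?_
  have h3 := energyForm_lower hε hεμ x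
  have h4 : 0 ≤ μ / 2 * ‖x.2.1‖ ^ 2 := by positivity
  have h5 : 0 ≤ ε / 2 * ‖x.2.2‖ ^ 2 := by positivity
  have h6 : ‖x.1‖ ^ 2 ≤ 2 / μ * energyForm μ ε x x := by
    rw [div_mul_eq_mul_div, le_div_iff₀ hμ]
    linarith
  have h7 : 0 ≤ energyForm μ ε x x := by
    have : 0 ≤ μ / 2 * ‖x.1‖ ^ 2 := by positivity
    linarith
  have h8 : 0 ≤ (L + 1) ^ 2 + 2 * L + 1 := by positivity
  have h9 : 0 ≤ 2 / μ * ((L + 1) ^ 2 + 2 * L + 1) * ε ^ 2 := by positivity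
  have h10 : 0 ≤ 2 * R₀ ^ 2 * energyForm μ ε x x := by positivity
  rw [hK]
  nlinarith [mul_le_mul_of_nonneg_left h6 h8]

/-- Variation of constants: the outer group cancels U(−t), so N enters the equation unchanged. -/
theorem hasDerivWithinAt_incl_group {U : ℝ → State 3 →L[ℝ] State 3} {μ ε M c C : ℝ}
    (hU : IsEnergyGroup U (energyForm μ ε) M c C)
    (hd : ∀ W t, HasDerivAt (fun s => State.incl (by norm_num : 2 ≤ 3) (U s W))
      (relaxL (k := 2) (μ / ε) (U t W)) t) {Z : ℝ → State 3} {N : State 3} {I : Set ℝ} {t : ℝ}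
    (hZ : HasDerivWithinAt Z (U (-t) N) I t) :
    HasDerivWithinAt (fun s => State.incl (by norm_num : 2 ≤ 3) (U s (Z s)))
      (relaxL (k := 2) (μ / ε) (U t (Z t)) + State.incl (by norm_num : 2 ≤ 3) N) I t := by
  have hd' (W : State 3) (t : ℝ) : HasDerivAt
      (fun s => State.inclL (by norm_num : 2 ≤ 3) (U s W)) (relaxL (k := 2) (μ / ε) (U t W)) t := by
    simp only [State.inclL_apply]
    exact hd W t
  have := hU.hasDerivWithinAt_apply hd' hZ
  rw [hU.apply_neg] at this
  simp only [State.inclL_apply] at this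
  exact this

/-- Solutions of the deviation equation. -/
theorem exists_deviation {Φ : Sob 3 Mat → Sob 3 Mat} (hΦ : Continuous Φ) {μ ε τ : ℝ} (hε : 0 < ε)
    (hεμ : ε ≤ μ / 4) (hτ : 0 ≤ τ) {A R : ℝ → Sob 3 Mat} (hA : ContinuousOn A (Icc 0 τ))
    (hRc : ContinuousOn R (Icc 0 τ)) {r L R₀ K : ℝ} (hr : 0 < r) (hL : 0 ≤ L)
    (hLip : ∀ t ∈ Icc 0 τ, ∀ f g, ‖f‖ < r → ‖g‖ < r →
      ‖Φ (A t + f) - Φ (A t + g)‖ ≤ L * ‖f - g‖)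
    (hR : ∀ t ∈ Icc 0 τ, ‖R t‖ ≤ R₀)
    (hK : K = 2 / μ * ((L + 1) ^ 2 + 2 * L + 1) + 2 * R₀ ^ 2) {W₀ : State 3}
    (hW₀ : Real.exp (K * τ) * (energyForm μ ε W₀ W₀ + ε ^ 2) ≤ μ * r ^ 2 / 8 / 2) :
    ∃ W : ℝ → State 3, W 0 = W₀ ∧ ContinuousOn W (Icc 0 τ) ∧
      (∀ t ∈ Icc 0 τ, HasDerivWithinAt (fun s => State.incl (by norm_num : 2 ≤ 3) (W s))
        (relaxL (k := 2) (μ / ε) (W t) + State.incl (by norm_num : 2 ≤ 3)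
          (0, 0, deviationForce Φ ε (A t) (R t) (W t))) (Icc 0 τ) t) ∧
      ∀ t ∈ Icc 0 τ, energyForm μ ε (W t) (W t) + ε ^ 2
        ≤ Real.exp (K * τ) * (energyForm μ ε W₀ W₀ + ε ^ 2) := by
  have hμ : 0 < μ := by linarith
  obtain ⟨U, M, C, hU, hd⟩ := exists_isEnergyGroup hε hεμ
  -- The threshold μr²/8 is chosen so that coercivity gives ‖F‖ ≤ r/2.
  have hsmall (x : State 3) (hx : energyForm μ ε x x ≤ μ * r ^ 2 / 8) : ‖x.1‖ < r := by
    have h1 := energyForm_lower hε hεμ x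
    have h2 : μ / 2 * ‖x.1‖ ^ 2 ≤ μ / 2 * (r / 2) ^ 2 := by
      have h3 : 0 ≤ μ / 2 * ‖x.2.1‖ ^ 2 := by positivity
      have h4 : 0 ≤ ε / 2 * ‖x.2.2‖ ^ 2 := by positivity
      linarith
    have h3 : ‖x.1‖ ≤ r / 2 := le_of_sq_le_sq (le_of_mul_le_mul_left h2 (by positivity)) (by positivity)
    linarith
  have hn1 {t : ℝ} (ht : t ∈ Icc 0 τ) {x : State 3} (hx : energyForm μ ε x x ≤ μ * r ^ 2 / 8) :
      ‖Φ (A t + x.1) - Φ (A t)‖ ≤ L * ‖x.1‖ := by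
    have := hLip t ht x.1 0 (hsmall x hx) (by simpa using hr)
    simpa using this
  obtain ⟨Z, hZ0, hZ, hE⟩ := hU.exists_semilinear hτ
    (continuousOn_deviationForce hΦ ε hA hRc) (ρ := μ * r ^ 2 / 8) (by positivity)
    -- This bound and the Lipschitz constant supplied below may blow up as ε → 0. They only serve
    -- solvability of the ODE; the growth rate K is independent of ε.
    (N := 1 / ε * ((L + 1) * Real.sqrt (μ * r ^ 2 / 8 / (ε / 2))) + R₀)
    (fun t ht x hx => (norm_deviationForce_le hε hL (hR t ht) (hn1 ht hx)).trans
      (by gcongr; exact hU.norm_le_sqrt hx))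
    (fun t ht x y hx hy => norm_deviationForce_sub_le hε hL
      (hLip t ht _ _ (hsmall x hx) (hsmall y hy)))
    (by rw [hK]; positivity) (by positivity)
    (fun t ht x hx => energyForm_deviationForce_le hε hεμ hL hK (hR t ht) (hn1 ht hx)) hW₀
  refine ⟨fun t => U t (Z t), ?_, ?_, fun t ht => ?_, fun t ht => ?_⟩
  · change U 0 (Z 0) = W₀
    rw [hU.zero, hZ0]
    rfl
  · exact hU.continuous_uncurry.comp_continuousOn
      (continuousOn_id.prodMk fun t ht => (hZ t ht).continuousWithinAt)
  · exact hasDerivWithinAt_incl_group hU hd (hZ t ht)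
  · change energyForm μ ε (U t (Z t)) (U t (Z t)) + ε ^ 2 ≤ _
    rw [hU.inv]
    exact hE t ht

/-! ### Existence of strong solutions -/

/-- The equilibrium contributes (1/ε)μ∇v̂ through its stress and (μ/ε)∇v̂ through its velocity;
these cancel, and the R in the force removes ∂ₜŜ. -/
theorem relaxRHS_add {Φ : Sob 3 Mat → Sob 3 Mat} {μ ε : ℝ} (F : Sob 4 Mat)
    (v : Sob 4 Vec) (R : Sob 3 Mat) (W : State 3) :
    ((grad (equilState Φ μ F v).2.1, dvg (equilState Φ μ F v).2.2,
      Sob.incl (by norm_num) R) : State 2) + (relaxL (k := 2) (μ / ε) W + State.incl (by norm_num : 2 ≤ 3)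
          (0, 0, deviationForce Φ ε (equilState Φ μ F v).1 R W))
      = relaxRHS Φ μ ε (equilState Φ μ F v + W) := by
  have z1 : Sob.incl (by norm_num : 2 ≤ 3) (0 : Sob 3 Mat) = 0 := rfl
  have z2 : Sob.incl (by norm_num : 2 ≤ 3) (0 : Sob 3 Vec) = 0 := rfl
  rw [relaxL_apply]
  refine Prod.ext ?_ (Prod.ext ?_ ?_)
  · change grad (equilState Φ μ F v).2.1 + (grad W.2.1 + Sob.incl (by norm_num) (0 : Sob 3 Mat))
      = grad ((equilState Φ μ F v).2.1 + W.2.1)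
    rw [z1, add_zero, map_add]
  · change dvg (equilState Φ μ F v).2.2 + (dvg W.2.2 + Sob.incl (by norm_num) (0 : Sob 3 Vec))
      = dvg ((equilState Φ μ F v).2.2 + W.2.2)
    rw [z2, add_zero, map_add]
  · change Sob.incl (by norm_num) R + ((μ / ε) • grad W.2.1 + Sob.incl (by norm_num)
        (deviationForce Φ ε (equilState Φ μ F v).1 R W))
      = (μ / ε) • grad ((equilState Φ μ F v).2.1 + W.2.1) + (1 / ε) • Sob.incl (by norm_num)
        (Φ ((equilState Φ μ F v).1 + W.1) - ((equilState Φ μ F v).2.2 + W.2.2))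
    have e1 : grad (equilState Φ μ F v).2.1 = Sob.incl (by norm_num : 2 ≤ 3) (grad (k := 3) v) :=
      grad_incl (by norm_num : 2 + 1 ≤ 3 + 1) v
    have e2 : (equilState Φ μ F v).2.2 = Φ (equilState Φ μ F v).1 + μ • grad v := rfl
    rw [map_add, e1, e2, deviationForce]
    generalize Φ (equilState Φ μ F v).1 = P
    generalize Φ ((equilState Φ μ F v).1 + W.1) = Q
    generalize grad v = G
    generalize W.2.2 = S
    generalize grad W.2.1 = H
    simp only [Sob.incl_add, Sob.incl_sub, Sob.incl_smul]
    generalize Sob.incl (by norm_num : 2 ≤ 3) P = P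
    generalize Sob.incl (by norm_num : 2 ≤ 3) Q = Q
    generalize Sob.incl (by norm_num : 2 ≤ 3) G = G
    generalize Sob.incl (by norm_num : 2 ≤ 3) R = R
    generalize Sob.incl (by norm_num : 2 ≤ 3) S = S
    have e3 : (1 / ε) • (μ • G) = (μ / ε) • G := by
      rw [smul_smul, one_div_mul_eq_div]
    simp only [smul_sub, smul_add, e3]
    abel

theorem isRelaxationSolution_add {T : Mat → Mat} {Φ : Sob 3 Mat → Sob 3 Mat}
    (hΦc : Continuous Φ) (hΦ : ∀ F, (Φ F).val =ᵐ[volume] fun x => T (F.val x)) {μ ε τ : ℝ}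
    (hτ : 0 < τ) {F : ℝ → Sob 4 Mat} {v : ℝ → Sob 4 Vec} {R : ℝ → Sob 3 Mat}
    (hUc : ContinuousOn (fun t => equilState Φ μ (F t) (v t)) (Icc 0 τ))
    (hU : ∀ t ∈ Icc 0 τ, HasDerivWithinAt
        (fun s => State.incl (by norm_num : 2 ≤ 3) (equilState Φ μ (F s) (v s)))
        ((grad (equilState Φ μ (F t) (v t)).2.1, dvg (equilState Φ μ (F t) (v t)).2.2,
          Sob.incl (by norm_num) (R t)) : State 2) (Icc 0 τ) t) {W : ℝ → State 3}
    (hWc : ContinuousOn W (Icc 0 τ))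
    (hW : ∀ t ∈ Icc 0 τ, HasDerivWithinAt (fun s => State.incl (by norm_num : 2 ≤ 3) (W s))
        (relaxL (k := 2) (μ / ε) (W t) + State.incl (by norm_num : 2 ≤ 3)
          (0, 0, deviationForce Φ ε (equilState Φ μ (F t) (v t)).1 (R t) (W t))) (Icc 0 τ) t) :
    IsRelaxationSolution T μ ε τ (equilState Φ μ (F 0) (v 0) + W 0)
      fun t => equilState Φ μ (F t) (v t) + W t := by
  refine (isRelaxationSolution_iff hΦc hΦ hτ).2 ⟨rfl, hUc.add hWc, fun t ht => ?_⟩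
  rw [← relaxRHS_add (F t) (v t) (R t)]
  exact (hU t ht).add (hW t ht)

/-! ### Uniqueness of strong solutions -/

theorem Sob.norm_zero_order {V : Type} [NormedAddCommGroup V] [InnerProductSpace ℝ V]
    (u : Sob 0 V) : ‖u‖ = ‖u.val‖ := by
  have h0 : multiIdx 0 = {0} := by
    ext γ
    rw [mem_multiIdx, Finset.mem_singleton]
    constructor
    · intro h
      ext i
      have := Finset.single_le_sum (f := γ) (fun j _ => Nat.zero_le _) (Finset.mem_univ i)
      simp only [Pi.zero_apply]
      omega
    · rintro rfl
      simp
  have h := Sob.norm_sq_eq u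
  rw [h0, Finset.sum_singleton] at h
  exact (sq_eq_sq₀ (norm_nonneg _) (norm_nonneg _)).1 h

/-- A bound in H³ is a bound in L^∞, on which T is Lipschitz pointwise; this yields an L² Lipschitz
estimate, all that uniqueness needs. -/
theorem exists_superpos_lipschitz {T : Mat → Mat} (hT : ContDiff ℝ ∞ T)
    {Φ : Sob 3 Mat → Sob 3 Mat} (hΦ : ∀ F, (Φ F).val =ᵐ[volume] fun x => T (F.val x)) (B : ℝ) :
    ∃ L : ℝ, 0 ≤ L ∧ ∀ F G : Sob 3 Mat, ‖F‖ ≤ B → ‖G‖ ≤ B →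
      ‖Sob.incl (Nat.zero_le 3) (Φ F - Φ G)‖ ≤ L * ‖Sob.incl (Nat.zero_le 3) (F - G)‖ := by
  obtain ⟨C, hC0, hC⟩ := exists_lipschitz_bound (hT.of_le (by norm_cast)) (‖linfMat‖ * B)
  refine ⟨C, hC0, fun F G hF hG => ?_⟩
  have hb {F : Sob 3 Mat} (hF : ‖F‖ ≤ B) : ∀ᵐ x, ‖F.val x‖ ≤ ‖linfMat‖ * B := by
    filter_upwards [linfMat_ae F, ae_norm_le_norm (linfMat F)] with x h1 h2
    rw [← h1]
    exact h2.trans ((linfMat.le_opNorm F).trans (mul_le_mul_of_nonneg_left hF (norm_nonneg _)))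
  rw [Sob.norm_zero_order, Sob.norm_zero_order, Sob.val_incl, Sob.val_incl, Sob.val_sub, Sob.val_sub]
  refine Lp.norm_le_mul_norm_of_ae_le_mul ?_
  filter_upwards [hb hF, hb hG, hΦ F, hΦ G, Lp.coeFn_sub (Φ F).val (Φ G).val,
    Lp.coeFn_sub F.val G.val] with x h1 h2 h3 h4 h5 h6
  rw [h5, Pi.sub_apply, h6, Pi.sub_apply, h3, h4]
  exact hC _ _ h2 h1

theorem energyForm_relax_zero_order {μ ε : ℝ} (hε : ε ≠ 0) (v : Sob 1 Vec) (S : Sob 1 Mat)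
    (f N : Sob 0 Mat) :
    energyForm μ ε ((grad v, dvg S, (μ / ε) • grad v + N) : State 0)
        (f, Sob.incl (Nat.le_succ 0) v, Sob.incl (Nat.le_succ 0) S)
      = ε * inner ℝ N (Sob.incl (Nat.le_succ 0) S - f) := by
  simp only [energyForm, inner_add_left, real_inner_smul_left, inner_sub_right]
  rw [inner_grad, ← real_inner_comm (Sob.incl (Nat.le_succ 0) v) (dvg S)]
  field_simp
  ring

theorem hasDerivWithinAt_incl_zero {f : ℝ → State 3} {f' : State 2} {I : Set ℝ} {t : ℝ}
    (h : HasDerivWithinAt (fun s => (State.incl (by norm_num) (f s) : State 2)) f' I t) :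
    HasDerivWithinAt (fun s => State.incl (Nat.zero_le 3) (f s)) (State.incl (Nat.zero_le 2) f')
      I t := by
  have := (State.inclL (Nat.zero_le 2)).hasFDerivAt.comp_hasDerivWithinAt t h
  simp only [Function.comp_def, State.inclL_apply] at this
  exact this

theorem incl_relaxRHS_sub (Φ : Sob 3 Mat → Sob 3 Mat) (μ ε : ℝ) (U V : State 3) :
    State.incl (Nat.zero_le 2) (relaxRHS Φ μ ε U) - State.incl (Nat.zero_le 2) (relaxRHS Φ μ ε V)
      = (grad (Sob.incl (by norm_num : 1 ≤ 3) (U.2.1 - V.2.1)),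
        dvg (Sob.incl (by norm_num : 1 ≤ 3) (U.2.2 - V.2.2)),
        (μ / ε) • grad (Sob.incl (by norm_num : 1 ≤ 3) (U.2.1 - V.2.1))
          + (1 / ε) • (Sob.incl (Nat.zero_le 3) (Φ U.1 - Φ V.1)
            - Sob.incl (Nat.zero_le 3) (U.2.2 - V.2.2))) := by
  have e1 : grad (Sob.incl (by norm_num : 1 ≤ 3) (U.2.1 - V.2.1))
      = Sob.incl (Nat.zero_le 2) (grad U.2.1) - Sob.incl (Nat.zero_le 2) (grad V.2.1) := by
    rw [grad_incl (k := 0) (l := 2) (by norm_num), map_sub, Sob.incl_sub]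
  have e2 : dvg (Sob.incl (by norm_num : 1 ≤ 3) (U.2.2 - V.2.2))
      = Sob.incl (Nat.zero_le 2) (dvg U.2.2) - Sob.incl (Nat.zero_le 2) (dvg V.2.2) := by
    rw [dvg_incl (k := 0) (l := 2) (by norm_num), map_sub, Sob.incl_sub]
  rw [e1, e2]
  refine Prod.ext rfl (Prod.ext rfl ?_)
  change Sob.incl (Nat.zero_le 2) ((μ / ε) • grad U.2.1
        + (1 / ε) • Sob.incl (by norm_num) (Φ U.1 - U.2.2))
      - Sob.incl (Nat.zero_le 2) ((μ / ε) • grad V.2.1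
        + (1 / ε) • Sob.incl (by norm_num) (Φ V.1 - V.2.2)) = _
  simp only [Sob.incl_add, Sob.incl_sub, Sob.incl_smul, Sob.incl_incl, smul_sub]
  abel

/-- Strong solutions are differentiable in time only in H², so the energy estimate for the
difference is made in L², where one spatial derivative may be integrated by parts. -/
theorem relaxation_solution_unique {T : Mat → Mat} (hT : ContDiff ℝ ∞ T)
    {Φ : Sob 3 Mat → Sob 3 Mat} (hΦc : Continuous Φ)
    (hΦ : ∀ F, (Φ F).val =ᵐ[volume] fun x => T (F.val x)) {μ ε τ : ℝ} (hε : 0 < ε)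
    (hεμ : ε ≤ μ / 4) (hτ : 0 < τ) {U₀ : State 3} {U V : ℝ → State 3}
    (hU : IsRelaxationSolution T μ ε τ U₀ U) (hV : IsRelaxationSolution T μ ε τ U₀ V) :
    EqOn V U (Icc 0 τ) := by
  have hμ : 0 < μ := by linarith
  obtain ⟨hU0, hUc, hUd⟩ := (isRelaxationSolution_iff hΦc hΦ hτ).1 hU
  obtain ⟨hV0, hVc, hVd⟩ := (isRelaxationSolution_iff hΦc hΦ hτ).1 hV
  obtain ⟨B₁, hB₁⟩ := isCompact_Icc.exists_bound_of_continuousOn hUc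
  obtain ⟨B₂, hB₂⟩ := isCompact_Icc.exists_bound_of_continuousOn hVc
  obtain ⟨L, hL, hLip⟩ := exists_superpos_lipschitz hT hΦ (max B₁ B₂)
  let D (t : ℝ) : State 0 := State.incl (Nat.zero_le 3) (U t) - State.incl (Nat.zero_le 3) (V t)
  have hD (t : ℝ) (ht : t ∈ Icc 0 τ) := hasDerivWithinAt_energyForm μ ε
    ((hasDerivWithinAt_incl_zero (hUd t ht)).sub (hasDerivWithinAt_incl_zero (hVd t ht)))
  have hest (t : ℝ) (ht : t ∈ Icc 0 τ) :
      2 * energyForm μ ε (State.incl (Nat.zero_le 2) (relaxRHS Φ μ ε (U t))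
        - State.incl (Nat.zero_le 2) (relaxRHS Φ μ ε (V t))) (D t)
      ≤ 2 / μ * ((L + 1) ^ 2 + 2 * L + 1) * (energyForm μ ε (D t) (D t) + 0) := by
    -- The inclusion into order zero is factored through order one, the form in which the
    -- integration by parts applies.
    have h1 : D t = (Sob.incl (Nat.zero_le 3) ((U t).1 - (V t).1),
      Sob.incl (Nat.le_succ 0) (Sob.incl (by norm_num : 1 ≤ 3) ((U t).2.1 - (V t).2.1)),
      Sob.incl (Nat.le_succ 0) (Sob.incl (by norm_num : 1 ≤ 3) ((U t).2.2 - (V t).2.2))) := rfl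
    have h2 := hLip (U t).1 (V t).1
      ((norm_fst_le _).trans ((hB₁ t ht).trans (le_max_left _ _)))
      ((norm_fst_le _).trans ((hB₂ t ht).trans (le_max_right _ _)))
    -- The equilibrium defect is absent from the difference of two solutions: the estimate is used
    -- with zero in place of R, so no ε² term remains.
    have h3 := deviation_estimate (s := Sob.incl (Nat.zero_le 3) ((U t).2.2 - (V t).2.2)) hε.le h2
      (norm_zero (E := Sob 0 Mat)).le
    have h4 := energyForm_lower hε hεμ (D t)
    have h5 : 0 ≤ μ / 2 * ‖(D t).2.1‖ ^ 2 := by positivity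
    have h6 : 0 ≤ ε / 2 * ‖(D t).2.2‖ ^ 2 := by positivity
    have h7 : ‖(D t).1‖ ^ 2 ≤ 2 / μ * energyForm μ ε (D t) (D t) := by
      rw [div_mul_eq_mul_div, le_div_iff₀ hμ]
      linarith
    have h8 : 2 * energyForm μ ε (State.incl (Nat.zero_le 2) (relaxRHS Φ μ ε (U t))
        - State.incl (Nat.zero_le 2) (relaxRHS Φ μ ε (V t))) (D t)
        ≤ ((L + 1) ^ 2 + 2 * L + 1) * ‖(D t).1‖ ^ 2 := by
      rw [incl_relaxRHS_sub, h1, energyForm_relax_zero_order hε.ne', ← real_inner_smul_left,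
        smul_smul, mul_one_div_cancel hε.ne', one_smul]
      rw [smul_zero, sub_zero, zero_pow two_ne_zero, mul_zero, zero_mul, add_zero] at h3
      exact h3
    refine h8.trans ?_
    have h9 : 0 ≤ (L + 1) ^ 2 + 2 * L + 1 := by positivity
    have := mul_le_mul_of_nonneg_left h7 h9
    linarith
  intro t ht
  have h : energyForm μ ε (D t) (D t) + 0
      ≤ Real.exp (2 / μ * ((L + 1) ^ 2 + 2 * L + 1) * t) * (energyForm μ ε (D 0) (D 0) + 0) :=
    exp_mul_le_of_hasDerivWithinAt (d := 0) hD hest ht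
  have hD0 : D 0 = 0 := by
    change State.incl (Nat.zero_le 3) (U 0) - State.incl (Nat.zero_le 3) (V 0) = 0
    rw [hU0, hV0, sub_self]
  have hz : energyForm μ ε (0 : State 0) 0 = 0 := by
    have := energyForm_smul_left (k := 0) μ ε 0 0 0
    rwa [zero_mul, zero_smul] at this
  rw [hD0, hz, add_zero, add_zero, mul_zero] at h
  have h1 := (norm_sq_le_energyForm hε hεμ (D t)).trans h
  have h2 : ‖D t‖ = 0 := by
    have : ‖D t‖ ^ 2 ≤ 0 := by
      by_contra! hc
      have : 0 < ε / 2 * ‖D t‖ ^ 2 := by positivity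
      linarith
    exact pow_eq_zero_iff two_ne_zero |>.1 (le_antisymm this (sq_nonneg _))
  have h3 : State.incl (Nat.zero_le 3) (U t) = State.incl (Nat.zero_le 3) (V t) :=
    sub_eq_zero.1 (norm_eq_zero.1 h2)
  have hinj {W : Type} [NormedAddCommGroup W] [InnerProductSpace ℝ W] [CompleteSpace W]
      {a b : Sob 3 W} (h : Sob.incl (Nat.zero_le 3) a = Sob.incl (Nat.zero_le 3) b) : b = a := by
    refine Sob.ext_val ?_
    rw [← Sob.val_incl (Nat.zero_le 3) a, h, Sob.val_incl]
  exact Prod.ext (hinj (congrArg Prod.fst h3)) (Prod.ext (hinj (congrArg (fun X => X.2.1) h3))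
    (hinj (congrArg (fun X => X.2.2) h3)))

/-! ### Deviations -/

theorem equilState_add_of_isDeviation {T : Mat → Mat} {Φ : Sob 3 Mat → Sob 3 Mat}
    (hΦ : ∀ F, (Φ F).val =ᵐ[volume] fun x => T (F.val x)) {μ : ℝ} {F : Sob 4 Mat} {v : Sob 4 Vec}
    {U W : State 3} (h : IsDeviation T μ F v U W) : equilState Φ μ F v + W = U := by
  refine Prod.ext ?_ (Prod.ext ?_ ?_)
  · change Sob.incl (by norm_num) F + W.1 = U.1
    rw [h.fst, add_sub_cancel]
  · change Sob.incl (by norm_num) v + W.2.1 = U.2.1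
    rw [h.snd, add_sub_cancel]
  · change stress Φ μ F v + W.2.2 = U.2.2
    refine Sob.ext_val (Lp.ext ?_)
    rw [Sob.val_add]
    filter_upwards [h.trd, stress_ae hΦ μ F v, Lp.coeFn_add (stress Φ μ F v).val W.2.2.val]
      with x h1 h2 h3
    rw [h3, Pi.add_apply, h1, h2, add_sub_cancel]

theorem isDeviation_equilState_add {T : Mat → Mat} {Φ : Sob 3 Mat → Sob 3 Mat}
    (hΦ : ∀ F, (Φ F).val =ᵐ[volume] fun x => T (F.val x)) {μ : ℝ} (F : Sob 4 Mat) (v : Sob 4 Vec)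
    (W : State 3) : IsDeviation T μ F v (equilState Φ μ F v + W) W := by
  refine ⟨(add_sub_cancel_left _ _).symm, (add_sub_cancel_left _ _).symm, ?_⟩
  change ∀ᵐ x, W.2.2.val x = (stress Φ μ F v + W.2.2).val x - _
  rw [Sob.val_add]
  filter_upwards [stress_ae hΦ μ F v, Lp.coeFn_add (stress Φ μ F v).val W.2.2.val] with x h2 h3
  rw [h3, Pi.add_apply, h2, add_sub_cancel_left]

/-- Coercivity controls F and v with weight μ/2 but S only with weight ε/2, hence the scaling of S
by √ε. -/
theorem norm_scaled_lt {μ ε δ E : ℝ} (hε : 0 < ε) (hεμ : ε ≤ μ / 4) (hδ : 0 < δ) {W : State 3}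
    (hE : energyForm μ ε W W ≤ E) (h : (2 / μ + 2) * E < δ ^ 2) :
    ‖((W.1, W.2.1, Real.sqrt ε • W.2.2) : State 3)‖ < δ := by
  have hμ : 0 < μ := by linarith
  have h1 := (energyForm_lower hε hεμ W).trans hE
  have a1 : 0 ≤ μ / 2 * ‖W.1‖ ^ 2 := by positivity
  have a2 : 0 ≤ μ / 2 * ‖W.2.1‖ ^ 2 := by positivity
  have a3 : 0 ≤ ε / 2 * ‖W.2.2‖ ^ 2 := by positivity
  have hE0 : 0 ≤ E := by linarith
  have hE1 : 2 / μ * E < δ ^ 2 := by nlinarith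
  have hE2 : 2 * E < δ ^ 2 := by
    have : 0 ≤ 2 / μ * E := by positivity
    linarith
  have key {a : ℝ} (ha : μ / 2 * a ^ 2 ≤ E) : a < δ := by
    refine lt_of_pow_lt_pow_left₀ 2 hδ.le (lt_of_le_of_lt ?_ hE1)
    rw [div_mul_eq_mul_div, le_div_iff₀ hμ]
    linarith
  rw [Prod.norm_def, Prod.norm_def, max_lt_iff, max_lt_iff]
  refine ⟨key (by linarith), key (by linarith), ?_⟩
  refine lt_of_pow_lt_pow_left₀ 2 hδ.le (lt_of_le_of_lt ?_ hE2)
  rw [norm_smul, Real.norm_eq_abs, abs_of_nonneg (Real.sqrt_nonneg _), mul_pow,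
    Real.sq_sqrt hε.le]
  linarith

/-- Well prepared data lead to strong solutions close to the equilibrium. -/
theorem exists_threshold {T : Mat → Mat} {Φ : Sob 3 Mat → Sob 3 Mat} (hΦc : ContDiff ℝ 1 Φ)
    (hΦ : ∀ F, (Φ F).val =ᵐ[volume] fun x => T (F.val x)) {μ τ : ℝ} (hμ : 0 < μ) (hτ : 0 < τ)
    {F : ℝ → Sob 4 Mat} {v : ℝ → Sob 4 Vec} (h : IsEquilibriumSolution T μ τ F v) :
    ∃ η > 0, ∃ C > 0, ∀ ε, 0 < ε → ε ≤ μ / 4 → ∀ W₀ : State 3,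
      ε ^ 2 + energyForm μ ε W₀ W₀ ≤ η → ∃ W : ℝ → State 3, W 0 = W₀ ∧
        IsRelaxationSolution T μ ε τ (equilState Φ μ (F 0) (v 0) + W 0)
          (fun t => equilState Φ μ (F t) (v t) + W t) ∧
        ∀ t ∈ Icc 0 τ, energyForm μ ε (W t) (W t) ≤ C * (ε ^ 2 + energyForm μ ε W₀ W₀) := by
  obtain ⟨R, hRc, hUc, hU⟩ := exists_equilibrium_curve hΦc hΦ hτ h
  have hAc : ContinuousOn (fun t => (equilState Φ μ (F t) (v t)).1) (Icc 0 τ) :=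
    continuous_fst.comp_continuousOn hUc
  obtain ⟨r, hr, L, hL, hLip⟩ := exists_lipschitz_near_compact hΦc
    (isCompact_Icc.image_of_continuousOn hAc)
  obtain ⟨R₀, hR₀⟩ := isCompact_Icc.exists_bound_of_continuousOn hRc
  set K : ℝ := 2 / μ * ((L + 1) ^ 2 + 2 * L + 1) + 2 * R₀ ^ 2 with hK
  -- η is the largest value for which the Grönwall bound stays below half of the threshold μr²/8; r,
  -- K and hence η and C are fixed by the equilibrium before ε is chosen.
  refine ⟨μ * r ^ 2 / 8 / 2 / Real.exp (K * τ), by positivity, Real.exp (K * τ), Real.exp_pos _,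
    fun ε hε hεμ W₀ hW₀ => ?_⟩
  rw [le_div_iff₀ (Real.exp_pos _)] at hW₀
  obtain ⟨W, hW0, hWc, hWd, hWE⟩ := exists_deviation hΦc.continuous hε hεμ hτ.le hAc hRc hr hL
    (fun t ht => hLip _ (mem_image_of_mem _ ht)) hR₀ hK (W₀ := W₀) (by linarith)
  refine ⟨W, hW0, isRelaxationSolution_add hΦc.continuous hΦ hτ hUc hU hWc hWd, fun t ht => ?_⟩
  have := hWE t ht
  have h2 : 0 ≤ ε ^ 2 := sq_nonneg ε
  linarith

end Visco

end

/-! ### The relaxation limit -/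

theorem mainTheorem1
    (T : Mat → Mat) (hT : ContDiff ℝ ∞ T) (μ : ℝ) (hμ : 0 < μ) (τ : ℝ) (hτ : 0 < τ)
    (Fhat : ℝ → Sob 4 Mat) (vhat : ℝ → Sob 4 Vec)
    (hequil : IsEquilibriumSolution T μ τ Fhat vhat)
    (U₀ W₀ : ℝ → State 3)
    (hW₀ : ∀ ε : ℝ, 0 < ε → IsDeviation T μ (Fhat 0) (vhat 0) (U₀ ε) (W₀ ε))
    (hprep : Tendsto (fun ε : ℝ => highEnergy μ ε (W₀ ε)) (𝓝[>] 0) (𝓝 0)) :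
    ∃ ε₀ : ℝ, 0 < ε₀ ∧ ∃ C : ℝ, 0 < C ∧ ∃ U W : ℝ → ℝ → State 3,
      (∀ ε : ℝ, 0 < ε → ε ≤ ε₀ →
        IsRelaxationSolution T μ ε τ (U₀ ε) (U ε) ∧
        (∀ V : ℝ → State 3, IsRelaxationSolution T μ ε τ (U₀ ε) V →
          EqOn V (U ε) (Icc 0 τ)) ∧
        ∀ t ∈ Icc 0 τ,
          IsDeviation T μ (Fhat t) (vhat t) (U ε t) (W ε t) ∧
          highEnergy μ ε (W ε t) ≤ C * (ε ^ 2 + highEnergy μ ε (W₀ ε))) ∧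
      TendstoUniformlyOn
        (fun ε t => ((W ε t).1, (W ε t).2.1, Real.sqrt ε • (W ε t).2.2))
        (fun _ => (0 : State 3)) (𝓝[>] 0) (Icc 0 τ) := by
  -- A deviation at a single ε, here 1, suffices to conclude T(0) = 0.
  obtain ⟨Φ, hΦc, hΦ⟩ := exists_superpos_mat hT (T_zero_of_isDeviation hT (hW₀ 1 one_pos))
  obtain ⟨η, hη, C, hC, key⟩ := exists_threshold hΦc hΦ hμ hτ hequil
  have hsq : Tendsto (fun ε : ℝ => ε ^ 2) (𝓝[>] 0) (𝓝 0) := by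
    have : Tendsto (fun ε : ℝ => ε ^ 2) (𝓝 0) (𝓝 (0 ^ 2)) := (continuous_pow 2).tendsto 0
    rw [zero_pow two_ne_zero] at this
    exact this.mono_left nhdsWithin_le_nhds
  have hsum : Tendsto (fun ε : ℝ => ε ^ 2 + highEnergy μ ε (W₀ ε)) (𝓝[>] 0) (𝓝 0) := by
    simpa using hsq.add hprep
  have hev : ∀ᶠ ε in 𝓝[>] (0 : ℝ), ε ≤ μ / 4 ∧ ε ^ 2 + highEnergy μ ε (W₀ ε) ≤ η :=
    Filter.Eventually.and (nhdsWithin_le_nhds (Iic_mem_nhds (show 0 < μ / 4 by positivity)))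
      (hsum.eventually (Iic_mem_nhds hη))
  obtain ⟨ε₀, hε₀, hsub⟩ := mem_nhdsGT_iff_exists_Ioc_subset.1 hev
  have hW (ε : ℝ) : ∃ W : ℝ → State 3, 0 < ε → ε ≤ ε₀ → W 0 = W₀ ε ∧
      IsRelaxationSolution T μ ε τ (equilState Φ μ (Fhat 0) (vhat 0) + W 0)
        (fun t => equilState Φ μ (Fhat t) (vhat t) + W t) ∧
      ∀ t ∈ Icc 0 τ, highEnergy μ ε (W t) ≤ C * (ε ^ 2 + highEnergy μ ε (W₀ ε)) := by
    by_cases hε : 0 < ε ∧ ε ≤ ε₀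
    · obtain ⟨h1, h2⟩ := hsub ⟨hε.1, hε.2⟩
      rw [highEnergy_eq hε.1.ne'] at h2
      obtain ⟨W, hW⟩ := key ε hε.1 h1 (W₀ ε) h2
      refine ⟨W, fun _ _ => ?_⟩
      simp only [highEnergy_eq hε.1.ne']
      exact hW
    -- Default value for ε outside (0, ε₀], where nothing is claimed.
    · exact ⟨fun _ => 0, fun h1 h2 => absurd ⟨h1, h2⟩ hε⟩
  choose W hW using hW
  refine ⟨ε₀, hε₀, C, hC, fun ε t => equilState Φ μ (Fhat t) (vhat t) + W ε t, W,
    fun ε hε hle => ?_, ?_⟩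
  · obtain ⟨h1, h2, h3⟩ := hW ε hε hle
    rw [h1, equilState_add_of_isDeviation hΦ (hW₀ ε hε)] at h2
    exact ⟨h2, fun V hV => relaxation_solution_unique hT hΦc.continuous hΦ hε (hsub ⟨hε, hle⟩).1 hτ
      h2 hV, fun t ht => ⟨isDeviation_equilState_add hΦ _ _ _, h3 t ht⟩⟩
  · refine Metric.tendstoUniformlyOn_iff.2 fun δ hδ => ?_
    -- The constant 2/μ + 2 is the one required by `norm_scaled_lt`; the bound does not depend on t,
    -- which makes the convergence uniform on [0, τ].
    have hlim : Tendsto (fun ε : ℝ => (2 / μ + 2) * (C * (ε ^ 2 + highEnergy μ ε (W₀ ε))))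
        (𝓝[>] 0) (𝓝 0) := by
      simpa using (hsum.const_mul C).const_mul (2 / μ + 2)
    filter_upwards [hlim.eventually (Iio_mem_nhds (pow_pos hδ 2)), Ioc_mem_nhdsGT hε₀]
      with ε h1 hε t ht
    have h2 := (hW ε hε.1 hε.2).2.2 t ht
    rw [dist_zero_left]
    rw [highEnergy_eq hε.1.ne' (W ε t)] at h2
    exact norm_scaled_lt hε.1 (hsub hε).1 hδ h2 h1
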